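/- **Setting.** Let $U\subseteq\mathbb R^n$ be open and $f:U\to\mathbb R^n$ smooth. Assume that the Jacobian $Df(u)$ has real eigenvalues $\lambda_1(u)<\dots<\lambda_n(u)$ with $\lambda_i(u)<\lambda_j(v)$ for all $u,v\in U$ and $i<j$; that for some $p\in\{1,\dots,n\}$ one has $\lambda_i<0$ on $U$ for $i\le p$ and $\lambda_i>0$ on $U$ for $i>p$; that every characteristic field is genuinely nonlinear ($\nabla\lambda_i\cdot r_i\neq0$ for the eigenvectors $r_i$ of $\lambda_i$); and that the system $u_t+f(u)_x=0$ is of Temple class, i.e. there is a smooth system of coordinates $w=(w_1,\dots,w_n)$ on $U$ consisting of Riemann invariants ($\nabla w_i\cdot r_j=0$ for $i\ne j$) whose level sets $\{u\in U: w_i(u)=\mathrm{const}\}$ are hyperplanes (intersected with $U$); the $w_i$ are oriented so that $\partial\lambda_i/\partial w_i>0$. Let $$\Gamma=\{u\in U:\ w_i(u)\in[\alpha_i,\beta_i],\ i=1,\dots,n\}$$ be convex and compact, let $a<b$, and let $\overline u\in L^\infty([a,b],\Gamma)$. Denote by $W(x/t;u_L,u_R)$ the self-similar entropy solution (shocks and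 centered rarefactions of the families $1,\dots,n$) of the Riemann problem with left and right states $u_L,u_R\in U$, and put $$\mathcal V_a(\tilde u)=\{W(0+;\tilde u,u_R):u_R\in U\},\qquad \mathcal V_b(\tilde u)=\{W(0-;u_L,\tilde u):u_L\in U\}.$$ Fix a constant $C>0$. For measurable $\tilde u_a,\tilde u_b:[0,T]\to U$, an *entropy weak solution* on $[0,T]\times[a,b]$ with data $\overline u,\tilde u_a,\tilde u_b$ is a measurable function $u:[0,T]\times[a,b]\to U$, continuous from $]0,T]$ into $L^1([a,b])$, such that, with $w_i(t,x)=w_i(u(t,x))$: (i) for every $C^1$ function $\phi:\mathbb R^2\to\mathbb R^n$ with compact support contained in $\{(t,x): a<x<b,\ t<T\}$, $$\int_0^T\!\!\int_a^b\big(u\cdot\phi_t+f(u)\cdot\phi_x\big)\,dx\,dt+\int_a^b\overline u(x)\cdot\phi(0,x)\,dx=0;$$ (ii) there are $\Psi_a,\Psi_b\in L^\infty([0,T],\mathbb R^n)$ with $f(u(\cdot,x))\rightharpoonup\Psi_a$ as $x\to a^+$ and $f(u(\cdot,x))\rightharpoonup\Psi_b$ as $x\to b^-$, weakly* in $L^\infty([0,T])$,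 and $\Psi_a(t)\in f(\mathcal V_a(\tilde u_a(t)))$, $\Psi_b(t)\in f(\mathcal V_b(\tilde u_b(t)))$ for a.e. $t\in[0,T]$; (iii) for every $0<t\le T$ and a.e. $a<x<y<b$, $$w_i(t,y)-w_i(t,x)\le C\Big\{\frac{y-x}{t}+\log\frac{b-x}{b-y}\Big\}\ (i\le p),\qquad w_i(t,y)-w_i(t,x)\le C\Big\{\frac{y-x}{t}+\log\frac{y-a}{x-a}\Big\}\ (i>p),$$ and for a.e. $a<x<b$ and a.e. $0<\tau_1<\tau_2\le T$, $$w_i(\tau_2,x)-w_i(\tau_1,x)\le C\Big\{\frac{\tau_2-\tau_1}{b-x}+\log\frac{\tau_2}{\tau_1}\Big\}\ (i\le p),\qquad w_i(\tau_1,x)-w_i(\tau_2,x)\le C\Big\{\frac{\tau_2-\tau_1}{x-a}+\log\frac{\tau_2}{\tau_1}\Big\}\ (i>p).$$ For $T>0$ let $\mathcal A(T)$ be the set of all profiles $u(T,\cdot)$ of $\Gamma$-valued entropy weak solutions $u$ on $[0,T]\times[a,b]$ with the fixed initial datum $\overline u$ and with boundary data $\tilde u_a,\tilde u_b\in L^\infty([0,T],\Gamma)$.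 **Theorem.** For each $T>0$ the attainable set $\mathcal A(T)$ is a compact subset of $L^1([a,b],\Gamma)$. -/

import Mathlib

open Set Filter Topology MeasureTheory
open scoped ContDiff ENNReal

/-- A system of conservation laws `u_t + f(u)_x = 0` on the open set `U ⊆ ℝⁿ`: smooth, strictly
hyperbolic (uniformly on `U`), genuinely nonlinear, of Temple class, with exactly `p` negative and
`n - p` positive characteristic speeds. The index `i : Fin n` stands for the family number `i + 1`,
so that the families `1, …, p` are those with `(i : ℕ) < p`. -/
structure TempleSystem (n : ℕ) where
  /-- the domain of the flux -/
  U : Set (EuclideanSpace ℝ (Fin n))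
  /-- the flux -/
  f : EuclideanSpace ℝ (Fin n) → EuclideanSpace ℝ (Fin n)
  /-- the characteristic speeds -/
  lam : Fin n → EuclideanSpace ℝ (Fin n) → ℝ
  /-- the Riemann coordinates -/
  w : Fin n → EuclideanSpace ℝ (Fin n) → ℝ
  /-- the number of negative speeds -/
  p : ℕ
  isOpen_U : IsOpen U
  smooth_f : ContDiffOn ℝ ∞ f U
  eigenvalue : ∀ u ∈ U, ∀ i,
    Module.End.HasEigenvalue
      ((fderiv ℝ f u : EuclideanSpace ℝ (Fin n) →L[ℝ] EuclideanSpace ℝ (Fin n)) :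
        EuclideanSpace ℝ (Fin n) →ₗ[ℝ] EuclideanSpace ℝ (Fin n)) (lam i u)
  /-- uniform strict hyperbolicity -/
  strictHyp : ∀ u ∈ U, ∀ v ∈ U, ∀ i j, i < j → lam i u < lam j v
  one_le_p : 1 ≤ p
  p_le : p ≤ n
  lam_neg : ∀ u ∈ U, ∀ i : Fin n, (i : ℕ) < p → lam i u < 0
  lam_pos : ∀ u ∈ U, ∀ i : Fin n, p ≤ (i : ℕ) → 0 < lam i u
  /-- genuine nonlinearity: `∇λᵢ · rᵢ ≠ 0` -/
  genuinelyNonlinear : ∀ u ∈ U, ∀ i r, r ≠ 0 → fderiv ℝ f u r = lam i u • r →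
    fderiv ℝ (lam i) u r ≠ 0
  smooth_w : ∀ i, ContDiffOn ℝ ∞ (w i) U
  /-- `w` is a system of coordinates on `U` -/
  injOn_w : InjOn (fun u i => w i u) U
  linearIndependent_w : ∀ u ∈ U, LinearIndependent ℝ (fun i => fderiv ℝ (w i) u)
  /-- the coordinates are Riemann invariants: `∇wᵢ · rⱼ = 0` for `j ≠ i` -/
  riemannInvariant : ∀ u ∈ U, ∀ i j r, i ≠ j → fderiv ℝ f u r = lam j u • r →
    fderiv ℝ (w i) u r = 0
  /-- the level sets of the Riemann invariants are hyperplanes (in `U`) -/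
  levelSet : ∀ i, ∀ u ∈ U, ∃ l : EuclideanSpace ℝ (Fin n) →L[ℝ] ℝ, l ≠ 0 ∧
    {v | v ∈ U ∧ w i v = w i u} = {v | v ∈ U ∧ l v = l u}
  /-- the orientation of the coordinates: `λᵢ` increases with `wᵢ`, i.e. `∂λᵢ/∂wᵢ > 0` -/
  orientation : ∀ u ∈ U, ∀ i r, r ≠ 0 → fderiv ℝ f u r = lam i u • r →
    0 < fderiv ℝ (lam i) u r * fderiv ℝ (w i) u r

namespace TempleSystem

variable {n : ℕ} (S : TempleSystem n)

/-- An (entropy admissible) wave of the `i`-th family with left state `z` and right state `z'`,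
filling the interval of speeds `[s, s']` of the self-similar profile `W`: no wave at all, a shock
with `s = s'`, or a centered rarefaction along the curve on which `wⱼ`, `j ≠ i`, are constant. -/
def IsWave (i : Fin n) (z z' : EuclideanSpace ℝ (Fin n)) (s s' : ℝ)
    (W : ℝ → EuclideanSpace ℝ (Fin n)) : Prop :=
  (z = z' ∧ s = S.lam i z ∧ s' = S.lam i z) ∨
  (S.w i z' < S.w i z ∧ s = s' ∧ S.f z' - S.f z = s • (z' - z) ∧
    S.lam i z' < s ∧ s < S.lam i z) ∨
  (S.w i z < S.w i z' ∧ s = S.lam i z ∧ s' = S.lam i z' ∧ s < s' ∧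
    ContinuousOn W (Icc s s') ∧ W s = z ∧ W s' = z' ∧
    ∀ ξ ∈ Icc s s', W ξ ∈ S.U ∧ S.lam i (W ξ) = ξ ∧ ∀ j, j ≠ i → S.w j (W ξ) = S.w j z)

/-- `(t, x) ↦ W (x / t)` is the solution of the Riemann problem with left state `uL` and right state
`uR`: the intermediate states `z k`, with Riemann coordinates
`(w₁(uR), …, w_k(uR), w_{k+1}(uL), …, w_n(uL))`, are separated by waves of the families
`1, …, n`, and `W` equals `z k` between the `k`-th wave and the next one. -/
def IsRiemannSolution (uL uR : EuclideanSpace ℝ (Fin n))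
    (W : ℝ → EuclideanSpace ℝ (Fin n)) : Prop :=
  ∃ (z : Fin (n + 1) → EuclideanSpace ℝ (Fin n)) (s s' : Fin n → ℝ),
    z 0 = uL ∧ z (Fin.last n) = uR ∧ (∀ k, z k ∈ S.U) ∧
    (∀ k i, S.w i (z k) = if i.castSucc < k then S.w i uR else S.w i uL) ∧
    (∀ i, S.IsWave i (z i.castSucc) (z i.succ) (s i) (s' i) W) ∧
    ∀ k ξ, (∀ i : Fin n, i.castSucc < k → s' i < ξ) → (∀ i : Fin n, k ≤ i.castSucc → ξ < s i) →
      W ξ = z k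

/-- The admissible states `W(0+; ũ, u_R)`, `u_R ∈ U`, at the left boundary. -/
def admissibleLeft (v : EuclideanSpace ℝ (Fin n)) : Set (EuclideanSpace ℝ (Fin n)) :=
  {z | ∃ uR ∈ S.U, ∃ W, S.IsRiemannSolution v uR W ∧ Tendsto W (𝓝[>] 0) (𝓝 z)}

/-- The admissible states `W(0-; u_L, ũ)`, `u_L ∈ U`, at the right boundary. -/
def admissibleRight (v : EuclideanSpace ℝ (Fin n)) : Set (EuclideanSpace ℝ (Fin n)) :=
  {z | ∃ uL ∈ S.U, ∃ W, S.IsRiemannSolution uL v W ∧ Tendsto W (𝓝[<] 0) (𝓝 z)}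

end TempleSystem

/-- `v(·, x)` converges to `Ψ` weakly* in `L^∞([0,T]; ℝⁿ)` as `x` tends along the filter `l`. -/
def HasWeakStarTrace {n : ℕ} (T : ℝ) (v : ℝ → ℝ → EuclideanSpace ℝ (Fin n)) (l : Filter ℝ)
    (Ψ : ℝ → EuclideanSpace ℝ (Fin n)) : Prop :=
  MemLp Ψ ∞ (volume.restrict (Icc 0 T)) ∧
  (∀ᶠ x in l, MemLp (fun t => v t x) ∞ (volume.restrict (Icc 0 T))) ∧
  ∀ g : ℝ → EuclideanSpace ℝ (Fin n), IntegrableOn g (Icc 0 T) →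
    Tendsto (fun x => ∫ t in Icc 0 T, inner ℝ (v t x) (g t)) l
      (𝓝 (∫ t in Icc 0 T, inner ℝ (Ψ t) (g t)))

/-- `u` is an entropy weak solution on `[0,T] × [a,b]` of the initial-boundary value problem with
initial datum `ubar` and boundary data `ua`, `ub`; `C` is the constant of the entropy conditions.
Only the values of `u` on `[0,T] × [a,b]` matter. -/
structure IsEntropyWeakSolution {n : ℕ} (S : TempleSystem n) (C a b T : ℝ)
    (ubar ua ub : ℝ → EuclideanSpace ℝ (Fin n)) (u : ℝ → ℝ → EuclideanSpace ℝ (Fin n)) :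
    Prop where
  mem_U : ∀ t ∈ Icc 0 T, ∀ x ∈ Icc a b, u t x ∈ S.U
  measurable : AEStronglyMeasurable (fun q : ℝ × ℝ => u q.1 q.2)
    (volume.restrict (Icc 0 T ×ˢ Icc a b))
  /-- `u` is continuous from `]0,T]` into `L¹` -/
  integrable : ∀ t ∈ Ioc 0 T, IntegrableOn (u t) (Icc a b)
  continuous : ∀ t₀ ∈ Ioc 0 T,
    Tendsto (fun t => ∫ x in Icc a b, ‖u t x - u t₀ x‖) (𝓝[Ioc 0 T] t₀) (𝓝 0)
  /-- `u` is a distributional solution of the Cauchy problem -/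
  weak : ∀ φ : ℝ × ℝ → EuclideanSpace ℝ (Fin n), ContDiff ℝ 1 φ → HasCompactSupport φ →
    tsupport φ ⊆ {q | q.1 < T ∧ a < q.2 ∧ q.2 < b} →
    IntegrableOn (fun q : ℝ × ℝ => inner ℝ (u q.1 q.2) (fderiv ℝ φ q (1, 0)) +
      inner ℝ (S.f (u q.1 q.2)) (fderiv ℝ φ q (0, 1))) (Icc 0 T ×ˢ Icc a b) ∧
    (∫ q in Icc 0 T ×ˢ Icc a b, (inner ℝ (u q.1 q.2) (fderiv ℝ φ q (1, 0)) +
      inner ℝ (S.f (u q.1 q.2)) (fderiv ℝ φ q (0, 1)))) +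
      ∫ x in Icc a b, inner ℝ (ubar x) (φ (0, x)) = 0
  /-- the flux has weak* traces, which satisfy the boundary conditions -/
  trace_left : ∃ Ψ, HasWeakStarTrace T (fun t x => S.f (u t x)) (𝓝[>] a) Ψ ∧
    ∀ᵐ t ∂(volume.restrict (Icc 0 T)), Ψ t ∈ S.f '' S.admissibleLeft (ua t)
  trace_right : ∃ Ψ, HasWeakStarTrace T (fun t x => S.f (u t x)) (𝓝[<] b) Ψ ∧
    ∀ᵐ t ∂(volume.restrict (Icc 0 T)), Ψ t ∈ S.f '' S.admissibleRight (ub t)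
  /-- decay of positive waves in space -/
  entropy_space_neg : ∀ i : Fin n, (i : ℕ) < S.p → ∀ t ∈ Ioc 0 T, ∀ᵐ q : ℝ × ℝ,
    a < q.1 → q.1 < q.2 → q.2 < b →
      S.w i (u t q.2) - S.w i (u t q.1) ≤
        C * ((q.2 - q.1) / t + Real.log ((b - q.1) / (b - q.2)))
  entropy_space_pos : ∀ i : Fin n, S.p ≤ (i : ℕ) → ∀ t ∈ Ioc 0 T, ∀ᵐ q : ℝ × ℝ,
    a < q.1 → q.1 < q.2 → q.2 < b →
      S.w i (u t q.2) - S.w i (u t q.1) ≤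
        C * ((q.2 - q.1) / t + Real.log ((q.2 - a) / (q.1 - a)))
  /-- decay of positive waves in time -/
  entropy_time_neg : ∀ i : Fin n, (i : ℕ) < S.p → ∀ᵐ x : ℝ, a < x → x < b → ∀ᵐ τ : ℝ × ℝ,
    0 < τ.1 → τ.1 < τ.2 → τ.2 ≤ T →
      S.w i (u τ.2 x) - S.w i (u τ.1 x) ≤
        C * ((τ.2 - τ.1) / (b - x) + Real.log (τ.2 / τ.1))
  entropy_time_pos : ∀ i : Fin n, S.p ≤ (i : ℕ) → ∀ᵐ x : ℝ, a < x → x < b → ∀ᵐ τ : ℝ × ℝ,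
    0 < τ.1 → τ.1 < τ.2 → τ.2 ≤ T →
      S.w i (u τ.1 x) - S.w i (u τ.2 x) ≤
        C * ((τ.2 - τ.1) / (x - a) + Real.log (τ.2 / τ.1))

/-- The set of all `u ∈ U` with `wᵢ(u) ∈ [αᵢ, βᵢ]`, `i = 1, …, n`. -/
def TempleSystem.box {n : ℕ} (S : TempleSystem n) (α β : Fin n → ℝ) :
    Set (EuclideanSpace ℝ (Fin n)) :=
  {u | u ∈ S.U ∧ ∀ i, S.w i u ∈ Icc (α i) (β i)}

/-- `v ∈ L^∞(s, Γ)`, for a bounded set `Γ`. -/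
def IsDatum {n : ℕ} (Γ : Set (EuclideanSpace ℝ (Fin n))) (s : Set ℝ)
    (v : ℝ → EuclideanSpace ℝ (Fin n)) : Prop :=
  AEStronglyMeasurable v (volume.restrict s) ∧ ∀ᵐ t ∂(volume.restrict s), v t ∈ Γ

/-- The attainable set at time `T`, as a set of classes in `L¹([a,b]; ℝⁿ)`: the profiles `u(T, ·)` of
the entropy weak solutions `u : [0,T] × [a,b] → Γ` with initial datum `ubar` and with boundary
controls in `L^∞([0,T], Γ)`. -/
def attainableSet {n : ℕ} (S : TempleSystem n) (Γ : Set (EuclideanSpace ℝ (Fin n)))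
    (C a b T : ℝ) (ubar : ℝ → EuclideanSpace ℝ (Fin n)) :
    Set (Lp (EuclideanSpace ℝ (Fin n)) 1 (volume.restrict (Icc a b))) :=
  {g | ∃ ua ub u, IsDatum Γ (Icc 0 T) ua ∧ IsDatum Γ (Icc 0 T) ub ∧
    IsEntropyWeakSolution S C a b T ubar ua ub u ∧
    (∀ t ∈ Icc 0 T, ∀ x ∈ Icc a b, u t x ∈ Γ) ∧
    g =ᵐ[volume.restrict (Icc a b)] u T}

/-!
The attainable set is shown to be sequentially compact: from a sequence of solutions with values in
the box `Γ` one extracts a subsequence whose profiles converge in `L¹` at every time `t ∈ ]0,T]`, and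
shows that the limit is again a solution, for suitable boundary data.

*Extraction.* At a fixed time the spatial entropy conditions say that `wᵢ(t, ·) - Θᵢ(t, ·)` is
nonincreasing for an explicit function `Θᵢ(t, ·)`, continuous on `]a, b[`. By Helly's principle the
functions with values in `Γ` satisfying these conditions form a compact subset of `L¹`
(`isCompact_setOf_isOneSided`; the coordinates `w` are injective on the compact set `Γ`, so that
convergence of the coordinates gives convergence of the states). By the weak form of the equation
the pairing of `u(t, ·)` with a fixed test function is Lipschitz in `t`, with a constant which
depends on `Γ` only (`IsWeakSolution.abs_pairing_sub_le`). On compact subsets of `L¹` convergence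
against test functions is convergence, so a subsequence which converges at a countable dense set of
times converges at all times, and the limit is a continuous curve in `L¹`
(`exists_subseq_tendsto_curves`, `continuousOn_of_pairing`). The weak form and the entropy
conditions then pass to the limit, along a further subsequence which converges a.e. in `(t, x)`.

*Boundary conditions.* The traces of the fluxes of the given solutions need not be followed. For any
weak solution the pairing of `f(u(·, x))` with a test function is Lipschitz in `x`, once `u(t, ·)` is
taken to be right-continuous; hence `f(u(·, x))` has weak* limits at both ends
(`exists_weakStarTrace`). The limits lie in the closed convex hull of `f(Γ)`, and the decisive point
is that `f(Γ)` is itself convex and `f` injective on `Γ` (`TempleSystem.convex_image_f`,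
`TempleSystem.injOn_f`). So the trace is `f(ũ)` for a bounded measurable `ũ` with values in `Γ`, and
with `ũ` as boundary datum the boundary condition holds because the constant `ũ(t)` solves the
Riemann problem with both states equal to `ũ(t)`.

*Convexity of `f(Γ)`.* Here the Temple structure enters. The differential of `wᵢ` is a left
eigenvector of `Df`, and it is a multiple of one fixed linear form along a level set of `wᵢ`; hence
`f` maps level hyperplanes into hyperplanes. A coordinate line is an intersection of such hyperplanes,
so it is straight, and `f` maps it to a line with the same direction, travelled with the sign of
`λᵢ`. It follows that for each face of `Γ` the set `f(Γ)` lies on one side of the hyperplane which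
contains the image of the face (`TempleSystem.exists_speed`). As `f` is locally open and preserves
the sides of level hyperplanes locally (`TempleSystem.eventually_w_sub`), a segment between two
points of `f(Γ)` cannot leave `f(Γ)`.
-/

/-! ### Left eigenvectors and level sets of the Riemann coordinates -/

namespace TempleSystem

variable {n : ℕ} (S : TempleSystem n)

theorem eq_zero_of_fderiv_w_eq_zero {u : EuclideanSpace ℝ (Fin n)} (hu : u ∈ S.U)
    {d : EuclideanSpace ℝ (Fin n)} (h : ∀ i, fderiv ℝ (S.w i) u d = 0) : d = 0 := by
  have hfin : Fintype.card (Fin n) =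
      Module.finrank ℝ (EuclideanSpace ℝ (Fin n) →L[ℝ] ℝ) := by
    rw [← (LinearMap.toContinuousLinearMap (𝕜 := ℝ) (E := EuclideanSpace ℝ (Fin n))
      (F' := ℝ)).finrank_eq]
    have h : Module.finrank ℝ (EuclideanSpace ℝ (Fin n) →ₗ[ℝ] ℝ) =
        Module.finrank ℝ (EuclideanSpace ℝ (Fin n)) := Subspace.dual_finrank_eq
    rw [h]; simp
  have hspan := (S.linearIndependent_w u hu).span_eq_top_of_card_eq_finrank' hfin
  have hle : (⊤ : Submodule ℝ (EuclideanSpace ℝ (Fin n) →L[ℝ] ℝ)) ≤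
      LinearMap.ker (ContinuousLinearMap.apply ℝ ℝ d :
        (EuclideanSpace ℝ (Fin n) →L[ℝ] ℝ) →L[ℝ] ℝ).toLinearMap := by
    rw [← hspan, Submodule.span_le]
    rintro _ ⟨i, rfl⟩
    simpa using h i
  have := hle (x := innerSL ℝ d) trivial
  simpa using this

/-- The differentials of the Riemann coordinates are left eigenvectors of the Jacobian. -/
theorem fderiv_w_fderiv_f {u : EuclideanSpace ℝ (Fin n)} (hu : u ∈ S.U) (i : Fin n)
    (d : EuclideanSpace ℝ (Fin n)) :
    fderiv ℝ (S.w i) u (fderiv ℝ S.f u d) = S.lam i u * fderiv ℝ (S.w i) u d := by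
  choose r hr using fun j => (S.eigenvalue u hu j).exists_hasEigenvector
  have hlin : LinearIndependent ℝ r := by
    refine Module.End.eigenvectors_linearIndependent' _ (fun j => S.lam j u) ?_ r hr
    intro j k hjk
    by_contra hne
    rcases lt_or_gt_of_ne hne with h | h
    · exact (S.strictHyp u hu u hu j k h).ne hjk
    · exact (S.strictHyp u hu u hu k j h).ne hjk.symm
  have hspan := hlin.span_eq_top_of_card_eq_finrank' (by simp)
  have hr' : ∀ j, fderiv ℝ S.f u (r j) = S.lam j u • r j := fun j => (hr j).apply_eq_smul
  have key : ((fderiv ℝ (S.w i) u).toLinearMap ∘ₗ (fderiv ℝ S.f u).toLinearMap) =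
      (S.lam i u) • (fderiv ℝ (S.w i) u).toLinearMap := by
    refine LinearMap.ext_on_range (v := r) hspan fun j => ?_
    simp only [LinearMap.comp_apply, ContinuousLinearMap.coe_coe, LinearMap.smul_apply, hr' j,
      map_smul, smul_eq_mul]
    rcases eq_or_ne i j with rfl | hij
    · rfl
    · rw [S.riemannInvariant u hu i j (r j) hij (hr' j)]; simp
  exact LinearMap.congr_fun key d

theorem lam_ne_zero {u : EuclideanSpace ℝ (Fin n)} (hu : u ∈ S.U) (i : Fin n) :
    S.lam i u ≠ 0 := by
  rcases lt_or_ge (i : ℕ) S.p with h | h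
  · exact (S.lam_neg u hu i h).ne
  · exact (S.lam_pos u hu i h).ne'

/-- The sign of the `i`-th characteristic speed, which does not depend on the state. -/
noncomputable def speedSign (i : Fin n) : ℝ := if (i : ℕ) < S.p then -1 else 1

theorem speedSign_mul_lam_pos {u : EuclideanSpace ℝ (Fin n)} (hu : u ∈ S.U) (i : Fin n) :
    0 < S.speedSign i * S.lam i u := by
  unfold speedSign
  split_ifs with h
  · linarith [S.lam_neg u hu i h]
  · linarith [S.lam_pos u hu i (not_lt.1 h)]

theorem fderiv_f_eq_smul {u : EuclideanSpace ℝ (Fin n)} (hu : u ∈ S.U) (i : Fin n)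
    {d : EuclideanSpace ℝ (Fin n)} (h : ∀ j, j ≠ i → fderiv ℝ (S.w j) u d = 0) :
    fderiv ℝ S.f u d = S.lam i u • d := by
  rw [← sub_eq_zero]
  refine S.eq_zero_of_fderiv_w_eq_zero hu fun k => ?_
  rw [map_sub, S.fderiv_w_fderiv_f hu, map_smul, smul_eq_mul]
  rcases eq_or_ne k i with rfl | hk
  · ring
  · rw [h k hk]; ring

theorem surjective_fderiv_f {u : EuclideanSpace ℝ (Fin n)} (hu : u ∈ S.U) :
    (fderiv ℝ S.f u).range = ⊤ := by
  have hinj : Function.Injective (fderiv ℝ S.f u).toLinearMap := by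
    rw [← LinearMap.ker_eq_bot, LinearMap.ker_eq_bot']
    intro d hd
    refine S.eq_zero_of_fderiv_w_eq_zero hu fun i => ?_
    have h := S.fderiv_w_fderiv_f hu i d
    rw [ContinuousLinearMap.coe_coe] at hd
    rw [hd, map_zero] at h
    exact (mul_eq_zero.1 h.symm).resolve_left (S.lam_ne_zero hu i)
  exact LinearMap.range_eq_top.2 (LinearMap.surjective_of_injective hinj)

theorem differentiableAt_f {u : EuclideanSpace ℝ (Fin n)} (hu : u ∈ S.U) :
    DifferentiableAt ℝ S.f u :=
  ((S.smooth_f.contDiffAt (S.isOpen_U.mem_nhds hu)).differentiableAt (by simp))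

theorem differentiableAt_w {u : EuclideanSpace ℝ (Fin n)} (hu : u ∈ S.U) (i : Fin n) :
    DifferentiableAt ℝ (S.w i) u :=
  (((S.smooth_w i).contDiffAt (S.isOpen_U.mem_nhds hu)).differentiableAt (by simp))

theorem map_nhds_f {u : EuclideanSpace ℝ (Fin n)} (hu : u ∈ S.U) :
    map S.f (𝓝 u) = 𝓝 (S.f u) :=
  ((S.smooth_f.contDiffAt (S.isOpen_U.mem_nhds hu)).hasStrictFDerivAt (by simp)).map_nhds_eq_of_surj
    (S.surjective_fderiv_f hu)

/-- The vector of all Riemann coordinates. -/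
def coords (u : EuclideanSpace ℝ (Fin n)) : Fin n → ℝ := fun i => S.w i u

theorem map_nhds_coords {u : EuclideanSpace ℝ (Fin n)} (hu : u ∈ S.U) :
    map S.coords (𝓝 u) = 𝓝 (S.coords u) := by
  have h : HasStrictFDerivAt S.coords
      (ContinuousLinearMap.pi fun i => fderiv ℝ (S.w i) u) u :=
    hasStrictFDerivAt_pi.2 fun i =>
      ((S.smooth_w i).contDiffAt (S.isOpen_U.mem_nhds hu)).hasStrictFDerivAt (by simp)
  refine h.map_nhds_eq_of_surj ?_
  have hinj : Function.Injective
      (ContinuousLinearMap.pi fun i => fderiv ℝ (S.w i) u).toLinearMap := by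
    rw [← LinearMap.ker_eq_bot, LinearMap.ker_eq_bot']
    intro d hd
    exact S.eq_zero_of_fderiv_w_eq_zero hu fun i => congrFun hd i
  refine LinearMap.range_eq_top.2 ?_
  exact (LinearMap.injective_iff_surjective_of_finrank_eq_finrank (by simp)).1 hinj

theorem continuousOn_f : ContinuousOn S.f S.U := S.smooth_f.continuousOn

theorem continuousOn_w (i : Fin n) : ContinuousOn (S.w i) S.U := (S.smooth_w i).continuousOn

theorem continuousOn_coords : ContinuousOn S.coords S.U :=
  continuousOn_pi.2 fun i => S.continuousOn_w i

/-- On the level set of `wᵢ` through `z`, which is cut out by a linear form `l`, the differentials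
of `wᵢ` are nonzero multiples of `l`. -/
theorem exists_levelSet_form {z : EuclideanSpace ℝ (Fin n)} (hz : z ∈ S.U) (i : Fin n) :
    ∃ l : EuclideanSpace ℝ (Fin n) →L[ℝ] ℝ, (∀ v ∈ S.U, S.w i v = S.w i z ↔ l v = l z) ∧
      ∀ q ∈ S.U, S.w i q = S.w i z → ∃ μ : ℝ, μ ≠ 0 ∧ fderiv ℝ (S.w i) q = μ • l := by
  obtain ⟨l, hl0, hl⟩ := S.levelSet i z hz
  have hiff : ∀ v ∈ S.U, S.w i v = S.w i z ↔ l v = l z := fun v hv =>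
    ⟨fun h => (hl.subset ⟨hv, h⟩ : v ∈ {v | v ∈ S.U ∧ l v = l z}).2,
      fun h => (hl.superset ⟨hv, h⟩ : v ∈ {v | v ∈ S.U ∧ S.w i v = S.w i z}).2⟩
  refine ⟨l, hiff, fun q hq hqz => ?_⟩
  obtain ⟨e, he⟩ : ∃ e, l e ≠ 0 := by
    by_contra! h
    exact hl0 (ContinuousLinearMap.ext h)
  have hker : ∀ v, l v = 0 → fderiv ℝ (S.w i) q v = 0 := by
    intro v hv
    have h1 : HasDerivAt (fun t : ℝ => S.w i (q + t • v)) (fderiv ℝ (S.w i) q v) 0 := by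
      have hd : HasFDerivAt (S.w i) (fderiv ℝ (S.w i) q) (q + (0 : ℝ) • v) := by
        simpa using (S.differentiableAt_w hq i).hasFDerivAt
      have hc : HasDerivAt (fun t : ℝ => q + t • v) v 0 := by
        simpa using ((hasDerivAt_id (0 : ℝ)).smul_const v).const_add q
      exact hd.comp_hasDerivAt (0 : ℝ) hc
    have h2 : (fun t : ℝ => S.w i (q + t • v)) =ᶠ[𝓝 0] fun _ => S.w i z := by
      have hc : Tendsto (fun t : ℝ => q + t • v) (𝓝 0) (𝓝 q) := by
        have : Continuous fun t : ℝ => q + t • v := by fun_prop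
        simpa using this.tendsto 0
      filter_upwards [hc.eventually (S.isOpen_U.mem_nhds hq)] with t ht
      rw [hiff _ ht]
      simp [hv, (hiff q hq).1 hqz]
    exact h1.unique ((hasDerivAt_const (0 : ℝ) (S.w i z)).congr_of_eventuallyEq h2)
  refine ⟨fderiv ℝ (S.w i) q e / l e, ?_, ?_⟩
  · intro h0
    have h0' : fderiv ℝ (S.w i) q e = 0 := (div_eq_zero_iff.1 h0).resolve_right he
    refine (S.linearIndependent_w q hq).ne_zero i (ContinuousLinearMap.ext fun x => ?_)
    have := hker (x - (l x / l e) • e) (by simp [he])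
    simpa [h0'] using this
  · ext x
    have := hker (x - (l x / l e) • e) (by simp [he])
    simp only [map_sub, map_smul, smul_eq_mul, sub_eq_zero] at this
    simp only [smul_apply, smul_eq_mul, this]
    field_simp

end TempleSystem

/-! ### Convexity of the image of a box under the flux, and constant Riemann problems -/

/-- A path which starts in the image `F(K)` of a compact set, and which cannot leave it
instantaneously, stays in it. -/
theorem mem_image_of_path {X Y : Type*} [TopologicalSpace X] [TopologicalSpace Y] [T2Space Y]
    {K : Set X} (hK : IsCompact K) {F : X → Y} (hF : ContinuousOn F K) {y : ℝ → Y}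
    (hy : Continuous y) (h0 : y 0 ∈ F '' K)
    (hstep : ∀ z ∈ K, ∀ θ ∈ Ico (0 : ℝ) 1, F z = y θ → ∀ᶠ θ' in 𝓝[Ioc θ 1] θ, y θ' ∈ F '' K) :
    ∀ θ ∈ Icc (0 : ℝ) 1, y θ ∈ F '' K := by
  have hcl : IsClosed (y ⁻¹' (F '' K)) := (hK.image_of_continuousOn hF).isClosed.preimage hy
  refine (hcl.inter isClosed_Icc).Icc_subset_of_forall_mem_nhdsWithin h0 ?_
  rintro θ ⟨⟨z, hz, hzθ⟩, hθ⟩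
  rw [← nhdsWithin_Ioc_eq_nhdsGT hθ.2]
  exact hstep z hz θ hθ hzθ

namespace TempleSystem

variable {n : ℕ} (S : TempleSystem n) {α β : Fin n → ℝ}

theorem box_subset : S.box α β ⊆ S.U := fun _ h => h.1

/-- In a compact box each Riemann coordinate can be given any of its values independently. -/
theorem exists_mem_box_update (hcompact : IsCompact (S.box α β)) {z v : EuclideanSpace ℝ (Fin n)}
    (hz : z ∈ S.box α β) (hv : v ∈ S.box α β) (i : Fin n) :
    ∃ q ∈ S.box α β, S.w i q = S.w i z ∧ ∀ j, j ≠ i → S.w j q = S.w j v := by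
  set y : ℝ → Fin n → ℝ := fun θ =>
    Function.update (S.coords v) i ((1 - θ) * S.w i v + θ * S.w i z) with hydef
  have hy : Continuous y := continuous_const.update i (by fun_prop)
  have hbox : ∀ θ ∈ Icc (0 : ℝ) 1, ∀ j, y θ j ∈ Icc (α j) (β j) := by
    intro θ hθ j
    rcases eq_or_ne j i with rfl | hj
    · simp only [hydef, Function.update_self]
      exact (convex_Icc (α j) (β j)) (hv.2 j) (hz.2 j) (sub_nonneg.2 hθ.2) hθ.1 (by ring)
    · simp only [hydef, Function.update_of_ne hj]
      exact hv.2 j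
  have h1 : y 1 ∈ S.coords '' S.box α β := by
    refine mem_image_of_path hcompact (S.continuousOn_coords.mono S.box_subset) hy
      ⟨v, hv, ?_⟩ ?_ 1 ⟨zero_le_one, le_rfl⟩
    · simp [hydef, coords]
    · intro q hq θ hθ hqθ
      have hev : ∀ᶠ c in 𝓝 (y θ), ∃ q' ∈ S.U, S.coords q' = c := by
        rw [← hqθ, ← S.map_nhds_coords hq.1, eventually_map]
        filter_upwards [S.isOpen_U.mem_nhds hq.1] with q' hq' using ⟨q', hq', rfl⟩
      filter_upwards [nhdsWithin_le_nhds (hy.continuousAt.eventually hev),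
        self_mem_nhdsWithin] with θ' hθ' hθ''
      obtain ⟨q', hq', hc⟩ := hθ'
      refine ⟨q', ⟨hq', fun j => ?_⟩, hc⟩
      have := hbox θ' ⟨hθ.1.trans hθ''.1.le, hθ''.2⟩ j
      rwa [← hc] at this
  obtain ⟨q, hq, hc⟩ := h1
  refine ⟨q, hq, ?_, fun j hj => ?_⟩
  · have := congrFun hc i
    simpa [hydef, coords] using this
  · have := congrFun hc j
    simpa [hydef, coords, hj] using this

theorem exists_segment_f_sub {K : Set (EuclideanSpace ℝ (Fin n))} (hK : Convex ℝ K)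
    (hKU : K ⊆ S.U) (l : EuclideanSpace ℝ (Fin n) →L[ℝ] ℝ) {x y : EuclideanSpace ℝ (Fin n)}
    (hx : x ∈ K) (hy : y ∈ K) :
    ∃ q ∈ segment ℝ x y, l (S.f y - S.f x) = l (fderiv ℝ S.f q (y - x)) := by
  obtain ⟨q, hq, h⟩ := domain_mvt (f := fun u => l (S.f u)) (s := K)
    (f' := fun u => l.comp (fderiv ℝ S.f u))
    (fun u hu => (l.hasFDerivAt.comp u
      (S.differentiableAt_f (hKU hu)).hasFDerivAt).hasFDerivWithinAt) hK hx hy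
  exact ⟨q, hq, by rw [map_sub]; exact h⟩

theorem apply_eq_of_mem_segment {l : EuclideanSpace ℝ (Fin n) →L[ℝ] ℝ}
    {x y q : EuclideanSpace ℝ (Fin n)} (hq : q ∈ segment ℝ x y) (h : l y = l x) : l q = l x := by
  obtain ⟨s, t, -, -, hst, rfl⟩ := hq
  simp only [map_add, map_smul, smul_eq_mul, h]
  rw [← add_mul, hst, one_mul]

/-- The normal form of the flux to a level set of `wᵢ` is constant on that level set. -/
theorem f_sub_eq_zero_of_levelSet {K : Set (EuclideanSpace ℝ (Fin n))} (hK : Convex ℝ K)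
    (hKU : K ⊆ S.U) {z q : EuclideanSpace ℝ (Fin n)} (hz : z ∈ K) (hq : q ∈ K) {i : Fin n}
    (hqz : fderiv ℝ (S.w i) z (q - z) = 0) :
    S.w i q = S.w i z ∧ fderiv ℝ (S.w i) z (S.f q - S.f z) = 0 := by
  obtain ⟨l, hl, hμ⟩ := S.exists_levelSet_form (hKU hz) i
  obtain ⟨μ, hμ0, hμz⟩ := hμ z (hKU hz) rfl
  have hlq : l q = l z := by
    rw [hμz] at hqz
    have := (mul_eq_zero.1 (by simpa [← mul_sub] using hqz : μ * (l q - l z) = 0)).resolve_left hμ0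
    linarith
  refine ⟨(hl q (hKU hq)).2 hlq, ?_⟩
  obtain ⟨m, hm, hfm⟩ := S.exists_segment_f_sub hK hKU l hz hq
  have hmU : m ∈ S.U := hKU (hK.segment_subset hz hq hm)
  obtain ⟨ν, hν0, hνm⟩ := hμ m hmU ((hl m hmU).2 (apply_eq_of_mem_segment hm hlq))
  have h := S.fderiv_w_fderiv_f hmU i (q - z)
  rw [hνm] at h
  simp only [smul_apply, smul_eq_mul, map_sub l q z, hlq, sub_self, mul_zero] at h
  rw [hμz, smul_apply, hfm, (mul_eq_zero.1 h).resolve_left hν0, smul_zero]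

/-- Measured along the normal to a level set of `wᵢ`, the flux is a multiple of the displacement,
with a factor of the sign of `λᵢ`: one may replace the base point by the projection of `v` to the
level set along the `i`-th coordinate line, which is straight. -/
theorem exists_speed {z v : EuclideanSpace ℝ (Fin n)}
    (hconvex : Convex ℝ (S.box α β)) (hcompact : IsCompact (S.box α β))
    (hz : z ∈ S.box α β) (hv : v ∈ S.box α β) (i : Fin n) :
    ∃ s : ℝ, 0 < S.speedSign i * s ∧
      fderiv ℝ (S.w i) z (S.f v - S.f z) = s * fderiv ℝ (S.w i) z (v - z) := by
  -- `q` shares the `i`-th coordinate with `z` and all the others with `v`: passing from `z` to `q`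
  -- stays in a level hyperplane of `wᵢ`, passing from `q` to `v` stays on a coordinate line.
  obtain ⟨q, hq, hqi, hqj⟩ := S.exists_mem_box_update hcompact hz hv i
  have hKU := S.box_subset (α := α) (β := β)
  have hlq : fderiv ℝ (S.w i) z (q - z) = 0 := by
    obtain ⟨l, hl, hμ⟩ := S.exists_levelSet_form (hKU hz) i
    obtain ⟨μ, -, hμz⟩ := hμ z (hKU hz) rfl
    rw [hμz, smul_apply, map_sub, (hl q hq.1).1 hqi, sub_self, smul_zero]
  have hfq := (S.f_sub_eq_zero_of_levelSet hconvex hKU hz hq hlq).2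
  obtain ⟨m, hm, hfm⟩ := S.exists_segment_f_sub hconvex hKU (fderiv ℝ (S.w i) z) hq hv
  have hmU : m ∈ S.U := hKU (hconvex.segment_subset hq hv hm)
  -- The coordinate line through `q` and `v` is straight, so `v - q` is an `i`-th eigenvector at every
  -- point of the segment.
  have hdir : fderiv ℝ S.f m (v - q) = S.lam i m • (v - q) := by
    refine S.fderiv_f_eq_smul hmU i fun j hj => ?_
    obtain ⟨l, hl, hμ⟩ := S.exists_levelSet_form (hKU hq) j
    have hlv : l v = l q := (hl v hv.1).1 (hqj j hj).symm
    obtain ⟨μ, -, hμm⟩ := hμ m hmU ((hl m hmU).2 (apply_eq_of_mem_segment hm hlv))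
    rw [hμm, smul_apply, map_sub, hlv, sub_self, smul_zero]
  refine ⟨S.lam i m, S.speedSign_mul_lam_pos hmU i, ?_⟩
  rw [hdir, map_smul, smul_eq_mul] at hfm
  have h1 : fderiv ℝ (S.w i) z (S.f v - S.f z) = fderiv ℝ (S.w i) z (S.f v - S.f q) := by
    rw [← sub_add_sub_cancel (S.f v) (S.f q) (S.f z), map_add, hfq, add_zero]
  have h2 : fderiv ℝ (S.w i) z (v - z) = fderiv ℝ (S.w i) z (v - q) := by
    rw [← sub_add_sub_cancel v q z, map_add, hlq, add_zero]
  rw [h1, h2, hfm]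

theorem injOn_f (hconvex : Convex ℝ (S.box α β)) (hcompact : IsCompact (S.box α β)) :
    InjOn S.f (S.box α β) := by
  intro z hz v hv hzv
  refine S.injOn_w hz.1 hv.1 (funext fun i => ?_)
  obtain ⟨s, hs, h⟩ := S.exists_speed hconvex hcompact hz hv i
  rw [hzv, sub_self, map_zero] at h
  have hs0 : s ≠ 0 := by rintro rfl; simp at hs
  exact (S.f_sub_eq_zero_of_levelSet hconvex S.box_subset hz hv
    ((mul_eq_zero.1 h.symm).resolve_left hs0)).1.symm

/-- Near `z`, the side of the level set of `wᵢ` through `z` on which a state lies is the side of the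
image of that level set on which its flux lies, up to the sign of `λᵢ`. -/
theorem eventually_w_sub {z : EuclideanSpace ℝ (Fin n)} (hz : z ∈ S.U) (i : Fin n) :
    ∀ᶠ v in 𝓝 z, ∃ s : ℝ, 0 < s ∧ S.w i v - S.w i z =
      s * (S.speedSign i * fderiv ℝ (S.w i) z (S.f v - S.f z)) := by
  set l := fderiv ℝ (S.w i) z with hl
  obtain ⟨e, he⟩ : ∃ e, l e = 1 := by
    obtain ⟨e, he⟩ : ∃ e, l e ≠ 0 := by
      by_contra! h
      exact (S.linearIndependent_w z hz).ne_zero i (ContinuousLinearMap.ext h)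
    exact ⟨(l e)⁻¹ • e, by simp [he]⟩
  have hcw : ContinuousAt (fun q => fderiv ℝ (S.w i) q e) z :=
    ((((S.smooth_w i).contDiffAt (S.isOpen_U.mem_nhds hz)).fderiv_right (m := 0)
      (by simp)).continuousAt).clm_apply continuousAt_const
  have hcf : ContinuousAt (fun q => S.speedSign i * l (fderiv ℝ S.f q e)) z :=
    continuousAt_const.mul (l.continuous.continuousAt.comp
      ((((S.smooth_f.contDiffAt (S.isOpen_U.mem_nhds hz)).fderiv_right (m := 0)
      (by simp)).continuousAt).clm_apply continuousAt_const))
  have hw : ∀ᶠ q in 𝓝 z, 0 < fderiv ℝ (S.w i) q e :=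
    hcw.eventually (lt_mem_nhds (by beta_reduce; rw [← hl, he]; exact one_pos))
  have hf : ∀ᶠ q in 𝓝 z, 0 < S.speedSign i * l (fderiv ℝ S.f q e) := by
    refine hcf.eventually (lt_mem_nhds ?_)
    beta_reduce
    rw [hl, S.fderiv_w_fderiv_f hz, ← hl, he, mul_one]
    exact S.speedSign_mul_lam_pos hz i
  obtain ⟨r, hr, hball⟩ := Metric.eventually_nhds_iff_ball.1
    (hw.and (hf.and (S.isOpen_U.mem_nhds hz)))
  set B := Metric.ball z r
  have hB : Convex ℝ B := convex_ball z r
  have hBU : B ⊆ S.U := fun q hq => (hball q hq).2.2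
  -- `v - l (v - z) • e` is the projection of `v` along `e` to the level hyperplane of `wᵢ` through
  -- `z`. On the segment from there to `v` both `wᵢ` and the sign-corrected flux increase with the
  -- component along `e`.
  have hproj : Tendsto (fun v => v - l (v - z) • e) (𝓝 z) (𝓝 z) := by
    have : Continuous fun v => v - l (v - z) • e := by fun_prop
    simpa using this.tendsto z
  filter_upwards [Metric.ball_mem_nhds z hr, hproj.eventually (Metric.ball_mem_nhds z hr)]
    with v hv hq
  set q := v - l (v - z) • e with hqdef
  set τ := l (v - z)
  have hvq : v - q = τ • e := by simp [hqdef]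
  have hlq : l (q - z) = 0 := by
    rw [show q - z = (v - z) - τ • e by rw [hqdef]; abel, map_sub, map_smul, he, smul_eq_mul,
      mul_one, sub_self]
  obtain ⟨hwq, hfq⟩ := S.f_sub_eq_zero_of_levelSet hB hBU (Metric.mem_ball_self hr) hq hlq
  obtain ⟨m, hm, hfm⟩ := S.exists_segment_f_sub hB hBU l hq hv
  obtain ⟨m', hm', hwm⟩ := domain_mvt (f := S.w i) (s := B) (f' := fun u => fderiv ℝ (S.w i) u)
    (fun u hu => (S.differentiableAt_w (hBU hu) i).hasFDerivAt.hasFDerivWithinAt) hB hq hv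
  have ha := (hball m' (hB.segment_subset hq hv hm')).1
  have hb := (hball m (hB.segment_subset hq hv hm)).2.1
  rw [hvq, map_smul, map_smul, smul_eq_mul] at hfm
  rw [hvq, map_smul, smul_eq_mul, hwq] at hwm
  have h1 : l (S.f v - S.f z) = l (S.f v - S.f q) := by
    rw [← sub_add_sub_cancel (S.f v) (S.f q) (S.f z), map_add, hfq, add_zero]
  refine ⟨fderiv ℝ (S.w i) m' e / (S.speedSign i * l (fderiv ℝ S.f m e)), div_pos ha hb, ?_⟩
  rw [h1, hfm, hwm, show S.speedSign i * (τ * l (fderiv ℝ S.f m e)) =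
    τ * (S.speedSign i * l (fderiv ℝ S.f m e)) by ring, div_mul_eq_mul_div, ← mul_assoc,
    mul_div_cancel_right₀ _ hb.ne', mul_comm]

theorem fderiv_w_sub_nonneg (hconvex : Convex ℝ (S.box α β)) {z u : EuclideanSpace ℝ (Fin n)}
    (hz : z ∈ S.box α β) (hu : u ∈ S.box α β) {i : Fin n} (hi : S.w i z = α i) :
    0 ≤ fderiv ℝ (S.w i) z (u - z) := by
  have hmin : IsLocalMinOn (S.w i) (S.box α β) z :=
    IsMinOn.localize (isMinOn_iff.2 fun q hq => by rw [hi]; exact (hq.2 i).1)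
  exact hmin.hasFDerivWithinAt_nonneg
    (S.differentiableAt_w hz.1 i).hasFDerivAt.hasFDerivWithinAt
    (sub_mem_posTangentConeAt_of_segment_subset (hconvex.segment_subset hz hu))

theorem fderiv_w_sub_nonpos (hconvex : Convex ℝ (S.box α β)) {z u : EuclideanSpace ℝ (Fin n)}
    (hz : z ∈ S.box α β) (hu : u ∈ S.box α β) {i : Fin n} (hi : S.w i z = β i) :
    fderiv ℝ (S.w i) z (u - z) ≤ 0 := by
  have hmax : IsLocalMaxOn (S.w i) (S.box α β) z :=
    IsMaxOn.localize (isMaxOn_iff.2 fun q hq => by rw [hi]; exact (hq.2 i).2)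
  exact hmax.hasFDerivWithinAt_nonpos
    (S.differentiableAt_w hz.1 i).hasFDerivAt.hasFDerivWithinAt
    (sub_mem_posTangentConeAt_of_segment_subset (hconvex.segment_subset hz hu))

/-- The flux maps a convex compact box onto a convex set. A segment between two points of the image
cannot leave the image: locally `f` is open, and at a face `wᵢ = const` of the box the image lies
on one side of the hyperplane which contains the image of the face. -/
theorem convex_image_f (hconvex : Convex ℝ (S.box α β)) (hcompact : IsCompact (S.box α β)) :
    Convex ℝ (S.f '' S.box α β) := by
  rw [convex_iff_segment_subset]
  rintro _ ⟨u, hu, rfl⟩ _ ⟨v, hv, rfl⟩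
  rw [segment_eq_image ℝ]
  rintro _ ⟨θ₀, hθ₀, rfl⟩
  set y : ℝ → EuclideanSpace ℝ (Fin n) := fun θ => (1 - θ) • S.f u + θ • S.f v with hydef
  have hy : Continuous y := by fun_prop
  -- The set of parameters with `y θ` in the compact image is closed; it remains to see that it does
  -- not stop at any `θ`: near a preimage `z` of `y θ` there is a preimage in the box of `y θ'`, for all
  -- `θ'` slightly beyond `θ`.
  refine mem_image_of_path hcompact (S.continuousOn_f.mono S.box_subset) hy
    ⟨u, hu, by simp [hydef]⟩ ?_ θ₀ hθ₀
  intro z hz θ hθ hzθ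
  have hloc : ∀ᶠ q in 𝓝 z, q ∈ S.U ∧ ∀ i,
      (α i < S.w i z → α i < S.w i q) ∧ (S.w i z < β i → S.w i q < β i) ∧
      ∃ s : ℝ, 0 < s ∧ S.w i q - S.w i z =
      s * (S.speedSign i * fderiv ℝ (S.w i) z (S.f q - S.f z)) := by
    refine Eventually.and (S.isOpen_U.mem_nhds hz.1) (eventually_all.2 fun i => ?_)
    have hc : ContinuousAt (S.w i) z := (S.differentiableAt_w hz.1 i).continuousAt
    refine Eventually.and ?_ (Eventually.and ?_ (S.eventually_w_sub hz.1 i))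
    · by_cases h : α i < S.w i z
      · filter_upwards [hc.eventually (lt_mem_nhds h)] with q hq _ using hq
      · exact Eventually.of_forall fun _ h' => absurd h' h
    · by_cases h : S.w i z < β i
      · filter_upwards [hc.eventually (gt_mem_nhds h)] with q hq _ using hq
      · exact Eventually.of_forall fun _ h' => absurd h' h
  have hev : ∀ᶠ c in 𝓝 (y θ), ∃ q, S.f q = c ∧ (q ∈ S.U ∧ ∀ i,
      (α i < S.w i z → α i < S.w i q) ∧ (S.w i z < β i → S.w i q < β i) ∧
      ∃ s : ℝ, 0 < s ∧ S.w i q - S.w i z =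
      s * (S.speedSign i * fderiv ℝ (S.w i) z (S.f q - S.f z))) := by
    rw [← hzθ, ← S.map_nhds_f hz.1, eventually_map]
    filter_upwards [hloc] with q hq using ⟨q, rfl, hq⟩
  filter_upwards [nhdsWithin_le_nhds (hy.continuousAt.eventually hev),
    self_mem_nhdsWithin] with θ' hθ' hmem
  obtain ⟨q, hqf, hqU, hq⟩ := hθ'
  refine ⟨q, ⟨hqU, fun i => ?_⟩, hqf⟩
  obtain ⟨hqα, hqβ, s, hs, hws⟩ := hq i
  have hθ0 : 0 ≤ θ' := hθ.1.trans hmem.1.le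
  have hθ1 : 0 ≤ 1 - θ' := sub_nonneg.2 hmem.2
  have hsplit : S.f q - S.f z = (1 - θ') • (S.f u - S.f z) + θ' • (S.f v - S.f z) := by
    rw [hqf, hydef]; module
  obtain ⟨su, hsu, hfu⟩ := S.exists_speed hconvex hcompact hz hu i
  obtain ⟨sv, hsv, hfv⟩ := S.exists_speed hconvex hcompact hz hv i
  have hval : S.speedSign i * fderiv ℝ (S.w i) z (S.f q - S.f z) =
      (1 - θ') * ((S.speedSign i * su) * fderiv ℝ (S.w i) z (u - z)) +
      θ' * ((S.speedSign i * sv) * fderiv ℝ (S.w i) z (v - z)) := by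
    rw [hsplit, map_add, map_smul, map_smul, hfu, hfv, smul_eq_mul, smul_eq_mul]; ring
  rw [hval] at hws
  constructor
  -- Constraints inactive at `z` persist by continuity. At an active one both fluxes `f u`, `f v` lie
  -- on the inner side of the image of the face, hence so does their convex combination `f q`.
  · rcases (hz.2 i).1.lt_or_eq with h | h
    · exact (hqα h).le
    · have h1 := S.fderiv_w_sub_nonneg hconvex hz hu h.symm
      have h2 := S.fderiv_w_sub_nonneg hconvex hz hv h.symm
      have : 0 ≤ S.w i q - S.w i z := by rw [hws]; positivity
      linarith
  · rcases (hz.2 i).2.lt_or_eq with h | h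
    · exact (hqβ h).le
    · have h1 := S.fderiv_w_sub_nonpos hconvex hz hu h
      have h2 := S.fderiv_w_sub_nonpos hconvex hz hv h
      have : S.w i q - S.w i z ≤ 0 := by
        rw [hws]
        exact mul_nonpos_of_nonneg_of_nonpos hs.le (add_nonpos
          (mul_nonpos_of_nonneg_of_nonpos hθ1 (mul_nonpos_of_nonneg_of_nonpos hsu.le h1))
          (mul_nonpos_of_nonneg_of_nonpos hθ0 (mul_nonpos_of_nonneg_of_nonpos hsv.le h2)))
      linarith

/-- A constant state solves its own Riemann problem. -/
theorem isRiemannSolution_const {v : EuclideanSpace ℝ (Fin n)} (hv : v ∈ S.U) :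
    S.IsRiemannSolution v v fun _ => v :=
  ⟨fun _ => v, fun i => S.lam i v, fun i => S.lam i v, rfl, rfl, fun _ => hv,
    fun k i => by simp, fun i => Or.inl ⟨rfl, rfl, rfl⟩, fun _ _ _ _ => rfl⟩

theorem self_mem_admissibleLeft {v : EuclideanSpace ℝ (Fin n)} (hv : v ∈ S.U) :
    v ∈ S.admissibleLeft v :=
  ⟨v, hv, _, S.isRiemannSolution_const hv, tendsto_const_nhds⟩

theorem self_mem_admissibleRight {v : EuclideanSpace ℝ (Fin n)} (hv : v ∈ S.U) :
    v ∈ S.admissibleRight v :=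
  ⟨v, hv, _, S.isRiemannSolution_const hv, tendsto_const_nhds⟩

end TempleSystem

/-! ### Test functions, weak derivatives and one-sided averages -/

/-- `ψ` is a test function of class `C¹` on the open interval `]a, b[`. -/
structure IsTestFunction (a b : ℝ) (ψ : ℝ → ℝ) : Prop where
  contDiff : ContDiff ℝ 1 ψ
  hasCompactSupport : HasCompactSupport ψ
  tsupport_subset : tsupport ψ ⊆ Ioo a b

theorem IsTestFunction.eq_zero {a b : ℝ} {ψ : ℝ → ℝ} (h : IsTestFunction a b ψ) {x : ℝ}
    (hx : x ∉ Ioo a b) : ψ x = 0 :=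
  image_eq_zero_of_notMem_tsupport fun hx' => hx (h.tsupport_subset hx')

theorem IsTestFunction.continuous_deriv {a b : ℝ} {ψ : ℝ → ℝ} (h : IsTestFunction a b ψ) :
    Continuous (deriv ψ) := h.contDiff.continuous_deriv le_rfl

/-- A continuous probability density concentrated on `]c, c + ε[`. -/
theorem exists_continuous_bump (c : ℝ) {ε : ℝ} (hε : 0 < ε) :
    ∃ ρ : ℝ → ℝ, Continuous ρ ∧ (∀ r, 0 ≤ ρ r) ∧ (∀ r, r ∉ Ioo c (c + ε) → ρ r = 0) ∧
      Integrable ρ ∧ ∫ r, ρ r = 1 := by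
  let φ : ContDiffBump (c + ε / 2) := ⟨ε / 4, ε / 2, by positivity, by linarith⟩
  refine ⟨φ.normed volume, φ.continuous_normed, φ.nonneg_normed, fun r hr => ?_,
    φ.integrable_normed, φ.integral_normed⟩
  by_contra h
  have : r ∈ Function.support (φ.normed volume) := h
  rw [φ.support_normed_eq, Real.ball_eq_Ioo, show φ.rOut = ε / 2 from rfl] at this
  exact hr ⟨by linarith [this.1], by linarith [this.2]⟩

/-- Averages against densities concentrating to the right of `x` approximate the value of a
right-continuous function. -/
theorem abs_setIntegral_mul_bump_sub_le {a b x ε η : ℝ} {h ρ : ℝ → ℝ}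
    (hint : IntegrableOn h (Icc a b)) (hax : a < x) (hxb : x + ε < b)
    (hc : Continuous ρ) (h0 : ∀ r, 0 ≤ ρ r) (hsupp : ∀ r, r ∉ Ioo x (x + ε) → ρ r = 0)
    (hρ : ∫ r, ρ r = 1) (hη : ∀ r ∈ Ioo x (x + ε), |h r - h x| ≤ η) :
    |(∫ r in Icc a b, h r * ρ r) - h x| ≤ η := by
  have hone : ∫ r in Icc a b, ρ r = 1 := by
    rw [setIntegral_eq_integral_of_forall_compl_eq_zero, hρ]
    exact fun r hr => hsupp r fun hr' => hr ⟨(hax.trans hr'.1).le, (hr'.2.trans hxb).le⟩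
  have hcρ : IntegrableOn ρ (Icc a b) := hc.continuousOn.integrableOn_Icc
  have hi : IntegrableOn (fun r => h r * ρ r) (Icc a b) :=
    hint.mul_continuousOn hc.continuousOn isCompact_Icc
  have heq : (∫ r in Icc a b, h r * ρ r) - h x = ∫ r in Icc a b, (h r - h x) * ρ r := by
    simp_rw [sub_mul]
    rw [integral_sub hi (hcρ.const_mul _), integral_const_mul, hone, mul_one]
  rw [heq, ← Real.norm_eq_abs]
  refine (norm_integral_le_of_norm_le (hcρ.const_mul η) (Eventually.of_forall fun r => ?_)).trans ?_
  · rw [norm_mul, Real.norm_eq_abs, Real.norm_eq_abs, abs_of_nonneg (h0 r)]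
    by_cases hr : r ∈ Ioo x (x + ε)
    · exact mul_le_mul_of_nonneg_right (hη r hr) (h0 r)
    · simp [hsupp r hr]
  · rw [integral_const_mul, hone, mul_one]

/-- A right-continuous function with a bounded weak derivative is Lipschitz continuous. -/
theorem abs_sub_le_of_weak_deriv {a b M : ℝ} (hM : 0 ≤ M) {h : ℝ → ℝ}
    (hint : IntegrableOn h (Icc a b))
    (hrc : ∀ x ∈ Ioo a b, ContinuousWithinAt h (Ioi x) x)
    (hweak : ∀ ψ, IsTestFunction a b ψ →
      |∫ x in Icc a b, h x * deriv ψ x| ≤ M * ∫ x in Icc a b, |ψ x|)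
    {x y : ℝ} (hx : a < x) (hxy : x < y) (hy : y < b) : |h y - h x| ≤ M * (y - x) := by
  have key : ∀ η > 0, |h y - h x| ≤ M * (y - x) + (2 + M) * η := by
    intro η hη
    have hright : ∀ z ∈ Ioo a b, ∃ δ > 0, ∀ r ∈ Ioo z (z + δ), |h r - h z| ≤ η := by
      intro z hz
      have := Metric.tendsto_nhdsWithin_nhds.1 (hrc z hz) η hη
      obtain ⟨δ, hδ, hδ'⟩ := this
      refine ⟨δ, hδ, fun r hr => ?_⟩
      have := hδ' (x := r) hr.1 (by rw [Real.dist_eq, abs_of_pos (by linarith [hr.1])]; linarith [hr.2])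
      exact (Real.dist_eq _ _ ▸ this).le
    obtain ⟨δ₁, hδ₁, H₁⟩ := hright x ⟨hx, hxy.trans hy⟩
    obtain ⟨δ₂, hδ₂, H₂⟩ := hright y ⟨hx.trans hxy, hy⟩
    obtain ⟨ε, hε, hε'⟩ : ∃ ε > 0, ε < min (min δ₁ δ₂) (min η (min (y - x) (b - y))) :=
      exists_between (by simp only [lt_min_iff]; refine ⟨⟨hδ₁, hδ₂⟩, hη, ?_, ?_⟩ <;> linarith)
    simp only [lt_min_iff] at hε'
    obtain ⟨⟨hε1, hε2⟩, hεη, hεx, hεb⟩ := hε'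
    obtain ⟨ρ, hρc, hρ0, hρs, hρi, hρ1⟩ := exists_continuous_bump x hε
    obtain ⟨σ, hσc, hσ0, hσs, hσi, hσ1⟩ := exists_continuous_bump y hε
    -- `ρ` and `σ` are densities concentrated just to the right of `x` and `y`; `ψ` rises from `0` to at
    -- most `1` near `x` and returns to `0` near `y`, and `∫ h ψ'` is nearly `h x - h y`.
    set ψ : ℝ → ℝ := fun s => ∫ r in x..s, (ρ r - σ r) with hψ
    have hderiv : ∀ s, HasDerivAt ψ (ρ s - σ s) s := fun s =>
      intervalIntegral.integral_hasDerivAt_right ((hρc.sub hσc).intervalIntegrable _ _)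
        ((hρc.sub hσc).stronglyMeasurableAtFilter _ _) (hρc.sub hσc).continuousAt
    have hderiv' : deriv ψ = fun s => ρ s - σ s := funext fun s => (hderiv s).deriv
    have hψleft : ∀ s, s ≤ x → ψ s = 0 := by
      intro s hs
      rw [hψ]
      refine intervalIntegral.integral_zero_ae (Eventually.of_forall fun r hr => ?_)
      rw [uIoc_of_ge hs] at hr
      rw [hρs r fun h' => (h'.1.trans_le hr.2).false,
        hσs r fun h' => (hxy.trans (h'.1.trans_le hr.2)).false, sub_zero]
    have hψright : ∀ s, y + ε ≤ s → ψ s = 0 := by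
      intro s hs
      rw [hψ]
      beta_reduce
      rw [intervalIntegral.integral_eq_integral_of_support_subset, integral_sub hρi hσi, hρ1, hσ1,
        sub_self]
      intro r hr
      by_contra hr'
      refine hr ?_
      beta_reduce
      rw [hρs r fun h' => hr' ⟨h'.1, by linarith [h'.2]⟩,
        hσs r fun h' => hr' ⟨by linarith [h'.1], by linarith [h'.2]⟩, sub_zero]
    have hψone : ∀ s, |ψ s| ≤ 1 := by
      intro s
      rcases le_total s x with hs | hs
      · rw [hψleft s hs]; simp
      have hle : ∀ τ : ℝ → ℝ, (∀ r, 0 ≤ τ r) → Integrable τ → ∫ r, τ r = 1 →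
          0 ≤ ∫ r in x..s, τ r ∧ ∫ r in x..s, τ r ≤ 1 := by
        intro τ h0 hi h1
        refine ⟨intervalIntegral.integral_nonneg hs fun r _ => h0 r, ?_⟩
        rw [intervalIntegral.integral_of_le hs, ← h1]
        exact setIntegral_le_integral hi (Eventually.of_forall h0)
      have h1 := hle ρ hρ0 hρi hρ1
      have h2 := hle σ hσ0 hσi hσ1
      have h3 : ψ s = (∫ r in x..s, ρ r) - ∫ r in x..s, σ r :=
        intervalIntegral.integral_sub (hρc.intervalIntegrable _ _) (hσc.intervalIntegrable _ _)
      rw [h3, abs_le]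
      constructor <;> linarith [h1.1, h1.2, h2.1, h2.2]
    have hsub : Function.support ψ ⊆ Icc x (y + ε) := by
      intro s hs
      by_contra h'
      rw [mem_Icc, not_and_or, not_le, not_le] at h'
      rcases h' with h' | h'
      · exact hs (hψleft s h'.le)
      · exact hs (hψright s h'.le)
    have htsub : tsupport ψ ⊆ Icc x (y + ε) := closure_minimal hsub isClosed_Icc
    have htest : IsTestFunction a b ψ := by
      refine ⟨?_, HasCompactSupport.of_support_subset_isCompact isCompact_Icc hsub,
        htsub.trans fun s hs => ⟨hx.trans_le hs.1, hs.2.trans_lt (by linarith)⟩⟩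
      rw [contDiff_one_iff_deriv, hderiv']
      exact ⟨fun s => (hderiv s).differentiableAt, hρc.sub hσc⟩
    have hw := hweak ψ htest
    have hψint : ∫ s in Icc a b, |ψ s| ≤ y - x + ε := by
      have h1 : ∫ s in Icc a b, |ψ s| = ∫ s in Icc x (y + ε), |ψ s| := by
        rw [setIntegral_eq_integral_of_forall_compl_eq_zero,
          setIntegral_eq_integral_of_forall_compl_eq_zero]
        · intro s hs
          rw [Function.notMem_support.1 fun h' => hs (hsub h'), abs_zero]
        · intro s hs
          rw [htest.eq_zero fun h' => hs (Ioo_subset_Icc_self h'), abs_zero]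
      have hψc : Continuous ψ := htest.contDiff.continuous
      have h2 : ∫ s in Icc x (y + ε), |ψ s| ≤ ∫ s in Icc x (y + ε), (1 : ℝ) :=
        setIntegral_mono hψc.abs.continuousOn.integrableOn_Icc
          (continuous_const.continuousOn.integrableOn_Icc) hψone
      have h3 : ∫ s in Icc x (y + ε), (1 : ℝ) = y + ε - x := by
        rw [setIntegral_const, smul_eq_mul, mul_one, Real.volume_real_Icc_of_le (by linarith)]
      linarith
    have hρa := abs_setIntegral_mul_bump_sub_le (η := η) hint hx (by linarith) hρc hρ0 hρs hρ1
      fun r hr => H₁ r ⟨hr.1, by linarith [hr.2]⟩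
    have hσa := abs_setIntegral_mul_bump_sub_le (η := η) hint (hx.trans hxy) (by linarith) hσc hσ0
      hσs hσ1 fun r hr => H₂ r ⟨hr.1, by linarith [hr.2]⟩
    have heq : ∫ s in Icc a b, h s * deriv ψ s =
        (∫ s in Icc a b, h s * ρ s) - ∫ s in Icc a b, h s * σ s := by
      simp_rw [hderiv', mul_sub]
      exact integral_sub (hint.mul_continuousOn hρc.continuousOn isCompact_Icc)
        (hint.mul_continuousOn hσc.continuousOn isCompact_Icc)
    rw [heq] at hw
    have hM' : M * ∫ s in Icc a b, |ψ s| ≤ M * (y - x) + M * η := by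
      rw [← mul_add]
      exact mul_le_mul_of_nonneg_left (by linarith) hM
    rw [abs_le] at hρa hσa hw ⊢
    constructor <;> nlinarith [hρa.1, hρa.2, hσa.1, hσa.2, hw.1, hw.2]
  refine le_of_forall_pos_le_add fun η hη => ?_
  have := key (η / (2 + M)) (by positivity)
  rwa [mul_div_cancel₀ _ (by positivity)] at this

/-- Lebesgue's differentiation theorem with one-sided averages. -/
theorem ae_tendsto_average_right {E : Type*} [NormedAddCommGroup E] [NormedSpace ℝ E]
    [CompleteSpace E] {f : ℝ → E} (hf : LocallyIntegrable f) :
    ∀ᵐ x, Tendsto (fun y => ⨍ z in Icc x y, f z) (𝓝[>] x) (𝓝 (f x)) := by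
  filter_upwards [(IsUnifLocDoublingMeasure.vitaliFamily (volume : Measure ℝ) 1).ae_tendsto_average
    hf] with x hx
  exact hx.comp (Real.tendsto_Icc_vitaliFamily_right x)

/-- Test functions separate the points of `L¹`. -/
theorem ae_eq_zero_of_test {n : ℕ} {a b : ℝ} {f : ℝ → EuclideanSpace ℝ (Fin n)}
    (hf : IntegrableOn f (Icc a b))
    (h : ∀ ψ, IsTestFunction a b ψ → ∀ e, ∫ x in Icc a b, ψ x * inner ℝ (f x) e = 0) :
    f =ᵐ[volume.restrict (Icc a b)] 0 := by
  have h1 : ∀ᵐ x, x ∈ Ioo a b → f x = 0 := by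
    refine isOpen_Ioo.ae_eq_zero_of_integral_contDiff_smul_eq_zero
      (hf.locallyIntegrableOn.mono_set Ioo_subset_Icc_self) fun ψ hψ hc hs => ?_
    have htest : IsTestFunction a b ψ := ⟨hψ.of_le (by simp), hc, hs⟩
    have hi : IntegrableOn (fun x => ψ x • f x) (Icc a b) :=
      hf.continuousOn_smul hψ.continuous.continuousOn isCompact_Icc
    rw [← setIntegral_eq_integral_of_forall_compl_eq_zero (s := Icc a b) fun x hx => by
      rw [htest.eq_zero fun h' => hx (Ioo_subset_Icc_self h'), zero_smul]]
    refine ext_inner_left ℝ fun e => ?_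
    rw [← integral_inner hi, inner_zero_right, ← h ψ htest e]
    refine integral_congr_ae (Eventually.of_forall fun x => ?_)
    beta_reduce
    rw [inner_smul_right, real_inner_comm]
  rw [← restrict_Ioo_eq_restrict_Icc]
  exact (ae_restrict_iff' measurableSet_Ioo).2 h1

/-! ### Weak* traces -/

/-- A bounded family in a Hilbert space converges weakly as soon as its inner products with the
members of a total set converge. -/
theorem exists_weak_limit {H : Type*} [NormedAddCommGroup H] [InnerProductSpace ℝ H]
    [CompleteSpace H] {ι : Type*} {l : Filter ι} [NeBot l] {ξ : ι → H} {R : ℝ}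
    (hR : ∀ x, ‖ξ x‖ ≤ R) (D : Set H) (hD : ∀ ζ : H, (∀ g ∈ D, inner ℝ ζ g = 0) → ζ = 0)
    (hlim : ∀ g ∈ D, ∃ c, Tendsto (fun x => inner ℝ (ξ x) g) l (𝓝 c)) :
    ∃ Y : H, ∀ g, Tendsto (fun x => inner ℝ (ξ x) g) l (𝓝 (inner ℝ Y g)) := by
  set Φ : ι → WeakDual ℝ H := fun x =>
    StrongDual.toWeakDual (InnerProductSpace.toDual ℝ H (ξ x)) with hΦ
  have hK := WeakDual.isCompact_closedBall (𝕜 := ℝ) (E := H) 0 R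
  have hmem : ∀ x, Φ x ∈ WeakDual.toStrongDual ⁻¹' Metric.closedBall (0 : StrongDual ℝ H) R := by
    intro x
    simp only [mem_preimage, mem_closedBall_zero_iff]
    exact (LinearIsometryEquiv.norm_map (InnerProductSpace.toDual ℝ H) (ξ x)).trans_le (hR x)
  have hval : ∀ x g, Φ x g = inner ℝ (ξ x) g := fun x g => rfl
  have hcl : ∀ Z, MapClusterPt Z l Φ → ∀ g c, Tendsto (fun x => inner ℝ (ξ x) g) l (𝓝 c) →
      Z g = c := by
    intro Z hZ g c hc
    have h1 : MapClusterPt (Z g) l (fun x => Φ x g) :=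
      hZ.continuousAt_comp (f := fun ζ : WeakDual ℝ H => ζ g) (WeakDual.eval_continuous g).continuousAt
    have h2 : NeBot (𝓝 (Z g) ⊓ 𝓝 c) := NeBot.mono h1 (inf_le_inf_left _ hc)
    exact eq_of_nhds_neBot h2
  obtain ⟨Z, -, hZ⟩ := hK.exists_mapClusterPt (f := l) (u := Φ)
    (tendsto_principal.2 (Eventually.of_forall hmem))
  have huniq : ∀ Z', MapClusterPt Z' l Φ → Z' = Z := by
    intro Z' hZ'
    set ζ' := (InnerProductSpace.toDual ℝ H).symm (WeakDual.toStrongDual Z') with hζ'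
    set ζ := (InnerProductSpace.toDual ℝ H).symm (WeakDual.toStrongDual Z) with hζ
    have h' : ∀ g, inner ℝ ζ' g = Z' g := fun g => InnerProductSpace.toDual_symm_apply
    have h : ∀ g, inner ℝ ζ g = Z g := fun g => InnerProductSpace.toDual_symm_apply
    have h0 : ζ' - ζ = 0 := by
      refine hD _ fun g hg => ?_
      obtain ⟨c, hc⟩ := hlim g hg
      rw [inner_sub_left, h', h, hcl Z' hZ' g c hc, hcl Z hZ g c hc, sub_self]
    refine DFunLike.ext _ _ fun g => ?_
    rw [← h', ← h, sub_eq_zero.1 h0]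
  have htend : Tendsto Φ l (𝓝 Z) :=
    hK.tendsto_nhds_of_unique_mapClusterPt (Eventually.of_forall hmem) fun Z' _ hZ' => huniq Z' hZ'
  refine ⟨(InnerProductSpace.toDual ℝ H).symm (WeakDual.toStrongDual Z), fun g => ?_⟩
  have h1 : inner ℝ ((InnerProductSpace.toDual ℝ H).symm (WeakDual.toStrongDual Z)) g = Z g :=
    InnerProductSpace.toDual_symm_apply
  rw [h1]
  exact ((WeakDual.eval_continuous g).tendsto Z).comp htend

/-- If the integrals of `Ψ` over intervals are limits of integrals of functions with values in the
compact convex set `Q`, then `Ψ` has values in `Q`. -/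
theorem ae_mem_of_tendsto_integral {n : ℕ} {T : ℝ} {l : Filter ℝ} [NeBot l]
    {v : ℝ → ℝ → EuclideanSpace ℝ (Fin n)} {Ψ : ℝ → EuclideanSpace ℝ (Fin n)}
    {Q : Set (EuclideanSpace ℝ (Fin n))} (hQc : IsCompact Q) (hQ : Convex ℝ Q)
    (hm : ∀ᶠ x in l, IntegrableOn (fun t => v t x) (Icc 0 T) ∧ ∀ t, v t x ∈ Q)
    (hΨ : IntegrableOn Ψ (Icc 0 T))
    (hlim : ∀ s t, 0 ≤ s → s < t → t ≤ T → ∀ e : EuclideanSpace ℝ (Fin n),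
      Tendsto (fun x => inner ℝ e (∫ τ in Icc s t, v τ x)) l
        (𝓝 (inner ℝ e (∫ τ in Icc s t, Ψ τ)))) :
    ∀ᵐ t ∂(volume.restrict (Icc 0 T)), Ψ t ∈ Q := by
  have hav : ∀ s t, 0 ≤ s → s < t → t ≤ T → ⨍ τ in Icc s t, Ψ τ ∈ Q := by
    intro s t hs hst ht
    by_contra hnot
    obtain ⟨f, u, hfu, huf⟩ := geometric_hahn_banach_closed_point hQ hQc.isClosed hnot
    obtain ⟨e, rfl⟩ := (InnerProductSpace.toDual ℝ (EuclideanSpace ℝ (Fin n))).surjective f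
    simp only [InnerProductSpace.toDual_apply_apply] at hfu huf
    refine absurd huf (not_lt.2 ?_)
    have hl := (hlim s t hs hst ht e).const_mul (volume.real (Icc s t))⁻¹
    rw [setAverage_eq, inner_smul_right]
    refine le_of_tendsto hl ?_
    filter_upwards [hm] with x hx
    rw [← inner_smul_right, ← setAverage_eq]
    refine (hfu _ (hQ.set_average_mem hQc.isClosed ?_ ?_ (Eventually.of_forall hx.2)
      (hx.1.mono_set (Icc_subset_Icc hs ht)))).le
    · rw [Real.volume_Icc]; simp [hst]
    · rw [Real.volume_Icc]; simp
  have hΨ' : LocallyIntegrable ((Icc 0 T).indicator Ψ) :=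
    ((integrable_indicator_iff measurableSet_Icc).2 hΨ).locallyIntegrable
  rw [← restrict_Ioo_eq_restrict_Icc, ae_restrict_iff' measurableSet_Ioo]
  filter_upwards [ae_tendsto_average_right hΨ'] with t ht htT
  rw [indicator_of_mem (Ioo_subset_Icc_self htT)] at ht
  refine hQc.isClosed.mem_of_tendsto ht ?_
  filter_upwards [Ioc_mem_nhdsGT htT.2] with s hs
  rw [setAverage_eq, setIntegral_congr_fun (g := Ψ) measurableSet_Icc, ← setAverage_eq]
  · exact hav t s htT.1.le hs.1 hs.2
  · exact fun τ hτ => indicator_of_mem (show τ ∈ Icc 0 T from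
      ⟨htT.1.le.trans hτ.1, hτ.2.trans hs.2⟩) _

/-- If the integrals of `v(·, x)` against test functions converge and `v` has values in a compact
convex set, then `v(·, x)` has a weak* limit, with values in that set. -/
theorem exists_weakStarTrace {n : ℕ} {T : ℝ} {l : Filter ℝ} [NeBot l]
    {v : ℝ → ℝ → EuclideanSpace ℝ (Fin n)}
    {Q : Set (EuclideanSpace ℝ (Fin n))} (hQc : IsCompact Q) (hQ : Convex ℝ Q)
    (hm : ∀ᶠ x in l, AEStronglyMeasurable (fun t => v t x) (volume.restrict (Icc 0 T)) ∧
      ∀ t, v t x ∈ Q)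
    (hlim : ∀ ψ, IsTestFunction 0 T ψ → ∀ e : EuclideanSpace ℝ (Fin n),
      ∃ c, Tendsto (fun x => ∫ t in Icc 0 T, ψ t * inner ℝ (v t x) e) l (𝓝 c)) :
    ∃ Ψ, HasWeakStarTrace T v l Ψ ∧ ∀ᵐ t ∂(volume.restrict (Icc 0 T)), Ψ t ∈ Q := by
  classical
  set μ : Measure ℝ := volume.restrict (Icc 0 T) with hμ
  obtain ⟨R, hR⟩ := hQc.isBounded.exists_norm_le
  have hmemLp : ∀ p : ℝ≥0∞, ∀ᶠ x in l, MemLp (fun t => v t x) p μ ∧ ∀ t, v t x ∈ Q := fun p => by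
    filter_upwards [hm] with x hx
    exact ⟨MemLp.of_bound hx.1 R (Eventually.of_forall fun t => hR _ (hx.2 t)), hx.2⟩
  have hRpos : 0 ≤ R := by
    obtain ⟨x, hx⟩ := hm.exists
    exact (norm_nonneg _).trans (hR _ (hx.2 0))
  set ξ : ℝ → Lp (EuclideanSpace ℝ (Fin n)) 2 μ := fun x =>
    if hx : MemLp (fun t => v t x) 2 μ ∧ ∀ t, v t x ∈ Q then hx.1.toLp else 0 with hξ
  have hinner : ∀ g : Lp (EuclideanSpace ℝ (Fin n)) 2 μ, ∀ᶠ x in l,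
      inner ℝ (ξ x) g = ∫ t, inner ℝ (v t x) (g t) ∂μ := by
    intro g
    filter_upwards [hmemLp 2] with x hx
    rw [L2.inner_def]
    simp only [hξ, dif_pos hx]
    refine integral_congr_ae ?_
    filter_upwards [hx.1.coeFn_toLp] with t ht
    rw [ht]
  have hbound : ∀ x, ‖ξ x‖ ≤ (measureUnivNNReal μ : ℝ) ^ (2 : ℝ≥0∞).toReal⁻¹ * R := by
    intro x
    by_cases hx : MemLp (fun t => v t x) 2 μ ∧ ∀ t, v t x ∈ Q
    · simp only [hξ, dif_pos hx]
      refine Lp.norm_le_of_ae_bound hRpos ?_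
      filter_upwards [hx.1.coeFn_toLp] with t ht
      rw [ht]
      exact hR _ (hx.2 t)
    · simp only [hξ, dif_neg hx, norm_zero]
      positivity
  have htest : ∀ ψ, IsTestFunction 0 T ψ → ∀ e : EuclideanSpace ℝ (Fin n),
      MemLp (fun t => ψ t • e) 2 μ := by
    intro ψ hψ e
    exact ((hψ.contDiff.continuous.smul continuous_const).memLp_of_hasCompactSupport
      (HasCompactSupport.smul_right (f' := fun _ => e) hψ.hasCompactSupport)).restrict _
  set D : Set (Lp (EuclideanSpace ℝ (Fin n)) 2 μ) :=
    {g | ∃ ψ, ∃ hψ : IsTestFunction 0 T ψ, ∃ e, g = (htest ψ hψ e).toLp} with hD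
  have htestval : ∀ ψ (hψ : IsTestFunction 0 T ψ) (e : EuclideanSpace ℝ (Fin n))
      (f : ℝ → EuclideanSpace ℝ (Fin n)),
      ∫ t, inner ℝ (f t) ((htest ψ hψ e).toLp _ t) ∂μ = ∫ t, ψ t * inner ℝ (f t) e ∂μ := by
    intro ψ hψ e f
    refine integral_congr_ae ?_
    filter_upwards [(htest ψ hψ e).coeFn_toLp] with t ht
    rw [ht, inner_smul_right]
  have hsep : ∀ ζ : Lp (EuclideanSpace ℝ (Fin n)) 2 μ, (∀ g ∈ D, inner ℝ ζ g = 0) → ζ = 0 := by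
    intro ζ hζ
    rw [Lp.eq_zero_iff_ae_eq_zero]
    refine ae_eq_zero_of_test ((Lp.memLp ζ).integrable (by norm_num)) fun ψ hψ e => ?_
    exact (htestval ψ hψ e ζ).symm.trans ((L2.inner_def ζ _).symm.trans (hζ _ ⟨ψ, hψ, e, rfl⟩))
  have hconv : ∀ g ∈ D, ∃ c, Tendsto (fun x => inner ℝ (ξ x) g) l (𝓝 c) := by
    rintro _ ⟨ψ, hψ, e, rfl⟩
    obtain ⟨c, hc⟩ := hlim ψ hψ e
    refine ⟨c, hc.congr' ?_⟩
    filter_upwards [hinner ((htest ψ hψ e).toLp _)] with x hx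
    rw [hx, htestval ψ hψ]
  obtain ⟨Y, hY⟩ := exists_weak_limit hbound D hsep hconv
  have hYint : IntegrableOn Y (Icc 0 T) := (Lp.memLp Y).integrable (by norm_num)
  have hYQ : ∀ᵐ t ∂μ, Y t ∈ Q := by
    refine ae_mem_of_tendsto_integral (v := v) (l := l) hQc hQ ?_ hYint ?_
    · filter_upwards [hmemLp 1] with x hx
      exact ⟨memLp_one_iff_integrable.1 hx.1, hx.2⟩
    · intro s t hs hst ht e
      have hsub : Icc s t ⊆ Icc 0 T := Icc_subset_Icc hs ht
      have hrest : ∀ f : ℝ → EuclideanSpace ℝ (Fin n),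
          ∫ τ in Icc s t, f τ ∂μ = ∫ τ in Icc s t, f τ := fun f => by
        rw [hμ, Measure.restrict_restrict_of_subset hsub]
      have h := hY (indicatorConstLp 2 measurableSet_Icc (measure_ne_top μ (Icc s t)) e)
      rw [real_inner_comm, L2.inner_indicatorConstLp_eq_inner_setIntegral, hrest] at h
      refine h.congr' ?_
      filter_upwards [hmemLp 2] with x hx
      rw [real_inner_comm, L2.inner_indicatorConstLp_eq_inner_setIntegral, hrest]
      congr 1
      have h1 : ∀ᵐ τ ∂volume.restrict (Icc s t), ξ x τ = v τ x := by
        refine ae_restrict_of_ae_restrict_of_subset hsub ?_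
        simp only [hξ, dif_pos hx]
        exact hx.1.coeFn_toLp
      exact integral_congr_ae h1
  have hYR : ∀ᵐ t ∂μ, ‖Y t‖ ≤ R := hYQ.mono fun t ht => hR _ ht
  have hYm : AEStronglyMeasurable Y μ := (Lp.memLp Y).aestronglyMeasurable
  refine ⟨Y, ⟨MemLp.of_bound hYm R hYR, (hmemLp ∞).mono fun x hx => hx.1, fun g hg => ?_⟩, hYQ⟩
  -- The limit is tested against functions in `L²` so far; continuous functions with compact support
  -- are dense in `L¹`.
  rw [Metric.tendsto_nhds]
  intro ε hε
  obtain ⟨g', hg's, hg'ε, hg'c, hg'i⟩ := hg.exists_hasCompactSupport_integral_sub_le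
    (ε := ε / (4 * (R + 1))) (by positivity)
  have hg'2 : MemLp g' 2 μ := hg'c.memLp_of_hasCompactSupport hg's
  have hlim' : ∀ᶠ x in l, |∫ t, inner ℝ (v t x) (g' t) ∂μ - ∫ t, inner ℝ (Y t) (g' t) ∂μ| < ε / 2 := by
    have h1 := Metric.tendsto_nhds.1 (hY hg'2.toLp) (ε / 2) (by positivity)
    filter_upwards [h1, hinner hg'2.toLp] with x hx hx'
    rw [hx', L2.inner_def, Real.dist_eq] at hx
    have h2 : ∀ f : ℝ → EuclideanSpace ℝ (Fin n),
        ∫ t, inner ℝ (f t) (hg'2.toLp g' t) ∂μ = ∫ t, inner ℝ (f t) (g' t) ∂μ := fun f => by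
      refine integral_congr_ae ?_
      filter_upwards [hg'2.coeFn_toLp] with t ht
      rw [ht]
    rwa [h2, h2] at hx
  have hint : ∀ f : ℝ → EuclideanSpace ℝ (Fin n), AEStronglyMeasurable f μ →
      (∀ᵐ t ∂μ, ‖f t‖ ≤ R) → ∀ k : ℝ → EuclideanSpace ℝ (Fin n), Integrable k μ →
      Integrable (fun t => inner ℝ (f t) (k t)) μ ∧
        |∫ t, inner ℝ (f t) (k t) ∂μ| ≤ R * ∫ t, ‖k t‖ ∂μ := by
    intro f hf hfR k hk
    have hle : ∀ᵐ t ∂μ, ‖(inner ℝ (f t) (k t) : ℝ)‖ ≤ R * ‖k t‖ := by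
      filter_upwards [hfR] with t ht
      exact (norm_inner_le_norm _ _).trans (mul_le_mul_of_nonneg_right ht (norm_nonneg _))
    refine ⟨(hk.norm.const_mul R).mono' (hf.inner hk.aestronglyMeasurable) hle, ?_⟩
    rw [← Real.norm_eq_abs, ← integral_const_mul]
    exact norm_integral_le_of_norm_le (hk.norm.const_mul R) hle
  have hdiff : ∀ f : ℝ → EuclideanSpace ℝ (Fin n), AEStronglyMeasurable f μ →
      (∀ᵐ t ∂μ, ‖f t‖ ≤ R) →
      |∫ t, inner ℝ (f t) (g t) ∂μ - ∫ t, inner ℝ (f t) (g' t) ∂μ| ≤ ε / 4 := by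
    intro f hf hfR
    rw [← integral_sub (hint f hf hfR g hg).1 (hint f hf hfR g' hg'i).1]
    simp_rw [← inner_sub_right]
    refine (hint f hf hfR _ (hg.sub hg'i)).2.trans
      ((mul_le_mul_of_nonneg_left hg'ε hRpos).trans ?_)
    rw [mul_div_assoc', div_le_div_iff₀ (by positivity) (by positivity)]
    nlinarith
  filter_upwards [hlim', hmemLp 1] with x hx hx'
  have h1 := hdiff _ hx'.1.aestronglyMeasurable (Eventually.of_forall fun t => hR _ (hx'.2 t))
  have h2 := hdiff Y hYm hYR
  rw [Real.dist_eq]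
  rw [abs_le] at h1 h2
  rw [abs_lt] at hx ⊢
  constructor <;> linarith [h1.1, h1.2, h2.1, h2.2, hx.1, hx.2]

/-! ### One-sided estimates and Helly's selection principle -/

/-- `g` is (a.e.) a function with values in `Γ` whose coordinates `wᵢ ∘ g` satisfy the one-sided
estimates `wᵢ(g(y)) - wᵢ(g(x)) ≤ Θᵢ(y) - Θᵢ(x)` for a.e. `a < x < y < b`. -/
structure IsOneSided {n : ℕ} (Γ : Set (EuclideanSpace ℝ (Fin n)))
    (w : Fin n → EuclideanSpace ℝ (Fin n) → ℝ) (Θ : Fin n → ℝ → ℝ) (a b : ℝ)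
    (g : ℝ → EuclideanSpace ℝ (Fin n)) : Prop where
  aestronglyMeasurable : AEStronglyMeasurable g (volume.restrict (Icc a b))
  ae_mem : ∀ᵐ x ∂(volume.restrict (Icc a b)), g x ∈ Γ
  le : ∀ i, ∀ᵐ q : ℝ × ℝ, a < q.1 → q.1 < q.2 → q.2 < b →
    w i (g q.2) - w i (g q.1) ≤ Θ i q.2 - Θ i q.1

theorem exists_mem_between_of_ae {a b : ℝ} {N : Set ℝ} (hN : ∀ᵐ x, x ∈ Ioo a b → x ∈ N)
    {x y : ℝ} (hax : a ≤ x) (hxy : x < y) (hyb : y ≤ b) : ∃ r ∈ N, x < r ∧ r < y := by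
  obtain ⟨r, hr, hxr, hry⟩ := (Measure.dense_of_ae hN).exists_between hxy
  exact ⟨r, hr ⟨hax.trans_lt hxr, hry.trans_le hyb⟩, hxr, hry⟩

theorem neBot_nhdsWithin_inter_Ioi {a b : ℝ} {N : Set ℝ} (hN : ∀ᵐ x, x ∈ Ioo a b → x ∈ N)
    {x : ℝ} (hx : x ∈ Ioo a b) : NeBot (𝓝[N ∩ Ioi x] x) := by
  rw [← mem_closure_iff_nhdsWithin_neBot, Metric.mem_closure_iff]
  intro ε hε
  obtain ⟨r, hr, hxr, hry⟩ := exists_mem_between_of_ae hN hx.1.le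
    (y := min (x + ε) b) (lt_min (by linarith) hx.2) (min_le_right _ _)
  refine ⟨r, ⟨hr, hxr⟩, ?_⟩
  rw [dist_comm, Real.dist_eq, abs_of_pos (by linarith)]
  linarith [min_le_left (x + ε) b]

theorem eventually_nhdsWithin_inter_Ioi_iff {N : Set ℝ} {x : ℝ} {P : ℝ → Prop} :
    (∀ᶠ y in 𝓝[N ∩ Ioi x] x, P y) ↔ ∃ δ > 0, ∀ r ∈ N, x < r → r < x + δ → P r := by
  rw [Metric.nhdsWithin_basis_ball.eventually_iff]
  constructor
  · rintro ⟨δ, hδ, h⟩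
    refine ⟨δ, hδ, fun r hr hxr hrδ => h ⟨?_, hr, hxr⟩⟩
    rw [Metric.mem_ball, Real.dist_eq, abs_of_pos (by linarith)]
    linarith
  · rintro ⟨δ, hδ, h⟩
    refine ⟨δ, hδ, fun r hr => h r hr.2.1 hr.2.2 ?_⟩
    have := (abs_lt.1 (Real.dist_eq r x ▸ Metric.mem_ball.1 hr.1)).2
    linarith

theorem AntitoneOn.exists_tendsto_right {m : ℝ → ℝ} {N : Set ℝ} {x B : ℝ}
    (hm : AntitoneOn m N) [hne : NeBot (𝓝[N ∩ Ioi x] x)]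
    (hB : ∀ᶠ y in 𝓝[N ∩ Ioi x] x, m y ≤ B) : ∃ L, Tendsto m (𝓝[N ∩ Ioi x] x) (𝓝 L) := by
  have hnonempty : (N ∩ Ioi x).Nonempty := by
    obtain ⟨y, hy⟩ := (self_mem_nhdsWithin : N ∩ Ioi x ∈ 𝓝[N ∩ Ioi x] x) |> hne.nonempty_of_mem
    exact ⟨y, hy⟩
  have hlt : ∀ y, x < y → ∀ᶠ r in 𝓝[N ∩ Ioi x] x, r < y := fun y hy =>
    nhdsWithin_le_nhds (gt_mem_nhds hy)
  have hbdd : BddAbove (m '' (N ∩ Ioi x)) := by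
    refine ⟨B, ?_⟩
    rintro _ ⟨y, hy, rfl⟩
    obtain ⟨r, hrB, hry, hr⟩ := (hB.and ((hlt y hy.2).and self_mem_nhdsWithin)).exists
    exact (hm hr.1 hy.1 hry.le).trans hrB
  refine ⟨sSup (m '' (N ∩ Ioi x)), tendsto_order.2 ⟨fun c hc => ?_, fun c hc => ?_⟩⟩
  · obtain ⟨_, ⟨y, hy, rfl⟩, hcy⟩ := exists_lt_of_lt_csSup (hnonempty.image m) hc
    filter_upwards [hlt y hy.2, self_mem_nhdsWithin] with r hr hrN
    exact hcy.trans_le (hm hrN.1 hy.1 hr.le)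
  · filter_upwards [self_mem_nhdsWithin] with r hr
    exact (le_csSup hbdd (mem_image_of_mem m hr)).trans_lt hc

/-- A family in a compact set converges as soon as its images under continuous coordinates do. -/
theorem exists_tendsto_of_coords {X ι κ : Type*} [TopologicalSpace X] {Γ : Set X}
    (hΓ : IsCompact Γ) {w : κ → X → ℝ} (hw : ∀ i, ContinuousOn (w i) Γ)
    (hinj : InjOn (fun u i => w i u) Γ) {l : Filter ι} [NeBot l] {ξ : ι → X}
    (hξ : ∀ᶠ k in l, ξ k ∈ Γ) (hlim : ∀ i, ∃ c, Tendsto (fun k => w i (ξ k)) l (𝓝 c)) :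
    ∃ z ∈ Γ, Tendsto ξ l (𝓝 z) := by
  choose c hc using hlim
  have hval : ∀ z ∈ Γ, MapClusterPt z l ξ → ∀ i, w i z = c i := by
    intro z hz hcl i
    obtain ⟨U, hU, hUz⟩ := mapClusterPt_iff_ultrafilter.1 hcl
    have h1 : Tendsto ξ U (𝓝[Γ] z) := tendsto_nhdsWithin_iff.2 ⟨hUz, hU hξ⟩
    exact tendsto_nhds_unique ((hw i z hz).tendsto.comp h1) ((hc i).mono_left hU)
  obtain ⟨z, hz, hcl⟩ := hΓ.exists_mapClusterPt (tendsto_principal.2 hξ)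
  refine ⟨z, hz, hΓ.tendsto_nhds_of_unique_mapClusterPt hξ fun z' hz' hcl' => ?_⟩
  exact hinj hz' hz (funext fun i => (hval z' hz' hcl' i).trans (hval z hz hcl i).symm)

/-- **Helly's selection principle**, the part which follows the choice of the subsequence: antitone
functions which converge on a dense set converge outside of a countable set. -/
theorem exists_countable_tendsto_of_antitoneOn {a b : ℝ} {N D : Set ℝ} {m : ℕ → ℝ → ℝ} {L : ℝ → ℝ}
    (hN : N ⊆ Ioo a b) (hm : ∀ k, AntitoneOn (m k) N) (hDN : D ⊆ N)
    (hD : ∀ x y, a ≤ x → x < y → y ≤ b → ∃ d ∈ D, x < d ∧ d < y)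
    (hL : ∀ d ∈ D, Tendsto (fun k => m k d) atTop (𝓝 (L d))) :
    ∃ Z : Set ℝ, Z.Countable ∧ ∀ x ∈ N, x ∉ Z → ∃ c, Tendsto (fun k => m k x) atTop (𝓝 c) := by
  have hLanti : AntitoneOn L D := fun d hd d' hd' hdd' =>
    le_of_tendsto_of_tendsto' (hL d' hd') (hL d hd) fun k => hm k (hDN hd) (hDN hd') hdd'
  -- `M` is the left envelope of the limit `L` on `D`. It is monotone, and convergence holds
  -- wherever it is continuous, by squeezing between nearby points of `D`.
  set M : ℝ → ℝ := fun x => sInf (L '' (D ∩ Iio x)) with hM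
  have hne : ∀ x ∈ Ioo a b, (L '' (D ∩ Iio x)).Nonempty := by
    intro x hx
    obtain ⟨d, hd, -, hdx⟩ := hD a x le_rfl hx.1 hx.2.le
    exact ⟨_, d, ⟨hd, hdx⟩, rfl⟩
  have hbdd : ∀ x ∈ Ioo a b, BddBelow (L '' (D ∩ Iio x)) := by
    intro x hx
    obtain ⟨d, hd, hxd, -⟩ := hD x b hx.1.le hx.2 le_rfl
    refine ⟨L d, ?_⟩
    rintro _ ⟨d', hd', rfl⟩
    exact hLanti hd'.1 hd (hd'.2.trans hxd).le
  have hManti : AntitoneOn M (Ioo a b) := fun x hx y hy hxy =>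
    csInf_le_csInf (hbdd y hy) (hne x hx)
      (image_mono (inter_subset_inter_right _ (Iio_subset_Iio hxy)))
  refine ⟨_, hManti.countable_not_continuousWithinAt, fun x hx hxZ => ⟨M x, ?_⟩⟩
  have hxI := hN hx
  have hcont : ContinuousAt M x := by
    by_contra h
    exact hxZ ⟨hxI, fun h' => h (h'.continuousAt (isOpen_Ioo.mem_nhds hxI))⟩
  refine tendsto_order.2 ⟨fun c hc => ?_, fun c hc => ?_⟩
  · have h1 : ∀ᶠ x' in 𝓝[>] x, c < M x' ∧ x' < b ∧ x < x' :=
      ((hcont.eventually (lt_mem_nhds hc)).filter_mono nhdsWithin_le_nhds).and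
        (((gt_mem_nhds hxI.2).filter_mono nhdsWithin_le_nhds).and self_mem_nhdsWithin)
    obtain ⟨x', hcx', hx'b, hxx'⟩ := h1.exists
    obtain ⟨d, hd, hxd, hdx'⟩ := hD x x' hxI.1.le hxx' hx'b.le
    have hLd : c < L d :=
      hcx'.trans_le (csInf_le (hbdd x' ⟨hxI.1.trans hxx', hx'b⟩) ⟨d, ⟨hd, hdx'⟩, rfl⟩)
    filter_upwards [(hL d hd).eventually (lt_mem_nhds hLd)] with k hk
    exact hk.trans_le (hm k hx (hDN hd) hxd.le)
  · obtain ⟨_, ⟨d, hd, rfl⟩, hdc⟩ := exists_lt_of_csInf_lt (hne x hxI) hc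
    filter_upwards [(hL d hd.1).eventually (gt_mem_nhds hdc)] with k hk
    exact (hm k (hDN hd.1) hx hd.2.le).trans_lt hk

section OneSided

variable {n : ℕ} {Γ : Set (EuclideanSpace ℝ (Fin n))}
  {w : Fin n → EuclideanSpace ℝ (Fin n) → ℝ} {Θ : Fin n → ℝ → ℝ} {a b : ℝ}
  {g : ℝ → EuclideanSpace ℝ (Fin n)}

theorem ae_restrict_Icc_iff {P : ℝ → Prop} :
    (∀ᵐ x ∂(volume.restrict (Icc a b)), P x) ↔ ∀ᵐ x, x ∈ Ioo a b → P x := by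
  rw [← restrict_Ioo_eq_restrict_Icc, ae_restrict_iff' measurableSet_Ioo]

/-- On a set of full measure the one-sided estimates hold everywhere. -/
theorem IsOneSided.exists_antitoneOn (hg : IsOneSided Γ w Θ a b g) :
    ∃ N ⊆ Ioo a b, (∀ᵐ x, x ∈ Ioo a b → x ∈ N) ∧ (∀ x ∈ N, g x ∈ Γ) ∧
      ∀ i, AntitoneOn (fun x => w i (g x) - Θ i x) N := by
  set P : Fin n → ℝ → ℝ → Prop := fun i x y => a < x → x < y → y < b →
    w i (g y) - w i (g x) ≤ Θ i y - Θ i x with hP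
  have h1 : ∀ i, ∀ᵐ x, ∀ᵐ y, P i x y := fun i => Measure.ae_ae_of_ae_prod (hg.le i)
  have h2 : ∀ i, ∀ᵐ y, ∀ᵐ x, P i x y := fun i => by
    have := (Measure.measurePreserving_swap (μ := (volume : Measure ℝ))
      (ν := (volume : Measure ℝ))).quasiMeasurePreserving.ae (hg.le i)
    exact Measure.ae_ae_of_ae_prod this
  refine ⟨{x | x ∈ Ioo a b ∧ g x ∈ Γ ∧ ∀ i, (∀ᵐ y, P i x y) ∧ ∀ᵐ y, P i y x},
    fun x hx => hx.1, ?_, fun x hx => hx.2.1, fun i x hx y hy hxy => ?_⟩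
  · filter_upwards [ae_restrict_Icc_iff.1 hg.ae_mem, ae_all_iff.2 h1, ae_all_iff.2 h2]
      with x hx h1x h2x hxI
    exact ⟨hxI, hx hxI, fun i => ⟨h1x i, h2x i⟩⟩
  · rcases hxy.eq_or_lt with rfl | hlt
    · exact le_rfl
    obtain ⟨r, ⟨hr1, hr2⟩, hxr, hry⟩ := (Measure.dense_of_ae
      ((hx.2.2 i).1.and (hy.2.2 i).2)).exists_between hlt
    have e1 := hr1 hx.1.1 hxr (hry.trans hy.1.2)
    have e2 := hr2 (hx.1.1.trans hxr) hry hy.1.2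
    beta_reduce
    linarith

theorem IsOneSided.integrableOn (hΓ : IsCompact Γ) (hg : IsOneSided Γ w Θ a b g) :
    IntegrableOn g (Icc a b) := by
  obtain ⟨R, hR⟩ := hΓ.isBounded.exists_norm_le
  exact Integrable.of_bound hg.aestronglyMeasurable R (hg.ae_mem.mono fun x hx => hR _ hx)

/-- A function satisfying the one-sided estimates has a right-continuous representative, which is
the limit of the averages over small intervals to the right of each point. -/
theorem IsOneSided.exists_rightContinuous (hΓ : IsCompact Γ) (hw : ∀ i, ContinuousOn (w i) Γ)
    (hinj : InjOn (fun u i => w i u) Γ) (hΘ : ∀ i, ContinuousOn (Θ i) (Ioo a b))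
    (hg : IsOneSided Γ w Θ a b g) :
    ∃ G : ℝ → EuclideanSpace ℝ (Fin n), (∀ x ∈ Ioo a b, G x ∈ Γ ∧
      Tendsto (fun y => ⨍ r in Icc x y, g r) (𝓝[>] x) (𝓝 (G x)) ∧
      ContinuousWithinAt G (Ioi x) x) ∧ ∀ᵐ x ∂(volume.restrict (Icc a b)), G x = g x := by
  classical
  obtain ⟨N, hNI, hNae, hNΓ, hanti⟩ := hg.exists_antitoneOn
  have hlim : ∀ x ∈ Ioo a b, ∃ z ∈ Γ, Tendsto g (𝓝[N ∩ Ioi x] x) (𝓝 z) := by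
    intro x hx
    have hne := neBot_nhdsWithin_inter_Ioi hNae hx
    refine exists_tendsto_of_coords hΓ hw hinj ?_ fun i => ?_
    · filter_upwards [self_mem_nhdsWithin] with y hy using hNΓ y hy.1
    · have hΘx : Tendsto (Θ i) (𝓝[N ∩ Ioi x] x) (𝓝 (Θ i x)) :=
        ((hΘ i).continuousAt (isOpen_Ioo.mem_nhds hx)).tendsto.mono_left nhdsWithin_le_nhds
      obtain ⟨B, hB⟩ := hΓ.bddAbove_image (hw i)
      obtain ⟨L, hL⟩ := (hanti i).exists_tendsto_right (x := x) (B := B - (Θ i x - 1)) (by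
        filter_upwards [self_mem_nhdsWithin, hΘx.eventually (lt_mem_nhds (sub_one_lt _))]
          with y hy hy'
        have := hB ⟨g y, hNΓ y hy.1, rfl⟩
        linarith)
      exact ⟨_, (hL.add hΘx).congr fun y => by ring⟩
  choose! G hGΓ hG using hlim
  have hav : ∀ x ∈ Ioo a b, Tendsto (fun y => ⨍ r in Icc x y, g r) (𝓝[>] x) (𝓝 (G x)) := by
    intro x hx
    rw [Metric.tendsto_nhds]
    intro ε hε
    obtain ⟨δ, hδ, h⟩ := eventually_nhdsWithin_inter_Ioi_iff.1
      (Metric.tendsto_nhds.1 (hG x hx) (ε / 2) (by positivity))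
    filter_upwards [Ioo_mem_nhdsGT (show x < min (x + δ) b from lt_min (by linarith) hx.2)]
      with y hy
    obtain ⟨hy1, hy2⟩ := lt_min_iff.1 hy.2
    refine lt_of_le_of_lt (Metric.mem_closedBall.1 ((convex_closedBall (G x)
      (ε / 2)).set_average_mem Metric.isClosed_closedBall ?_ ?_ ?_ ?_)) (half_lt_self hε)
    · rw [Real.volume_Icc]; simp [hy.1]
    · rw [Real.volume_Icc]; simp
    · rw [ae_restrict_Icc_iff]
      filter_upwards [hNae] with r hr hrI
      exact (h r (hr ⟨hx.1.trans hrI.1, hrI.2.trans hy2⟩) hrI.1 (hrI.2.trans hy1)).le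
    · exact (hg.integrableOn hΓ).mono_set (Icc_subset_Icc hx.1.le hy2.le)
  refine ⟨G, fun x hx => ⟨hGΓ x hx, hav x hx, ?_⟩, ?_⟩
  · rw [ContinuousWithinAt, Metric.tendsto_nhds]
    intro ε hε
    obtain ⟨δ, hδ, h⟩ := eventually_nhdsWithin_inter_Ioi_iff.1
      (Metric.tendsto_nhds.1 (hG x hx) (ε / 2) (by positivity))
    filter_upwards [Ioo_mem_nhdsGT (show x < min (x + δ) b from lt_min (by linarith) hx.2)]
      with y hy
    obtain ⟨hy1, hy2⟩ := lt_min_iff.1 hy.2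
    have hyI : y ∈ Ioo a b := ⟨hx.1.trans hy.1, hy2⟩
    have hne := neBot_nhdsWithin_inter_Ioi hNae hyI
    refine lt_of_le_of_lt (le_of_tendsto ((hG y hyI).dist tendsto_const_nhds)
      (?_ : ∀ᶠ r in 𝓝[N ∩ Ioi y] y, dist (g r) (G x) ≤ ε / 2)) (half_lt_self hε)
    rw [eventually_nhdsWithin_inter_Ioi_iff]
    exact ⟨x + δ - y, by linarith, fun r hr hyr hr' =>
      (h r hr (hy.1.trans hyr) (by linarith)).le⟩
  · have hloc : LocallyIntegrable ((Icc a b).indicator g) :=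
      ((integrable_indicator_iff measurableSet_Icc).2 (hg.integrableOn hΓ)).locallyIntegrable
    rw [ae_restrict_Icc_iff]
    filter_upwards [ae_tendsto_average_right hloc] with x hx hxI
    rw [indicator_of_mem (Ioo_subset_Icc_self hxI)] at hx
    refine tendsto_nhds_unique (hav x hxI) (hx.congr' ?_)
    filter_upwards [Ioc_mem_nhdsGT hxI.2] with y hy
    rw [setAverage_eq, setIntegral_congr_fun (g := g) measurableSet_Icc, ← setAverage_eq]
    exact fun r hr => indicator_of_mem (show r ∈ Icc a b from
      ⟨hxI.1.le.trans hr.1, hr.2.trans hy.2⟩) _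

theorem IsOneSided.congr {g' : ℝ → EuclideanSpace ℝ (Fin n)} (hg : IsOneSided Γ w Θ a b g)
    (h : g =ᵐ[volume.restrict (Icc a b)] g') : IsOneSided Γ w Θ a b g' := by
  refine ⟨hg.aestronglyMeasurable.congr h, ?_, fun i => ?_⟩
  · filter_upwards [hg.ae_mem, h] with x hx hx'
    rwa [← hx']
  · have h' := ae_restrict_Icc_iff.1 h
    filter_upwards [hg.le i, Measure.quasiMeasurePreserving_fst.ae h',
      Measure.quasiMeasurePreserving_snd.ae h'] with q hq h1 h2 hq1 hq12 hq2
    rw [← h1 ⟨hq1, hq12.trans hq2⟩, ← h2 ⟨hq1.trans hq12, hq2⟩]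
    exact hq hq1 hq12 hq2

theorem IsOneSided.mono_right {Θ' : Fin n → ℝ → ℝ} (hg : IsOneSided Γ w Θ a b g)
    (h : ∀ i x y, a < x → x < y → y < b → Θ i y - Θ i x ≤ Θ' i y - Θ' i x) :
    IsOneSided Γ w Θ' a b g :=
  ⟨hg.aestronglyMeasurable, hg.ae_mem, fun i => by
    filter_upwards [hg.le i] with q hq h1 h2 h3 using (hq h1 h2 h3).trans (h i _ _ h1 h2 h3)⟩

theorem IsOneSided.of_tendsto (hΓ : IsCompact Γ) (hw : ∀ i, ContinuousOn (w i) Γ)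
    {G : ℕ → ℝ → EuclideanSpace ℝ (Fin n)} (hG : ∀ k, IsOneSided Γ w Θ a b (G k))
    (hlim : ∀ᵐ x ∂(volume.restrict (Icc a b)), Tendsto (fun k => G k x) atTop (𝓝 (g x))) :
    IsOneSided Γ w Θ a b g := by
  have hmem : ∀ᵐ x ∂(volume.restrict (Icc a b)), ∀ k, G k x ∈ Γ :=
    ae_all_iff.2 fun k => (hG k).ae_mem
  refine ⟨aestronglyMeasurable_of_tendsto_ae atTop (fun k => (hG k).aestronglyMeasurable) hlim,
    ?_, fun i => ?_⟩
  · filter_upwards [hlim, hmem] with x hx hx'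
    exact hΓ.isClosed.mem_of_tendsto hx (Eventually.of_forall hx')
  · have hpt : ∀ᵐ x, x ∈ Ioo a b → Tendsto (fun k => w i (G k x)) atTop (𝓝 (w i (g x))) := by
      filter_upwards [ae_restrict_Icc_iff.1 hlim, ae_restrict_Icc_iff.1 hmem] with x hx hx' hxI
      have h1 := hΓ.isClosed.mem_of_tendsto (hx hxI) (Eventually.of_forall (hx' hxI))
      exact (hw i _ h1).tendsto.comp (tendsto_nhdsWithin_iff.2
        ⟨hx hxI, Eventually.of_forall (hx' hxI)⟩)
    filter_upwards [ae_all_iff.2 fun k => (hG k).le i, Measure.quasiMeasurePreserving_fst.ae hpt,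
      Measure.quasiMeasurePreserving_snd.ae hpt] with q hq h1 h2 hq1 hq12 hq2
    exact le_of_tendsto ((h2 ⟨hq1.trans hq12, hq2⟩).sub (h1 ⟨hq1, hq12.trans hq2⟩))
      (Eventually.of_forall fun k => hq k hq1 hq12 hq2)

/-- **Helly's selection principle** for functions satisfying the one-sided estimates. -/
theorem exists_subseq_tendsto_ae (hΓ : IsCompact Γ) (hw : ∀ i, ContinuousOn (w i) Γ)
    (hinj : InjOn (fun u i => w i u) Γ)
    {G : ℕ → ℝ → EuclideanSpace ℝ (Fin n)} (hG : ∀ k, IsOneSided Γ w Θ a b (G k)) :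
    ∃ φ : ℕ → ℕ, StrictMono φ ∧ ∀ᵐ x ∂(volume.restrict (Icc a b)),
      ∃ z, Tendsto (fun k => G (φ k) x) atTop (𝓝 z) := by
  choose N hNI hNae hNΓ hanti using fun k => (hG k).exists_antitoneOn
  set N' : Set ℝ := Ioo a b ∩ ⋂ k, N k with hN'
  have hN'ae : ∀ᵐ x, x ∈ Ioo a b → x ∈ N' := by
    filter_upwards [ae_all_iff.2 hNae] with x hx hxI
    exact ⟨hxI, mem_iInter.2 fun k => hx k hxI⟩
  have hN'N : ∀ k, N' ⊆ N k := fun k => inter_subset_right.trans (iInter_subset _ k)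
  obtain ⟨D, hDN, hDc, hDd⟩ :=
    (TopologicalSpace.IsSeparable.of_separableSpace N').exists_countable_dense_subset
  have hD : ∀ x y, a ≤ x → x < y → y ≤ b → ∃ d ∈ D, x < d ∧ d < y := by
    intro x y hax hxy hyb
    obtain ⟨r, hr, hxr, hry⟩ := exists_mem_between_of_ae hN'ae hax hxy hyb
    obtain ⟨d, hd, hdD⟩ := mem_closure_iff.1 (hDd hr) (Ioo x y) isOpen_Ioo ⟨hxr, hry⟩
    exact ⟨d, hdD, hd.1, hd.2⟩
  have : Countable D := hDc.to_subtype
  -- The countable product of copies of `Γ` is sequentially compact: one subsequence converges at all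
  -- points of `D`.
  obtain ⟨p, hp, φ, hφ, hlim⟩ := (isCompact_univ_pi fun _ : D => hΓ).tendsto_subseq
    (x := fun k (d : D) => G k d) fun k d _ => hNΓ k d (hN'N k (hDN d.2))
  rw [tendsto_pi_nhds] at hlim
  have hZ : ∀ i, ∃ Z : Set ℝ, Z.Countable ∧ ∀ x ∈ N', x ∉ Z →
      ∃ c, Tendsto (fun k => w i (G (φ k) x) - Θ i x) atTop (𝓝 c) := by
    intro i
    have h1 : ∀ d ∈ D, ∃ c, Tendsto (fun k => w i (G (φ k) d) - Θ i d) atTop (𝓝 c) := by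
      intro d hd
      have h2 : p ⟨d, hd⟩ ∈ Γ := hp ⟨d, hd⟩ trivial
      exact ⟨_, ((hw i _ h2).tendsto.comp (tendsto_nhdsWithin_iff.2 ⟨hlim ⟨d, hd⟩,
        Eventually.of_forall fun k => hNΓ _ d (hN'N _ (hDN hd))⟩)).sub_const _⟩
    choose! L hL using h1
    exact exists_countable_tendsto_of_antitoneOn (m := fun k x => w i (G (φ k) x) - Θ i x)
      inter_subset_left (fun k => (hanti (φ k) i).mono (hN'N _)) hDN hD hL
  choose Z hZc hZ using hZ
  refine ⟨φ, hφ, ?_⟩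
  rw [ae_restrict_Icc_iff]
  filter_upwards [hN'ae, (countable_iUnion hZc).ae_notMem volume] with x hx hxZ hxI
  obtain ⟨z, -, hz⟩ := exists_tendsto_of_coords (l := atTop) (ξ := fun k => G (φ k) x) hΓ hw hinj
    (Eventually.of_forall fun k => hNΓ _ x (hN'N _ (hx hxI))) fun i => by
      obtain ⟨c, hc⟩ := hZ i x (hx hxI) fun h => hxZ (mem_iUnion.2 ⟨i, h⟩)
      exact ⟨c + Θ i x, (hc.add_const (Θ i x)).congr fun k => by ring⟩
  exact ⟨z, hz⟩

end OneSided

/-! ### Compactness in `L¹` -/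

section L1

variable {n : ℕ} {a b : ℝ}

theorem L1_norm_sub_eq {f g : ℝ → EuclideanSpace ℝ (Fin n)}
    {F G : Lp (EuclideanSpace ℝ (Fin n)) 1 (volume.restrict (Icc a b))}
    (hF : F =ᵐ[volume.restrict (Icc a b)] f) (hG : G =ᵐ[volume.restrict (Icc a b)] g) :
    ‖F - G‖ = ∫ x in Icc a b, ‖f x - g x‖ := by
  rw [L1.norm_eq_integral_norm]
  refine integral_congr_ae ?_
  filter_upwards [Lp.coeFn_sub F G, hF, hG] with x hx hf hg
  rw [hx, Pi.sub_apply, hf, hg]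

theorem L1_tendsto_of_ae {R : ℝ} {F : ℕ → Lp (EuclideanSpace ℝ (Fin n)) 1 (volume.restrict (Icc a b))}
    {G : Lp (EuclideanSpace ℝ (Fin n)) 1 (volume.restrict (Icc a b))}
    (hR : ∀ k, ∀ᵐ x ∂(volume.restrict (Icc a b)), ‖F k x‖ ≤ R)
    (hlim : ∀ᵐ x ∂(volume.restrict (Icc a b)), Tendsto (fun k => F k x) atTop (𝓝 (G x))) :
    Tendsto F atTop (𝓝 G) := by
  rw [tendsto_iff_norm_sub_tendsto_zero]
  simp_rw [fun k => L1_norm_sub_eq (f := F k) (g := G) EventuallyEq.rfl EventuallyEq.rfl]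
  have hG : ∀ᵐ x ∂(volume.restrict (Icc a b)), ‖G x‖ ≤ R := by
    filter_upwards [hlim, ae_all_iff.2 hR] with x hx hx'
    exact le_of_tendsto hx.norm (Eventually.of_forall hx')
  have := tendsto_integral_of_dominated_convergence (μ := volume.restrict (Icc a b))
    (F := fun k x => ‖F k x - G x‖) (f := fun _ => (0 : ℝ)) (fun _ => R + R)
    (fun k => ((Lp.aestronglyMeasurable (F k)).sub (Lp.aestronglyMeasurable G)).norm)
    (integrable_const _) (fun k => by
      filter_upwards [hR k, hG] with x hx hx'
      rw [norm_norm]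
      exact (norm_sub_le _ _).trans (add_le_add hx hx')) (by
      filter_upwards [hlim] with x hx
      exact tendsto_iff_norm_sub_tendsto_zero.1 hx)
  simpa using this

/-- The functions satisfying given one-sided estimates form a compact subset of `L¹`. -/
theorem isCompact_setOf_isOneSided {Γ : Set (EuclideanSpace ℝ (Fin n))}
    {w : Fin n → EuclideanSpace ℝ (Fin n) → ℝ} {Θ : Fin n → ℝ → ℝ}
    (hΓ : IsCompact Γ) (hw : ∀ i, ContinuousOn (w i) Γ) (hinj : InjOn (fun u i => w i u) Γ) :
    IsCompact {F : Lp (EuclideanSpace ℝ (Fin n)) 1 (volume.restrict (Icc a b)) |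
      IsOneSided Γ w Θ a b F} := by
  refine IsSeqCompact.isCompact fun F hF => ?_
  obtain ⟨R, hR⟩ := hΓ.isBounded.exists_norm_le
  obtain ⟨φ, hφ, hlim⟩ := exists_subseq_tendsto_ae hΓ hw hinj hF
  obtain ⟨g, hgm, hg⟩ := exists_stronglyMeasurable_limit_of_tendsto_ae
    (fun k => (hF (φ k)).aestronglyMeasurable) hlim
  have hone : IsOneSided Γ w Θ a b g := IsOneSided.of_tendsto hΓ hw (fun k => hF (φ k)) hg
  have hint : Integrable g (volume.restrict (Icc a b)) := hone.integrableOn hΓ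
  have hG := hint.coeFn_toL1
  refine ⟨hint.toL1 g, hone.congr hG.symm, φ, hφ,
    L1_tendsto_of_ae (R := R) (fun k => (hF (φ k)).ae_mem.mono fun x hx => hR _ hx) ?_⟩
  filter_upwards [hg, hG] with x hx hx'
  rwa [hx']

theorem continuous_pairing {ψ : ℝ → ℝ} (hψ : IsTestFunction a b ψ) (e : EuclideanSpace ℝ (Fin n)) :
    Continuous fun F : Lp (EuclideanSpace ℝ (Fin n)) 1 (volume.restrict (Icc a b)) =>
      ∫ x in Icc a b, ψ x * inner ℝ (F x) e := by
  obtain ⟨B, hB⟩ := hψ.contDiff.continuous.bounded_above_of_compact_support hψ.hasCompactSupport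
  have hle : ∀ f : ℝ → EuclideanSpace ℝ (Fin n), ∀ x, ‖ψ x * inner ℝ (f x) e‖ ≤ B * ‖e‖ * ‖f x‖ := by
    intro f x
    rw [norm_mul, mul_assoc, mul_comm ‖e‖]
    exact mul_le_mul (hB x) (norm_inner_le_norm _ _) (norm_nonneg _) ((norm_nonneg _).trans (hB x))
  have hint : ∀ f : ℝ → EuclideanSpace ℝ (Fin n), IntegrableOn f (Icc a b) →
      IntegrableOn (fun x => ψ x * inner ℝ (f x) e) (Icc a b) := fun f hf =>
    (hf.norm.const_mul (B * ‖e‖)).mono' (hψ.contDiff.continuous.aestronglyMeasurable.mul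
      (hf.aestronglyMeasurable.inner aestronglyMeasurable_const)) (Eventually.of_forall (hle f))
  refine (LipschitzWith.of_dist_le' (K := B * ‖e‖) fun F G => ?_).continuous
  rw [Real.dist_eq, dist_eq_norm, L1_norm_sub_eq (f := F) (g := G) EventuallyEq.rfl EventuallyEq.rfl,
    ← integral_sub (hint F (L1.integrable_coeFn F)) (hint G (L1.integrable_coeFn G)),
    ← integral_const_mul, ← Real.norm_eq_abs]
  refine norm_integral_le_of_norm_le
    (((L1.integrable_coeFn F).sub (L1.integrable_coeFn G)).norm.const_mul _)
    (Eventually.of_forall fun x => ?_)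
  rw [← mul_sub, ← inner_sub_left]
  exact hle (fun x => F x - G x) x

/-- On compact subsets of `L¹`, convergence against test functions implies convergence. -/
theorem tendsto_L1_of_tendsto_pairing
    {K : Set (Lp (EuclideanSpace ℝ (Fin n)) 1 (volume.restrict (Icc a b)))} (hK : IsCompact K)
    {ι : Type*} {l : Filter ι} {V : ι → Lp (EuclideanSpace ℝ (Fin n)) 1 (volume.restrict (Icc a b))}
    {p : Lp (EuclideanSpace ℝ (Fin n)) 1 (volume.restrict (Icc a b))} (hV : ∀ᶠ k in l, V k ∈ K)
    (hlim : ∀ ψ, IsTestFunction a b ψ → ∀ e : EuclideanSpace ℝ (Fin n),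
      Tendsto (fun k => ∫ x in Icc a b, ψ x * inner ℝ (V k x) e) l
        (𝓝 (∫ x in Icc a b, ψ x * inner ℝ (p x) e))) :
    Tendsto V l (𝓝 p) := by
  refine hK.tendsto_nhds_of_unique_mapClusterPt hV fun q _ hq => ?_
  obtain ⟨U, hU, hUq⟩ := mapClusterPt_iff_ultrafilter.1 hq
  rw [← sub_eq_zero, Lp.eq_zero_iff_ae_eq_zero]
  refine ae_eq_zero_of_test (L1.integrable_coeFn _) fun ψ hψ e => ?_
  have h1 := tendsto_nhds_unique (((continuous_pairing hψ e).tendsto q).comp hUq)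
    ((hlim ψ hψ e).mono_left hU)
  have hi : ∀ F : Lp (EuclideanSpace ℝ (Fin n)) 1 (volume.restrict (Icc a b)),
      IntegrableOn (fun x => ψ x * inner ℝ (F x) e) (Icc a b) := fun F =>
    IntegrableOn.continuousOn_mul hψ.contDiff.continuous.continuousOn
      ((L1.integrable_coeFn F).inner_const e) isCompact_Icc
  rw [← sub_eq_zero, ← integral_sub (hi q) (hi p)] at h1
  rw [← h1]
  refine integral_congr_ae ?_
  filter_upwards [Lp.coeFn_sub q p] with x hx
  rw [hx, Pi.sub_apply, inner_sub_left, mul_sub]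

end L1

/-! ### Weak solutions tested with products -/

section Fubini

variable {a b T : ℝ}

theorem volume_restrict_prod (s t : Set ℝ) :
    (volume : Measure (ℝ × ℝ)).restrict (s ×ˢ t) = (volume.restrict s).prod (volume.restrict t) := by
  rw [Measure.volume_eq_prod, Measure.prod_restrict]

theorem integrableOn_mul_mul {A B : ℝ → ℝ} {k : ℝ × ℝ → ℝ} (hA : Continuous A) (hB : Continuous B)
    (hk : IntegrableOn k (Icc 0 T ×ˢ Icc a b)) :
    IntegrableOn (fun q : ℝ × ℝ => A q.1 * B q.2 * k q) (Icc 0 T ×ˢ Icc a b) :=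
  hk.continuousOn_mul ((hA.comp continuous_fst).mul (hB.comp continuous_snd)).continuousOn
    (isCompact_Icc.prod isCompact_Icc)

theorem setIntegral_mul_mul {A B : ℝ → ℝ} {k : ℝ × ℝ → ℝ} (hA : Continuous A) (hB : Continuous B)
    (hk : IntegrableOn k (Icc 0 T ×ˢ Icc a b)) :
    ∫ q in Icc 0 T ×ˢ Icc a b, A q.1 * B q.2 * k q =
      ∫ t in Icc 0 T, A t * ∫ x in Icc a b, B x * k (t, x) := by
  have h := integrableOn_mul_mul hA hB hk
  rw [IntegrableOn, volume_restrict_prod] at h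
  rw [volume_restrict_prod, integral_prod _ h]
  refine integral_congr_ae (Eventually.of_forall fun t => ?_)
  beta_reduce
  rw [← integral_const_mul]
  simp_rw [mul_assoc]

theorem setIntegral_mul_mul_symm {A B : ℝ → ℝ} {k : ℝ × ℝ → ℝ} (hA : Continuous A)
    (hB : Continuous B) (hk : IntegrableOn k (Icc 0 T ×ˢ Icc a b)) :
    ∫ q in Icc 0 T ×ˢ Icc a b, A q.1 * B q.2 * k q =
      ∫ x in Icc a b, B x * ∫ t in Icc 0 T, A t * k (t, x) := by
  have h := integrableOn_mul_mul hA hB hk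
  rw [IntegrableOn, volume_restrict_prod] at h
  rw [volume_restrict_prod, integral_prod_symm _ h]
  refine integral_congr_ae (Eventually.of_forall fun x => ?_)
  beta_reduce
  rw [← integral_const_mul]
  refine integral_congr_ae (Eventually.of_forall fun t => ?_)
  beta_reduce
  ring

theorem abs_setIntegral_mul_le {s : Set ℝ} {R : ℝ} {A k : ℝ → ℝ} (hA : IntegrableOn A s)
    (hk : ∀ᵐ t ∂(volume.restrict s), |k t| ≤ R) :
    |∫ t in s, A t * k t| ≤ R * ∫ t in s, |A t| := by
  rw [← Real.norm_eq_abs, ← integral_const_mul]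
  refine norm_integral_le_of_norm_le (hA.abs.const_mul R) ?_
  filter_upwards [hk] with t ht
  rw [norm_mul, mul_comm]
  exact mul_le_mul_of_nonneg_right ht (abs_nonneg _)

end Fubini

/-- The weak form of `u_t + f(u)_x = 0` with initial datum `ubar`, for measurable `u` with values in
`Γ`. -/
structure IsWeakSolution {n : ℕ} (Γ : Set (EuclideanSpace ℝ (Fin n)))
    (f : EuclideanSpace ℝ (Fin n) → EuclideanSpace ℝ (Fin n)) (a b T : ℝ)
    (ubar : ℝ → EuclideanSpace ℝ (Fin n)) (u : ℝ → ℝ → EuclideanSpace ℝ (Fin n)) : Prop where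
  mem : ∀ t ∈ Icc 0 T, ∀ x ∈ Icc a b, u t x ∈ Γ
  measurable : AEStronglyMeasurable (fun q : ℝ × ℝ => u q.1 q.2)
    (volume.restrict (Icc 0 T ×ˢ Icc a b))
  weak : ∀ φ : ℝ × ℝ → EuclideanSpace ℝ (Fin n), ContDiff ℝ 1 φ → HasCompactSupport φ →
    tsupport φ ⊆ {q | q.1 < T ∧ a < q.2 ∧ q.2 < b} →
    IntegrableOn (fun q : ℝ × ℝ => inner ℝ (u q.1 q.2) (fderiv ℝ φ q (1, 0)) +
      inner ℝ (f (u q.1 q.2)) (fderiv ℝ φ q (0, 1))) (Icc 0 T ×ˢ Icc a b) ∧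
    (∫ q in Icc 0 T ×ˢ Icc a b, (inner ℝ (u q.1 q.2) (fderiv ℝ φ q (1, 0)) +
      inner ℝ (f (u q.1 q.2)) (fderiv ℝ φ q (0, 1)))) +
      ∫ x in Icc a b, inner ℝ (ubar x) (φ (0, x)) = 0

/-- A continuous function on a compact set extends to a continuous function on the whole space. -/
theorem exists_continuous_extension {n : ℕ} {Γ : Set (EuclideanSpace ℝ (Fin n))} (hΓ : IsClosed Γ)
    {f : EuclideanSpace ℝ (Fin n) → EuclideanSpace ℝ (Fin n)} (hf : ContinuousOn f Γ) :
    ∃ F : EuclideanSpace ℝ (Fin n) → EuclideanSpace ℝ (Fin n), Continuous F ∧ ∀ x ∈ Γ, F x = f x := by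
  obtain ⟨F, hF⟩ := ContinuousMap.exists_restrict_eq hΓ ⟨Γ.domRestrict f, hf.domRestrict⟩
  exact ⟨F, F.continuous, fun x hx => congrArg (fun G : C(Γ, _) => G ⟨x, hx⟩) hF⟩

namespace IsWeakSolution

variable {n : ℕ} {Γ : Set (EuclideanSpace ℝ (Fin n))}
  {f : EuclideanSpace ℝ (Fin n) → EuclideanSpace ℝ (Fin n)} {a b T R : ℝ}
  {ubar : ℝ → EuclideanSpace ℝ (Fin n)} {u : ℝ → ℝ → EuclideanSpace ℝ (Fin n)}

theorem integrableOn_comp (hΓ : IsCompact Γ) {F : EuclideanSpace ℝ (Fin n) → EuclideanSpace ℝ (Fin n)}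
    (hF : ContinuousOn F Γ) (hR : ∀ z ∈ Γ, ‖F z‖ ≤ R) (hu : IsWeakSolution Γ f a b T ubar u) :
    IntegrableOn (fun q : ℝ × ℝ => F (u q.1 q.2)) (Icc 0 T ×ˢ Icc a b) := by
  obtain ⟨F', hF', hFF'⟩ := exists_continuous_extension hΓ.isClosed hF
  have hmem : ∀ᵐ q : ℝ × ℝ ∂(volume.restrict (Icc 0 T ×ˢ Icc a b)), u q.1 q.2 ∈ Γ := by
    filter_upwards [ae_restrict_mem (measurableSet_Icc.prod measurableSet_Icc)] with q hq
    exact hu.mem _ hq.1 _ hq.2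
  have : IsFiniteMeasure ((volume : Measure (ℝ × ℝ)).restrict (Icc 0 T ×ˢ Icc a b)) :=
    ⟨by rw [Measure.restrict_apply_univ]; exact (isCompact_Icc.prod isCompact_Icc).measure_lt_top⟩
  refine Integrable.of_bound ?_ R (hmem.mono fun q hq => hR _ hq)
  refine (hF'.comp_aestronglyMeasurable hu.measurable).congr ?_
  filter_upwards [hmem] with q hq using hFF' _ hq

theorem integrableOn_inner (hΓ : IsCompact Γ)
    {F : EuclideanSpace ℝ (Fin n) → EuclideanSpace ℝ (Fin n)}
    (hF : ContinuousOn F Γ) (hR : ∀ z ∈ Γ, ‖F z‖ ≤ R) (hu : IsWeakSolution Γ f a b T ubar u)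
    (e : EuclideanSpace ℝ (Fin n)) :
    IntegrableOn (fun q : ℝ × ℝ => inner ℝ (F (u q.1 q.2)) e) (Icc 0 T ×ˢ Icc a b) :=
  (hu.integrableOn_comp hΓ hF hR).inner_const e

/-- The weak form for test functions `(t, x) ↦ g(t) ψ(x) e`. -/
theorem weak_product (hΓ : IsCompact Γ) (hf : ContinuousOn f Γ) (hR : ∀ z ∈ Γ, ‖z‖ ≤ R)
    (hRf : ∀ z ∈ Γ, ‖f z‖ ≤ R) (hu : IsWeakSolution Γ f a b T ubar u) {g ψ : ℝ → ℝ}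
    (hg : IsTestFunction 0 T g) (hψ : IsTestFunction a b ψ) (e : EuclideanSpace ℝ (Fin n)) :
    (∫ q in Icc 0 T ×ˢ Icc a b, deriv g q.1 * ψ q.2 * inner ℝ (u q.1 q.2) e) +
      ∫ q in Icc 0 T ×ˢ Icc a b, g q.1 * deriv ψ q.2 * inner ℝ (f (u q.1 q.2)) e = 0 := by
  set φ : ℝ × ℝ → EuclideanSpace ℝ (Fin n) := fun q => (g q.1 * ψ q.2) • e with hφ
  have hφC : ContDiff ℝ 1 φ :=
    ((hg.contDiff.comp contDiff_fst).mul (hψ.contDiff.comp contDiff_snd)).smul contDiff_const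
  have hsub : Function.support φ ⊆ tsupport g ×ˢ tsupport ψ := by
    intro q hq
    refine ⟨subset_tsupport g fun h => hq ?_, subset_tsupport ψ fun h => hq ?_⟩ <;>
      simp [hφ, h]
  have htsub : tsupport φ ⊆ tsupport g ×ˢ tsupport ψ :=
    closure_minimal hsub ((isClosed_tsupport g).prod (isClosed_tsupport ψ))
  have hφK : HasCompactSupport φ := HasCompactSupport.of_support_subset_isCompact
    (hg.hasCompactSupport.isCompact.prod hψ.hasCompactSupport.isCompact) hsub
  have h := (hu.weak φ hφC hφK fun q hq => by
    have h1 := hg.tsupport_subset (htsub hq).1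
    have h2 := hψ.tsupport_subset (htsub hq).2
    exact ⟨h1.2, h2.1, h2.2⟩).2
  have h0 : ∀ x, φ (0, x) = 0 := fun x => by
    simp [hφ, hg.eq_zero (x := 0) fun h => h.1.false]
  have hfd : ∀ q : ℝ × ℝ, HasFDerivAt φ (((g q.1 • (deriv ψ q.2 • ContinuousLinearMap.snd ℝ ℝ ℝ) +
      ψ q.2 • (deriv g q.1 • ContinuousLinearMap.fst ℝ ℝ ℝ))).smulRight e) q := fun q => by
    have h1 : HasFDerivAt (fun q : ℝ × ℝ => g q.1)
        (deriv g q.1 • ContinuousLinearMap.fst ℝ ℝ ℝ) q :=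
      ((hg.contDiff.differentiable one_ne_zero _).hasDerivAt).comp_hasFDerivAt q hasFDerivAt_fst
    have h2 : HasFDerivAt (fun q : ℝ × ℝ => ψ q.2)
        (deriv ψ q.2 • ContinuousLinearMap.snd ℝ ℝ ℝ) q :=
      ((hψ.contDiff.differentiable one_ne_zero _).hasDerivAt).comp_hasFDerivAt q hasFDerivAt_snd
    exact (h1.mul h2).smul_const e
  simp only [h0, inner_zero_right, integral_zero, add_zero] at h
  have hi1 : IntegrableOn (fun q : ℝ × ℝ => deriv g q.1 * ψ q.2 * inner ℝ (u q.1 q.2) e)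
      (Icc 0 T ×ˢ Icc a b) := integrableOn_mul_mul hg.continuous_deriv hψ.contDiff.continuous
    (hu.integrableOn_inner hΓ continuousOn_id hR e)
  have hi2 : IntegrableOn (fun q : ℝ × ℝ => g q.1 * deriv ψ q.2 * inner ℝ (f (u q.1 q.2)) e)
      (Icc 0 T ×ˢ Icc a b) := integrableOn_mul_mul hg.contDiff.continuous hψ.continuous_deriv
    (hu.integrableOn_inner hΓ hf hRf e)
  rw [← integral_add hi1 hi2]
  refine Eq.trans ?_ h
  refine integral_congr_ae (Eventually.of_forall fun q => ?_)
  simp [(hfd q).fderiv, inner_smul_right, mul_comm]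

/-- Pairings of the profiles `u(t, ·)` with a test function have a bounded weak derivative. -/
theorem abs_integral_time_le (hΓ : IsCompact Γ) (hf : ContinuousOn f Γ) (hR : ∀ z ∈ Γ, ‖z‖ ≤ R)
    (hRf : ∀ z ∈ Γ, ‖f z‖ ≤ R) (hu : IsWeakSolution Γ f a b T ubar u) {g ψ : ℝ → ℝ}
    (hg : IsTestFunction 0 T g) (hψ : IsTestFunction a b ψ) (e : EuclideanSpace ℝ (Fin n)) :
    |∫ t in Icc 0 T, (∫ x in Icc a b, ψ x * inner ℝ (u t x) e) * deriv g t| ≤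
      (R * ‖e‖ * ∫ x in Icc a b, |deriv ψ x|) * ∫ t in Icc 0 T, |g t| := by
  have h := hu.weak_product hΓ hf hR hRf hg hψ e
  rw [setIntegral_mul_mul (k := fun q => inner ℝ (u q.1 q.2) e) hg.continuous_deriv
      hψ.contDiff.continuous (hu.integrableOn_inner hΓ continuousOn_id hR e),
    setIntegral_mul_mul (k := fun q => inner ℝ (f (u q.1 q.2)) e) hg.contDiff.continuous
      hψ.continuous_deriv (hu.integrableOn_inner hΓ hf hRf e)] at h
  simp_rw [mul_comm _ (deriv g _)]
  rw [eq_neg_of_add_eq_zero_left h, abs_neg]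
  refine abs_setIntegral_mul_le hg.contDiff.continuous.continuousOn.integrableOn_Icc ?_
  filter_upwards [ae_restrict_mem measurableSet_Icc] with t ht
  refine abs_setIntegral_mul_le hψ.continuous_deriv.continuousOn.integrableOn_Icc ?_
  filter_upwards [ae_restrict_mem measurableSet_Icc] with x hx
  exact (abs_real_inner_le_norm _ _).trans
    (mul_le_mul_of_nonneg_right (hRf _ (hu.mem t ht x hx)) (norm_nonneg _))

/-- Pairings of the fluxes `f(u(·, x))` with a test function have a bounded weak derivative. -/
theorem abs_integral_space_le (hΓ : IsCompact Γ) (hf : ContinuousOn f Γ) (hR : ∀ z ∈ Γ, ‖z‖ ≤ R)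
    (hRf : ∀ z ∈ Γ, ‖f z‖ ≤ R) (hu : IsWeakSolution Γ f a b T ubar u) {g ψ : ℝ → ℝ}
    (hg : IsTestFunction 0 T g) (hψ : IsTestFunction a b ψ) (e : EuclideanSpace ℝ (Fin n)) :
    |∫ x in Icc a b, (∫ t in Icc 0 T, g t * inner ℝ (f (u t x)) e) * deriv ψ x| ≤
      (R * ‖e‖ * ∫ t in Icc 0 T, |deriv g t|) * ∫ x in Icc a b, |ψ x| := by
  have h := hu.weak_product hΓ hf hR hRf hg hψ e
  rw [setIntegral_mul_mul_symm (k := fun q => inner ℝ (u q.1 q.2) e) hg.continuous_deriv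
      hψ.contDiff.continuous (hu.integrableOn_inner hΓ continuousOn_id hR e),
    setIntegral_mul_mul_symm (k := fun q => inner ℝ (f (u q.1 q.2)) e) hg.contDiff.continuous
      hψ.continuous_deriv (hu.integrableOn_inner hΓ hf hRf e)] at h
  simp_rw [mul_comm _ (deriv ψ _)]
  rw [eq_neg_of_add_eq_zero_right h, abs_neg]
  refine abs_setIntegral_mul_le hψ.contDiff.continuous.continuousOn.integrableOn_Icc ?_
  filter_upwards [ae_restrict_mem measurableSet_Icc] with x hx
  refine abs_setIntegral_mul_le hg.continuous_deriv.continuousOn.integrableOn_Icc ?_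
  filter_upwards [ae_restrict_mem measurableSet_Icc] with t ht
  exact (abs_real_inner_le_norm _ _).trans
    (mul_le_mul_of_nonneg_right (hR _ (hu.mem t ht x hx)) (norm_nonneg _))

theorem integrableOn_pairing_time (hΓ : IsCompact Γ) (hR : ∀ z ∈ Γ, ‖z‖ ≤ R)
    (hu : IsWeakSolution Γ f a b T ubar u) {ψ : ℝ → ℝ} (hψ : Continuous ψ)
    (e : EuclideanSpace ℝ (Fin n)) :
    IntegrableOn (fun t => ∫ x in Icc a b, ψ x * inner ℝ (u t x) e) (Icc 0 T) := by
  have h := integrableOn_mul_mul (continuous_const (y := (1 : ℝ))) hψ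
    (hu.integrableOn_inner hΓ continuousOn_id hR e)
  rw [IntegrableOn, volume_restrict_prod] at h
  rw [IntegrableOn]
  simpa using h.integral_prod_left

theorem integrableOn_pairing_space (hΓ : IsCompact Γ) (hf : ContinuousOn f Γ)
    (hRf : ∀ z ∈ Γ, ‖f z‖ ≤ R) (hu : IsWeakSolution Γ f a b T ubar u) {g : ℝ → ℝ}
    (hg : Continuous g) (e : EuclideanSpace ℝ (Fin n)) :
    IntegrableOn (fun x => ∫ t in Icc 0 T, g t * inner ℝ (f (u t x)) e) (Icc a b) := by
  have h := integrableOn_mul_mul hg (continuous_const (y := (1 : ℝ)))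
    (hu.integrableOn_inner hΓ hf hRf e)
  rw [IntegrableOn, volume_restrict_prod] at h
  rw [IntegrableOn]
  simpa using h.integral_prod_right

/-- Pairings of the profiles with a test function are Lipschitz continuous in time, with a constant
depending only on the bounds for the states and their fluxes. -/
theorem abs_pairing_sub_le (hΓ : IsCompact Γ) (hf : ContinuousOn f Γ) (hR0 : 0 ≤ R)
    (hR : ∀ z ∈ Γ, ‖z‖ ≤ R) (hRf : ∀ z ∈ Γ, ‖f z‖ ≤ R) (hu : IsWeakSolution Γ f a b T ubar u)
    {ψ : ℝ → ℝ} (hψ : IsTestFunction a b ψ) (e : EuclideanSpace ℝ (Fin n))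
    (hcont : ContinuousOn (fun t => ∫ x in Icc a b, ψ x * inner ℝ (u t x) e) (Ioc 0 T))
    {s t : ℝ} (hs : s ∈ Ioc 0 T) (ht : t ∈ Ioc 0 T) :
    |(∫ x in Icc a b, ψ x * inner ℝ (u t x) e) - ∫ x in Icc a b, ψ x * inner ℝ (u s x) e| ≤
      (R * ‖e‖ * ∫ x in Icc a b, |deriv ψ x|) * |t - s| := by
  set h : ℝ → ℝ := fun t => ∫ x in Icc a b, ψ x * inner ℝ (u t x) e with hh
  set L := R * ‖e‖ * ∫ x in Icc a b, |deriv ψ x|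
  have hL : 0 ≤ L := by positivity
  have hopen : ∀ s ∈ Ioo 0 T, ∀ t ∈ Ioo 0 T, s < t → |h t - h s| ≤ L * (t - s) := by
    intro s hs t ht hst
    refine abs_sub_le_of_weak_deriv hL (hu.integrableOn_pairing_time hΓ hR
      hψ.contDiff.continuous e) ?_ (fun g hg => hu.abs_integral_time_le hΓ hf hR hRf hg hψ e)
      hs.1 hst ht.2
    intro r hr
    exact (hcont.continuousAt (mem_of_superset (isOpen_Ioo.mem_nhds hr)
      Ioo_subset_Ioc_self)).continuousWithinAt
  have key : ∀ s ∈ Ioc 0 T, ∀ t ∈ Ioc 0 T, s < t → |h t - h s| ≤ L * (t - s) := by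
    intro s hs t ht hst
    have hst' : s ∈ Ioo 0 T := ⟨hs.1, hst.trans_le ht.2⟩
    have hc : Tendsto h (𝓝[Ioo s t] t) (𝓝 (h t)) :=
      (hcont t ht).mono_left (nhdsWithin_mono _ fun r hr => ⟨hs.1.trans hr.1, hr.2.le.trans ht.2⟩)
    have hid : Tendsto (fun r => L * (r - s)) (𝓝[Ioo s t] t) (𝓝 (L * (t - s))) :=
      ((continuous_id.sub continuous_const).const_mul L).continuousAt.mono_left nhdsWithin_le_nhds
    have : NeBot (𝓝[Ioo s t] t) := by
      rw [← mem_closure_iff_nhdsWithin_neBot, closure_Ioo hst.ne]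
      exact right_mem_Icc.2 hst.le
    refine le_of_tendsto_of_tendsto (hc.sub_const (h s)).abs hid ?_
    filter_upwards [self_mem_nhdsWithin] with r hr
    exact hopen s hst' r ⟨hs.1.trans hr.1, hr.2.trans_le ht.2⟩ hr.1
  rcases lt_trichotomy s t with hst | rfl | hst
  · rw [abs_of_pos (sub_pos.2 hst)]
    exact key s hs t ht hst
  · simp
  · rw [abs_sub_comm, abs_sub_comm t s, abs_of_pos (sub_pos.2 hst)]
    exact key t ht s hs hst

/-- If `u(t, ·)` is right-continuous, the pairings of `f(u(·, x))` with a test function have limits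
at both ends of the interval. -/
theorem exists_tendsto_pairing_flux (hΓ : IsCompact Γ) (hf : ContinuousOn f Γ) (hR0 : 0 ≤ R)
    (hR : ∀ z ∈ Γ, ‖z‖ ≤ R) (hRf : ∀ z ∈ Γ, ‖f z‖ ≤ R) (hu : IsWeakSolution Γ f a b T ubar u)
    (hm : ∀ x ∈ Ioo a b, AEStronglyMeasurable (fun t => f (u t x)) (volume.restrict (Icc 0 T)))
    (hrc : ∀ t ∈ Icc 0 T, ∀ x ∈ Ioo a b, ContinuousWithinAt (u t) (Ioi x) x)
    {g : ℝ → ℝ} (hg : IsTestFunction 0 T g) (e : EuclideanSpace ℝ (Fin n)) (x₀ : ℝ) :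
    ∃ c, Tendsto (fun x => ∫ t in Icc 0 T, g t * inner ℝ (f (u t x)) e) (𝓝[Ioo a b] x₀) (𝓝 c) := by
  set h : ℝ → ℝ := fun x => ∫ t in Icc 0 T, g t * inner ℝ (f (u t x)) e with hh
  set L := R * ‖e‖ * ∫ t in Icc 0 T, |deriv g t|
  have hL : 0 ≤ L := by positivity
  have hrch : ∀ x ∈ Ioo a b, ContinuousWithinAt h (Ioi x) x := by
    intro x hx
    have hnear : ∀ᶠ y in 𝓝[>] x, y ∈ Ioo a b := nhdsWithin_le_nhds (isOpen_Ioo.mem_nhds hx)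
    refine tendsto_integral_filter_of_dominated_convergence (fun t => |g t| * (R * ‖e‖)) ?_ ?_
      (hg.contDiff.continuous.abs.continuousOn.integrableOn_Icc.mul_const _) ?_
    · filter_upwards [hnear] with y hy
      exact hg.contDiff.continuous.aestronglyMeasurable.mul
        ((hm y hy).inner aestronglyMeasurable_const)
    · filter_upwards [hnear] with y hy
      filter_upwards [ae_restrict_mem measurableSet_Icc] with t ht
      rw [norm_mul]
      exact mul_le_mul_of_nonneg_left ((norm_inner_le_norm _ _).trans (mul_le_mul_of_nonneg_right
        (hRf _ (hu.mem t ht y (Ioo_subset_Icc_self hy))) (norm_nonneg _))) (abs_nonneg _)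
    · filter_upwards [ae_restrict_mem measurableSet_Icc] with t ht
      have h1 : Tendsto (u t) (𝓝[>] x) (𝓝[Γ] (u t x)) := tendsto_nhdsWithin_iff.2
        ⟨hrc t ht x hx, hnear.mono fun y hy => hu.mem t ht y (Ioo_subset_Icc_self hy)⟩
      have h2 := (hf _ (hu.mem t ht x (Ioo_subset_Icc_self hx))).tendsto.comp h1
      exact (h2.inner tendsto_const_nhds).const_mul (g t)
  have hlip : ∀ x ∈ Ioo a b, ∀ y ∈ Ioo a b, x < y → |h y - h x| ≤ L * (y - x) :=
    fun x hx y hy hxy => abs_sub_le_of_weak_deriv hL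
      (hu.integrableOn_pairing_space hΓ hf hRf hg.contDiff.continuous e) hrch
      (fun ψ hψ => hu.abs_integral_space_le hΓ hf hR hRf hg hψ e) hx.1 hxy hy.2
  have hlip' : LipschitzOnWith (Real.toNNReal L) h (Ioo a b) := by
    refine LipschitzOnWith.of_dist_le_mul fun x hx y hy => ?_
    rw [Real.coe_toNNReal L hL, Real.dist_eq, Real.dist_eq]
    rcases lt_trichotomy x y with hxy | rfl | hxy
    · rw [abs_sub_comm, abs_sub_comm x y, abs_of_pos (sub_pos.2 hxy)]
      exact hlip x hx y hy hxy
    · simp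
    · rw [abs_of_pos (sub_pos.2 hxy)]
      exact hlip y hy x hx hxy
  obtain ⟨H, hH, hHh⟩ := hlip'.extend_real
  refine ⟨H x₀, ((hH.continuous.tendsto x₀).mono_left nhdsWithin_le_nhds).congr' ?_⟩
  filter_upwards [self_mem_nhdsWithin] with x hx using (hHh hx).symm

end IsWeakSolution

/-! ### Curves of profiles -/

/-- The function `Θᵢ(t, ·)` for which the `i`-th spatial entropy condition at time `t` reads
`wᵢ(t, y) - wᵢ(t, x) ≤ Θᵢ(t, y) - Θᵢ(t, x)`. -/
noncomputable def TempleSystem.entropyBound {n : ℕ} (S : TempleSystem n) (C a b t : ℝ) (i : Fin n)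
    (x : ℝ) : ℝ :=
  if (i : ℕ) < S.p then C * (x / t - Real.log (b - x)) else C * (x / t + Real.log (x - a))

namespace TempleSystem

variable {n : ℕ} (S : TempleSystem n) {C a b s t : ℝ}

theorem entropyBound_sub_neg {i : Fin n} (hi : (i : ℕ) < S.p) {x y : ℝ} (hxy : x < y)
    (hy : y < b) : S.entropyBound C a b t i y - S.entropyBound C a b t i x =
      C * ((y - x) / t + Real.log ((b - x) / (b - y))) := by
  rw [entropyBound, entropyBound, if_pos hi, if_pos hi,
    Real.log_div (by linarith) (by linarith)]
  ring

theorem entropyBound_sub_pos {i : Fin n} (hi : S.p ≤ (i : ℕ)) {x y : ℝ} (hx : a < x)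
    (hxy : x < y) : S.entropyBound C a b t i y - S.entropyBound C a b t i x =
      C * ((y - x) / t + Real.log ((y - a) / (x - a))) := by
  rw [entropyBound, entropyBound, if_neg (not_lt.2 hi), if_neg (not_lt.2 hi),
    Real.log_div (by linarith) (by linarith)]
  ring

theorem continuousOn_entropyBound (i : Fin n) :
    ContinuousOn (S.entropyBound C a b t i) (Ioo a b) := by
  unfold entropyBound
  split_ifs
  · exact continuousOn_const.mul ((continuousOn_id.div_const t).sub
      ((continuousOn_const.sub continuousOn_id).log fun x hx => (sub_pos.2 hx.2).ne'))
  · exact continuousOn_const.mul ((continuousOn_id.div_const t).add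
      ((continuousOn_id.sub continuousOn_const).log fun x hx => (sub_pos.2 hx.1).ne'))

theorem entropyBound_sub_anti (hC : 0 < C) (hs : 0 < s) (hst : s ≤ t) (i : Fin n) {x y : ℝ}
    (hxy : x < y) : S.entropyBound C a b t i y - S.entropyBound C a b t i x ≤
      S.entropyBound C a b s i y - S.entropyBound C a b s i x := by
  have h : C * ((y - x) / t) ≤ C * ((y - x) / s) :=
    mul_le_mul_of_nonneg_left (div_le_div_of_nonneg_left (by linarith) hs hst) hC.le
  have e1 : C * ((y - x) / t) = C * (y / t) - C * (x / t) := by ring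
  have e2 : C * ((y - x) / s) = C * (y / s) - C * (x / s) := by ring
  unfold entropyBound
  split_ifs <;> linarith

end TempleSystem

namespace IsEntropyWeakSolution

variable {n : ℕ} {S : TempleSystem n} {Γ : Set (EuclideanSpace ℝ (Fin n))} {C a b T R : ℝ}
  {ubar ua ub : ℝ → EuclideanSpace ℝ (Fin n)} {u : ℝ → ℝ → EuclideanSpace ℝ (Fin n)}

theorem isWeakSolution (hu : IsEntropyWeakSolution S C a b T ubar ua ub u)
    (hΓ : ∀ t ∈ Icc 0 T, ∀ x ∈ Icc a b, u t x ∈ Γ) : IsWeakSolution Γ S.f a b T ubar u :=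
  ⟨hΓ, hu.measurable, hu.weak⟩

theorem isOneSided (hu : IsEntropyWeakSolution S C a b T ubar ua ub u)
    (hΓ : ∀ t ∈ Icc 0 T, ∀ x ∈ Icc a b, u t x ∈ Γ) {t : ℝ} (ht : t ∈ Ioc 0 T) :
    IsOneSided Γ S.w (S.entropyBound C a b t) a b (u t) := by
  refine ⟨(hu.integrable t ht).aestronglyMeasurable, ?_, fun i => ?_⟩
  · filter_upwards [ae_restrict_mem measurableSet_Icc] with x hx
    exact hΓ t (Ioc_subset_Icc_self ht) x hx
  · rcases lt_or_ge (i : ℕ) S.p with hi | hi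
    · filter_upwards [hu.entropy_space_neg i hi t ht] with q hq h1 h2 h3
      rw [S.entropyBound_sub_neg hi h2 h3]
      exact hq h1 h2 h3
    · filter_upwards [hu.entropy_space_pos i hi t ht] with q hq h1 h2 h3
      rw [S.entropyBound_sub_pos hi h1 h2]
      exact hq h1 h2 h3

theorem continuousOn_pairing (hu : IsEntropyWeakSolution S C a b T ubar ua ub u) {ψ : ℝ → ℝ}
    (hψ : IsTestFunction a b ψ) (e : EuclideanSpace ℝ (Fin n)) :
    ContinuousOn (fun t => ∫ x in Icc a b, ψ x * inner ℝ (u t x) e) (Ioc 0 T) := by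
  classical
  set V : ℝ → Lp (EuclideanSpace ℝ (Fin n)) 1 (volume.restrict (Icc a b)) := fun t =>
    if h : Integrable (u t) (volume.restrict (Icc a b)) then h.toL1 (u t) else 0 with hV
  have hVu : ∀ t ∈ Ioc 0 T, V t =ᵐ[volume.restrict (Icc a b)] u t := fun t ht => by
    simp only [hV, dif_pos (show Integrable (u t) (volume.restrict (Icc a b)) from
      hu.integrable t ht)]
    exact Integrable.coeFn_toL1 _
  have hVc : ContinuousOn V (Ioc 0 T) := by
    intro t₀ ht₀
    rw [ContinuousWithinAt, tendsto_iff_norm_sub_tendsto_zero]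
    refine (hu.continuous t₀ ht₀).congr' ?_
    filter_upwards [self_mem_nhdsWithin] with t ht
    exact (L1_norm_sub_eq (hVu t ht) (hVu t₀ ht₀)).symm
  refine ((continuous_pairing hψ e).comp_continuousOn hVc).congr fun t ht => ?_
  refine integral_congr_ae ?_
  filter_upwards [hVu t ht] with x hx
  rw [hx]

end IsEntropyWeakSolution

section Curves

variable {n : ℕ} {a b T : ℝ}

/-- Equi-Lipschitz curves (against test functions) with values in compact subsets `K t` of `L¹` have
a subsequence which converges at all times. -/
theorem exists_subseq_tendsto_curves
    {K : ℝ → Set (Lp (EuclideanSpace ℝ (Fin n)) 1 (volume.restrict (Icc a b)))}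
    (hK : ∀ t ∈ Ioc 0 T, IsCompact (K t))
    {V : ℕ → ℝ → Lp (EuclideanSpace ℝ (Fin n)) 1 (volume.restrict (Icc a b))}
    (hV : ∀ k, ∀ t ∈ Ioc 0 T, V k t ∈ K t)
    (hlip : ∀ ψ, IsTestFunction a b ψ → ∀ e : EuclideanSpace ℝ (Fin n), ∃ L : ℝ, 0 ≤ L ∧
      ∀ k, ∀ s ∈ Ioc 0 T, ∀ t ∈ Ioc 0 T, |(∫ x in Icc a b, ψ x * inner ℝ (V k t x) e) -
        ∫ x in Icc a b, ψ x * inner ℝ (V k s x) e| ≤ L * |t - s|) :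
    ∃ φ : ℕ → ℕ, StrictMono φ ∧ ∃ v : ℝ → Lp (EuclideanSpace ℝ (Fin n)) 1
      (volume.restrict (Icc a b)), ∀ t ∈ Ioc 0 T, v t ∈ K t ∧
        Tendsto (fun k => V (φ k) t) atTop (𝓝 (v t)) := by
  obtain ⟨D, hDT, hDc, hDd⟩ :=
    (TopologicalSpace.IsSeparable.of_separableSpace (Ioc 0 T)).exists_countable_dense_subset
  have : Countable D := hDc.to_subtype
  -- One subsequence converges in `L¹` at all times in `D`.
  obtain ⟨p, -, φ, hφ, hlim⟩ := (isCompact_univ_pi fun d : D => hK d (hDT d.2)).tendsto_subseq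
    (x := fun k (d : D) => V k d) fun k d _ => hV k d (hDT d.2)
  rw [tendsto_pi_nhds] at hlim
  have key : ∀ t ∈ Ioc 0 T, ∃ q ∈ K t, Tendsto (fun k => V (φ k) t) atTop (𝓝 q) := by
    intro t ht
    obtain ⟨q, hq, χ, hχ, hχlim⟩ := (hK t ht).tendsto_subseq fun k => hV (φ k) t ht
    refine ⟨q, hq, tendsto_L1_of_tendsto_pairing (hK t ht)
      (Eventually.of_forall fun k => hV (φ k) t ht) fun ψ hψ e => ?_⟩
    obtain ⟨L, hL, hLip⟩ := hlip ψ hψ e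
    set P : ℕ → ℝ → ℝ := fun k t => ∫ x in Icc a b, ψ x * inner ℝ (V (φ k) t x) e with hP
    -- The pairings are Cauchy at times in `D`, and equi-Lipschitz in time.
    have hcauchy : CauchySeq fun k => P k t := by
      rw [Metric.cauchySeq_iff]
      intro ε hε
      obtain ⟨d, hdD, hd⟩ := Metric.mem_closure_iff.1 (hDd ht) (ε / (3 * (L + 1))) (by positivity)
      have hdL : L * |t - d| < ε / 3 := by
        rw [Real.dist_eq, lt_div_iff₀ (by positivity)] at hd
        nlinarith [abs_nonneg (t - d)]
      have hc : CauchySeq fun k => P k d :=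
        (((continuous_pairing hψ e).tendsto _).comp (hlim ⟨d, hdD⟩)).cauchySeq
      obtain ⟨N, hN⟩ := Metric.cauchySeq_iff.1 hc (ε / 3) (by positivity)
      refine ⟨N, fun m hm k hk => ?_⟩
      have h1 := hN m hm k hk
      have h2 := hLip (φ m) d (hDT hdD) t ht
      have h3 := hLip (φ k) d (hDT hdD) t ht
      rw [Real.dist_eq, abs_lt] at h1 ⊢
      rw [abs_le] at h2 h3
      simp only [hP] at h1 ⊢
      constructor <;> linarith [h1.1, h1.2, h2.1, h2.2, h3.1, h3.2]
    obtain ⟨c, hc⟩ := cauchySeq_tendsto_of_complete hcauchy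
    have h1 := tendsto_nhds_unique (((continuous_pairing hψ e).tendsto q).comp hχlim)
      (hc.comp hχ.tendsto_atTop)
    rw [h1]
    exact hc
  choose! v hv hvlim using key
  exact ⟨φ, hφ, v, fun t ht => ⟨hv t ht, hvlim t ht⟩⟩

/-- A curve in `L¹` which is Lipschitz against test functions, and takes values in compact sets, is
continuous. -/
theorem continuousOn_of_pairing
    {K : ℝ → Set (Lp (EuclideanSpace ℝ (Fin n)) 1 (volume.restrict (Icc a b)))}
    (hK : ∀ t ∈ Ioc 0 T, IsCompact (K t))
    (hKanti : ∀ s ∈ Ioc 0 T, ∀ t ∈ Ioc 0 T, s ≤ t → K t ⊆ K s)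
    {v : ℝ → Lp (EuclideanSpace ℝ (Fin n)) 1 (volume.restrict (Icc a b))}
    (hv : ∀ t ∈ Ioc 0 T, v t ∈ K t)
    (hlip : ∀ ψ, IsTestFunction a b ψ → ∀ e : EuclideanSpace ℝ (Fin n), ∃ L : ℝ, 0 ≤ L ∧
      ∀ s ∈ Ioc 0 T, ∀ t ∈ Ioc 0 T, |(∫ x in Icc a b, ψ x * inner ℝ (v t x) e) -
        ∫ x in Icc a b, ψ x * inner ℝ (v s x) e| ≤ L * |t - s|) :
    ContinuousOn v (Ioc 0 T) := by
  intro t₀ ht₀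
  have hhalf : t₀ / 2 ∈ Ioc 0 T := ⟨half_pos ht₀.1, (half_le_self ht₀.1.le).trans ht₀.2⟩
  refine tendsto_L1_of_tendsto_pairing (hK _ hhalf) ?_ fun ψ hψ e => ?_
  · filter_upwards [self_mem_nhdsWithin,
      nhdsWithin_le_nhds (lt_mem_nhds (half_lt_self ht₀.1))] with t ht ht'
    exact hKanti _ hhalf t ht (le_of_lt ht') (hv t ht)
  · obtain ⟨L, hL, hLip⟩ := hlip ψ hψ e
    rw [tendsto_iff_dist_tendsto_zero]
    have h0 : Tendsto (fun t => L * |t - t₀|) (𝓝[Ioc 0 T] t₀) (𝓝 0) := by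
      have : Continuous fun t => L * |t - t₀| := by fun_prop
      simpa using (this.tendsto t₀).mono_left nhdsWithin_le_nhds
    refine squeeze_zero' (Eventually.of_forall fun _ => dist_nonneg) ?_ h0
    filter_upwards [self_mem_nhdsWithin] with t ht
    exact hLip t₀ ht₀ t ht

/-- The primitives `(t, x) ↦ ∫ₐˣ v(t)` of a continuous curve in `L¹` are jointly measurable. -/
theorem measurable_primitive
    {v : ℝ → Lp (EuclideanSpace ℝ (Fin n)) 1 (volume.restrict (Icc a b))}
    (hv : ContinuousOn v (Ioc 0 T)) :
    Measurable fun q : ℝ × ℝ => if q.1 ∈ Ioc 0 T then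
      ∫ r in a..q.2, (Icc a b).indicator (v q.1) r else 0 := by
  classical
  have hint : ∀ F : Lp (EuclideanSpace ℝ (Fin n)) 1 (volume.restrict (Icc a b)),
      Integrable ((Icc a b).indicator F) := fun F =>
    (integrable_indicator_iff measurableSet_Icc).2 (L1.integrable_coeFn F)
  have hswap : Measurable (Function.uncurry fun x t : ℝ => if t ∈ Ioc 0 T then
      ∫ r in a..x, (Icc a b).indicator (v t) r else 0) := by
    refine measurable_uncurry_of_continuous_of_measurable (fun t => ?_) fun x => ?_
    · by_cases ht : t ∈ Ioc 0 T
      · simp only [if_pos ht]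
        exact (hint (v t)).continuous_primitive a
      · simp only [if_neg ht]
        exact continuous_const
    · refine ContinuousOn.measurable_piecewise (s := Ioc 0 T)
        (f := fun t => ∫ r in a..x, (Icc a b).indicator (v t) r) (g := fun _ => 0)
        ?_ continuousOn_const measurableSet_Ioc
      intro t₀ ht₀
      rw [ContinuousWithinAt, tendsto_iff_norm_sub_tendsto_zero]
      refine squeeze_zero (fun _ => norm_nonneg _) (fun t => ?_)
        (tendsto_iff_norm_sub_tendsto_zero.1 (hv t₀ ht₀))
      rw [← intervalIntegral.integral_sub (hint _).intervalIntegrable (hint _).intervalIntegrable,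
        L1_norm_sub_eq (f := v t) (g := v t₀) EventuallyEq.rfl EventuallyEq.rfl]
      refine (intervalIntegral.norm_integral_le_integral_norm_uIoc).trans ?_
      have h1 : ∀ r, ‖(Icc a b).indicator (v t) r - (Icc a b).indicator (v t₀) r‖ =
          (Icc a b).indicator (fun r => ‖v t r - v t₀ r‖) r := fun r => by
        by_cases hr : r ∈ Icc a b <;> simp [hr]
      simp_rw [h1]
      rw [← integral_indicator (f := fun r => ‖v t r - v t₀ r‖) measurableSet_Icc]
      refine setIntegral_le_integral ((integrable_indicator_iff measurableSet_Icc).2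
        ((L1.integrable_coeFn _).sub (L1.integrable_coeFn _)).norm) (Eventually.of_forall fun r => ?_)
      exact indicator_nonneg (fun _ _ => norm_nonneg _) _
  exact hswap.comp measurable_swap

/-- A continuous curve of `L¹` functions satisfying one-sided estimates is represented by a jointly
measurable function which is right-continuous in space. -/
theorem exists_representative {Γ : Set (EuclideanSpace ℝ (Fin n))}
    {w : Fin n → EuclideanSpace ℝ (Fin n) → ℝ} {Θ : ℝ → Fin n → ℝ → ℝ}
    (hΓ : IsCompact Γ) (hne : Γ.Nonempty) (hw : ∀ i, ContinuousOn (w i) Γ)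
    (hinj : InjOn (fun u i => w i u) Γ) (hΘ : ∀ t i, ContinuousOn (Θ t i) (Ioo a b))
    {v : ℝ → Lp (EuclideanSpace ℝ (Fin n)) 1 (volume.restrict (Icc a b))}
    (hv : ContinuousOn v (Ioc 0 T)) (hone : ∀ t ∈ Ioc 0 T, IsOneSided Γ w (Θ t) a b (v t)) :
    ∃ u : ℝ → ℝ → EuclideanSpace ℝ (Fin n), (∀ t x, u t x ∈ Γ) ∧
      Measurable (fun q : ℝ × ℝ => u q.1 q.2) ∧
      (∀ t ∈ Ioc 0 T, v t =ᵐ[volume.restrict (Icc a b)] u t) ∧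
      ∀ t, ∀ x ∈ Ioo a b, ContinuousWithinAt (u t) (Ioi x) x := by
  classical
  obtain ⟨c, hc⟩ := hne
  choose! G hG hGv using fun t (ht : t ∈ Ioc 0 T) =>
    (hone t ht).exists_rightContinuous hΓ hw hinj (hΘ t)
  set A : Set (ℝ × ℝ) := Ioc 0 T ×ˢ Ioo a b with hA
  have hAm : MeasurableSet A := measurableSet_Ioc.prod measurableSet_Ioo
  set u : ℝ → ℝ → EuclideanSpace ℝ (Fin n) := fun t x => if (t, x) ∈ A then G t x else c with hu
  have huG : ∀ t ∈ Ioc 0 T, ∀ x ∈ Ioo a b, u t x = G t x := fun t ht x hx =>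
    if_pos (mk_mem_prod ht hx)
  -- Joint measurability: the right-continuous representative is the pointwise limit of the right
  -- difference quotients of the primitive `Φ`, which is jointly measurable.
  refine ⟨u, fun t x => ?_, ?_, fun t ht => ?_, fun t x hx => ?_⟩
  · by_cases h : (t, x) ∈ A
    · rw [huG t h.1 x h.2]
      exact (hG t h.1 x h.2).1
    · simp only [hu, if_neg h]
      exact hc
  · set Φ : ℝ × ℝ → EuclideanSpace ℝ (Fin n) := fun q => if q.1 ∈ Ioc 0 T then
      ∫ r in a..q.2, (Icc a b).indicator (v q.1) r else 0 with hΦ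
    have hΦm : Measurable Φ := measurable_primitive hv
    have hε : ∀ k : ℕ, (0 : ℝ) < 1 / ((k : ℝ) + 1) := fun k => Nat.one_div_pos_of_nat
    set F : ℕ → ℝ × ℝ → EuclideanSpace ℝ (Fin n) := fun k q => if q ∈ A then
      (1 / ((k : ℝ) + 1))⁻¹ • (Φ (q.1, q.2 + 1 / ((k : ℝ) + 1)) - Φ q) else c with hF
    have hFm : ∀ k, Measurable (F k) := by
      intro k
      have h1 : Measurable fun q : ℝ × ℝ => Φ (q.1, q.2 + 1 / ((k : ℝ) + 1)) :=
        hΦm.comp (measurable_fst.prodMk (measurable_snd.add_const _))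
      have h2 : Measurable fun q : ℝ × ℝ =>
          (1 / ((k : ℝ) + 1))⁻¹ • (Φ (q.1, q.2 + 1 / ((k : ℝ) + 1)) - Φ q) :=
        (h1.sub hΦm).const_smul (1 / ((k : ℝ) + 1))⁻¹
      exact Measurable.ite hAm h2 measurable_const
    refine measurable_of_tendsto_metrizable hFm ?_
    rw [tendsto_pi_nhds]
    rintro ⟨t, x⟩
    by_cases h : (t, x) ∈ A
    · obtain ⟨ht, hx⟩ : t ∈ Ioc 0 T ∧ x ∈ Ioo a b := h
      have hFval : ∀ k, F k (t, x) =
          (1 / ((k : ℝ) + 1))⁻¹ • (Φ (t, x + 1 / ((k : ℝ) + 1)) - Φ (t, x)) := fun k =>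
        if_pos (mk_mem_prod ht hx)
      rw [huG t ht x hx]
      have hto : Tendsto (fun k : ℕ => x + 1 / ((k : ℝ) + 1)) atTop (𝓝[>] x) := by
        refine tendsto_nhdsWithin_iff.2 ⟨?_, Eventually.of_forall fun k => ?_⟩
        · simpa using (tendsto_one_div_add_atTop_nhds_zero_nat (𝕜 := ℝ)).const_add x
        · exact lt_add_of_pos_right x (hε k)
      refine ((hG t ht x hx).2.1.comp hto).congr' ?_
      filter_upwards [hto.eventually (Ioc_mem_nhdsGT hx.2)] with k hk
      simp only [hFval, Function.comp_apply, hΦ, if_pos ht]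
      have hint : Integrable ((Icc a b).indicator (v t)) :=
        (integrable_indicator_iff measurableSet_Icc).2 (L1.integrable_coeFn (v t))
      rw [intervalIntegral.integral_interval_sub_left hint.intervalIntegrable
        hint.intervalIntegrable, intervalIntegral.integral_of_le hk.1.le,
        ← integral_Icc_eq_integral_Ioc, setAverage_eq, Real.volume_real_Icc_of_le hk.1.le,
        add_sub_cancel_left]
      congr 1
      refine setIntegral_congr_fun measurableSet_Icc fun r hr => ?_
      exact (indicator_of_mem (show r ∈ Icc a b from
        ⟨hx.1.le.trans hr.1, hr.2.trans hk.2⟩) _).symm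
    · simp only [hF, if_neg h, hu]
      exact tendsto_const_nhds
  · have h1 : ∀ᵐ x ∂(volume.restrict (Icc a b)), x ∈ Ioo a b := by
      rw [ae_restrict_Icc_iff]
      exact Eventually.of_forall fun x hx => hx
    filter_upwards [hGv t ht, h1] with x hx hxI
    rw [huG t ht x hxI, hx]
  · by_cases ht : t ∈ Ioc 0 T
    · refine ((hG t ht x hx).2.2).congr_of_eventuallyEq ?_ (huG t ht x hx)
      filter_upwards [nhdsWithin_le_nhds (isOpen_Ioo.mem_nhds hx)] with y hy using huG t ht y hy
    · have : u t = fun _ => c := funext fun y => if_neg fun h => ht h.1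
      rw [this]
      exact continuousWithinAt_const

end Curves

/-! ### Passage to the limit -/

section Limits

variable {n : ℕ} {Γ : Set (EuclideanSpace ℝ (Fin n))}
  {f : EuclideanSpace ℝ (Fin n) → EuclideanSpace ℝ (Fin n)} {a b T R : ℝ}
  {ubar : ℝ → EuclideanSpace ℝ (Fin n)}

/-- An injective continuous map on a compact set has a left inverse which is continuous on the
whole space. -/
theorem exists_continuous_leftInverse (hΓ : IsCompact Γ) (hf : ContinuousOn f Γ)
    (hinj : InjOn f Γ) :
    ∃ F : EuclideanSpace ℝ (Fin n) → EuclideanSpace ℝ (Fin n), Continuous F ∧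
      ∀ z ∈ Γ, F (f z) = z := by
  set g := Function.invFunOn f Γ with hg
  have hgΓ : ∀ y ∈ f '' Γ, g y ∈ Γ := fun y hy => Function.invFunOn_mem hy
  have hfg : ∀ y ∈ f '' Γ, f (g y) = y := fun y hy => Function.invFunOn_eq hy
  have hcont : ContinuousOn g (f '' Γ) := by
    intro y hy
    have hne : NeBot (𝓝[f '' Γ] y) := mem_closure_iff_nhdsWithin_neBot.1 (subset_closure hy)
    obtain ⟨z, -, hz⟩ := exists_tendsto_of_coords (l := 𝓝[f '' Γ] y) (ξ := g) hΓ
      (w := fun i u => f u i)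
      (fun i => (EuclideanSpace.proj i : EuclideanSpace ℝ (Fin n) →L[ℝ] ℝ).continuous.comp_continuousOn
        hf)
      (fun u hu v hv huv => hinj hu hv (by ext i; exact congrFun huv i))
      (eventually_nhdsWithin_of_forall hgΓ) fun i => by
        refine ⟨y i, Tendsto.congr' (f₁ := fun y' : EuclideanSpace ℝ (Fin n) => y' i) ?_ ?_⟩
        · filter_upwards [self_mem_nhdsWithin] with y' hy'
          rw [hfg y' hy']
        · exact ((EuclideanSpace.proj i : EuclideanSpace ℝ (Fin n) →L[ℝ] ℝ).continuous.tendsto y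
            ).mono_left nhdsWithin_le_nhds
    have : z = g y := tendsto_nhds_unique (hz.mono_left (pure_le_nhdsWithin hy))
      (tendsto_pure_nhds g y)
    rwa [this] at hz
  obtain ⟨F, hF, hFg⟩ := exists_continuous_extension (hΓ.image_of_continuousOn hf).isClosed hcont
  exact ⟨F, hF, fun z hz => by
    rw [hFg _ ⟨z, hz, rfl⟩]
    exact hinj (hgΓ _ ⟨z, hz, rfl⟩) hz (hfg _ ⟨z, hz, rfl⟩)⟩

/-- If the profiles converge in `L¹` at all times, a subsequence converges almost everywhere in
space and time. -/
theorem exists_subseq_tendsto_ae_prod (hR : ∀ z ∈ Γ, ‖z‖ ≤ R)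
    {u : ℕ → ℝ → ℝ → EuclideanSpace ℝ (Fin n)} {v : ℝ → ℝ → EuclideanSpace ℝ (Fin n)}
    (hu : ∀ k, ∀ t ∈ Icc 0 T, ∀ x ∈ Icc a b, u k t x ∈ Γ)
    (hum : ∀ k, AEStronglyMeasurable (fun q : ℝ × ℝ => u k q.1 q.2)
      (volume.restrict (Icc 0 T ×ˢ Icc a b)))
    (hv : ∀ t ∈ Icc 0 T, ∀ x ∈ Icc a b, v t x ∈ Γ)
    (hvm : AEStronglyMeasurable (fun q : ℝ × ℝ => v q.1 q.2)
      (volume.restrict (Icc 0 T ×ˢ Icc a b)))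
    (hlim : ∀ t ∈ Ioc 0 T, Tendsto (fun k => ∫ x in Icc a b, ‖u k t x - v t x‖) atTop (𝓝 0)) :
    ∃ χ : ℕ → ℕ, StrictMono χ ∧ ∀ᵐ q : ℝ × ℝ ∂(volume.restrict (Icc 0 T ×ˢ Icc a b)),
      Tendsto (fun k => u (χ k) q.1 q.2) atTop (𝓝 (v q.1 q.2)) := by
  have hfin : IsFiniteMeasure ((volume : Measure (ℝ × ℝ)).restrict (Icc 0 T ×ˢ Icc a b)) :=
    ⟨by rw [Measure.restrict_apply_univ]; exact (isCompact_Icc.prod isCompact_Icc).measure_lt_top⟩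
  have hle : ∀ k, ∀ t ∈ Icc 0 T, ∀ x ∈ Icc a b, ‖u k t x - v t x‖ ≤ R + R := fun k t ht x hx =>
    (norm_sub_le _ _).trans (add_le_add (hR _ (hu k t ht x hx)) (hR _ (hv t ht x hx)))
  have hint : ∀ k, Integrable (fun q : ℝ × ℝ => u k q.1 q.2 - v q.1 q.2)
      (volume.restrict (Icc 0 T ×ˢ Icc a b)) := by
    intro k
    refine Integrable.of_bound ((hum k).sub hvm) (R + R) ?_
    filter_upwards [ae_restrict_mem (measurableSet_Icc.prod measurableSet_Icc)] with q hq
    exact hle k _ hq.1 _ hq.2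
  have hdouble : ∀ k, ∫ q in Icc 0 T ×ˢ Icc a b, ‖u k q.1 q.2 - v q.1 q.2‖ =
      ∫ t in Icc 0 T, ∫ x in Icc a b, ‖u k t x - v t x‖ := by
    intro k
    have h := (hint k).norm
    rw [volume_restrict_prod] at h ⊢
    exact integral_prod _ h
  have hzero : Tendsto (fun k => ∫ q in Icc 0 T ×ˢ Icc a b, ‖u k q.1 q.2 - v q.1 q.2‖) atTop
      (𝓝 0) := by
    simp_rw [hdouble]
    have h := tendsto_integral_of_dominated_convergence (μ := volume.restrict (Icc 0 T))
      (F := fun k t => ∫ x in Icc a b, ‖u k t x - v t x‖) (f := fun _ => (0 : ℝ))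
      (fun _ => (R + R) * volume.real (Icc a b)) (fun k => by
        have h := (hint k).norm
        rw [volume_restrict_prod] at h
        exact h.integral_prod_left.aestronglyMeasurable) (integrable_const _) (fun k => by
        filter_upwards [ae_restrict_mem measurableSet_Icc] with t ht
        refine norm_setIntegral_le_of_norm_le_const (by simp) fun x hx => ?_
        rw [norm_norm]
        exact hle k t ht x hx) (by
        rw [ae_restrict_Icc_iff]
        exact Eventually.of_forall fun t ht => hlim t (Ioo_subset_Ioc_self ht))
    simpa using h
  refine (tendstoInMeasure_of_tendsto_eLpNorm (p := 1) one_ne_zero hum hvm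
    ?_).exists_seq_tendsto_ae
  have h := ENNReal.tendsto_ofReal hzero
  rw [ENNReal.ofReal_zero] at h
  refine h.congr fun k => ?_
  rw [eLpNorm_one_eq_lintegral_enorm, ofReal_integral_norm_eq_lintegral_enorm (hint k)]
  rfl

theorem IsWeakSolution.of_tendsto (hΓ : IsCompact Γ) (hf : ContinuousOn f Γ)
    {u : ℕ → ℝ → ℝ → EuclideanSpace ℝ (Fin n)} {v : ℝ → ℝ → EuclideanSpace ℝ (Fin n)}
    (hu : ∀ k, IsWeakSolution Γ f a b T ubar (u k))
    (hv : ∀ t ∈ Icc 0 T, ∀ x ∈ Icc a b, v t x ∈ Γ)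
    (hlim : ∀ᵐ q : ℝ × ℝ ∂(volume.restrict (Icc 0 T ×ˢ Icc a b)),
      Tendsto (fun k => u k q.1 q.2) atTop (𝓝 (v q.1 q.2))) :
    IsWeakSolution Γ f a b T ubar v := by
  have hvm : AEStronglyMeasurable (fun q : ℝ × ℝ => v q.1 q.2)
      (volume.restrict (Icc 0 T ×ˢ Icc a b)) :=
    aestronglyMeasurable_of_tendsto_ae atTop (fun k => (hu k).measurable) hlim
  refine ⟨hv, hvm, fun φ hφ hc hs => ?_⟩
  obtain ⟨R, hR⟩ := hΓ.isBounded.exists_norm_le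
  obtain ⟨R', hR'⟩ := (hΓ.image_of_continuousOn hf).isBounded.exists_norm_le
  have hrect : ∀ᵐ q : ℝ × ℝ ∂(volume.restrict (Icc 0 T ×ˢ Icc a b)),
      q.1 ∈ Icc 0 T ∧ q.2 ∈ Icc a b :=
    ae_restrict_mem (measurableSet_Icc.prod measurableSet_Icc)
  have hcd : ∀ d : ℝ × ℝ, Continuous fun q => fderiv ℝ φ q d := fun d =>
    (hφ.continuous_fderiv one_ne_zero).clm_apply continuous_const
  set B : ℝ × ℝ → ℝ := fun q => R * ‖fderiv ℝ φ q (1, 0)‖ + R' * ‖fderiv ℝ φ q (0, 1)‖ with hB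
  have hBi : IntegrableOn B (Icc 0 T ×ˢ Icc a b) :=
    (((hcd _).norm.const_mul R).add ((hcd _).norm.const_mul R')).continuousOn.integrableOn_compact
      (isCompact_Icc.prod isCompact_Icc)
  have hle : ∀ z ∈ Γ, ∀ q, ‖(inner ℝ z (fderiv ℝ φ q (1, 0)) +
      inner ℝ (f z) (fderiv ℝ φ q (0, 1)) : ℝ)‖ ≤ B q := fun z hz q =>
    (norm_add_le _ _).trans (add_le_add
      ((norm_inner_le_norm _ _).trans (mul_le_mul_of_nonneg_right (hR z hz) (norm_nonneg _)))
      ((norm_inner_le_norm _ _).trans (mul_le_mul_of_nonneg_right (hR' _ ⟨z, hz, rfl⟩)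
        (norm_nonneg _))))
  have hlimI : ∀ᵐ q : ℝ × ℝ ∂(volume.restrict (Icc 0 T ×ˢ Icc a b)),
      Tendsto (fun k => inner ℝ (u k q.1 q.2) (fderiv ℝ φ q (1, 0)) +
        inner ℝ (f (u k q.1 q.2)) (fderiv ℝ φ q (0, 1))) atTop
        (𝓝 (inner ℝ (v q.1 q.2) (fderiv ℝ φ q (1, 0)) +
        inner ℝ (f (v q.1 q.2)) (fderiv ℝ φ q (0, 1)))) := by
    filter_upwards [hlim, hrect] with q hq hq'
    have h1 := (hf _ (hv _ hq'.1 _ hq'.2)).tendsto.comp (tendsto_nhdsWithin_iff.2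
      ⟨hq, Eventually.of_forall fun k => (hu k).mem _ hq'.1 _ hq'.2⟩)
    exact (hq.inner tendsto_const_nhds).add (h1.inner tendsto_const_nhds)
  have hmk : ∀ k, AEStronglyMeasurable (fun q : ℝ × ℝ =>
      (inner ℝ (u k q.1 q.2) (fderiv ℝ φ q (1, 0)) +
        inner ℝ (f (u k q.1 q.2)) (fderiv ℝ φ q (0, 1)) : ℝ))
      (volume.restrict (Icc 0 T ×ˢ Icc a b)) := fun k =>
    ((hu k).weak φ hφ hc hs).1.aestronglyMeasurable
  have hdct := tendsto_integral_of_dominated_convergence B hmk hBi (fun k => by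
    filter_upwards [hrect] with q hq
    exact hle _ ((hu k).mem _ hq.1 _ hq.2) q) hlimI
  refine ⟨hBi.mono' (aestronglyMeasurable_of_tendsto_ae atTop hmk hlimI) ?_, ?_⟩
  · filter_upwards [hrect] with q hq
    exact hle _ (hv _ hq.1 _ hq.2) q
  · have h1 := hdct.add_const (∫ x in Icc a b, inner ℝ (ubar x) (φ (0, x)))
    refine tendsto_nhds_unique h1 (tendsto_const_nhds.congr fun k => ?_)
    exact ((hu k).weak φ hφ hc hs).2.symm

/-- A property of pairs of times passes to almost everywhere limits. -/
theorem ae_pairs_le_of_tendsto {W : EuclideanSpace ℝ (Fin n) → ℝ} (hW : ContinuousOn W Γ)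
    {u : ℕ → ℝ → ℝ → EuclideanSpace ℝ (Fin n)} {v : ℝ → ℝ → EuclideanSpace ℝ (Fin n)}
    (hu : ∀ k, ∀ t ∈ Icc 0 T, ∀ x ∈ Icc a b, u k t x ∈ Γ)
    (hv : ∀ t ∈ Icc 0 T, ∀ x ∈ Icc a b, v t x ∈ Γ)
    (hlim : ∀ᵐ q : ℝ × ℝ ∂(volume.restrict (Icc 0 T ×ˢ Icc a b)),
      Tendsto (fun k => u k q.1 q.2) atTop (𝓝 (v q.1 q.2)))
    {σ : ℝ} {β : ℝ → ℝ × ℝ → ℝ}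
    (hle : ∀ k, ∀ᵐ x : ℝ, a < x → x < b → ∀ᵐ τ : ℝ × ℝ, 0 < τ.1 → τ.1 < τ.2 → τ.2 ≤ T →
      σ * (W (u k τ.2 x) - W (u k τ.1 x)) ≤ β x τ) :
    ∀ᵐ x : ℝ, a < x → x < b → ∀ᵐ τ : ℝ × ℝ, 0 < τ.1 → τ.1 < τ.2 → τ.2 ≤ T →
      σ * (W (v τ.2 x) - W (v τ.1 x)) ≤ β x τ := by
  have hx : ∀ᵐ x, x ∈ Ioo a b → ∀ᵐ t, t ∈ Icc 0 T →
      Tendsto (fun k => u k t x) atTop (𝓝 (v t x)) := by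
    have h1 : ∀ᵐ q : ℝ × ℝ, q ∈ Icc 0 T ×ˢ Icc a b →
        Tendsto (fun k => u k q.1 q.2) atTop (𝓝 (v q.1 q.2)) :=
      (ae_restrict_iff' (measurableSet_Icc.prod measurableSet_Icc)).1 hlim
    have h2 := (Measure.measurePreserving_swap (μ := (volume : Measure ℝ))
      (ν := (volume : Measure ℝ))).quasiMeasurePreserving.ae h1
    filter_upwards [Measure.ae_ae_of_ae_prod h2] with x hx hxI
    filter_upwards [hx] with t ht htI
    exact ht ⟨htI, Ioo_subset_Icc_self hxI⟩
  filter_upwards [hx, ae_all_iff.2 hle] with x hx hlex hax hxb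
  have hxI : x ∈ Ioo a b := ⟨hax, hxb⟩
  have hpt : ∀ᵐ t, t ∈ Icc 0 T → Tendsto (fun k => W (u k t x)) atTop (𝓝 (W (v t x))) := by
    filter_upwards [hx hxI] with t ht htI
    exact (hW _ (hv t htI x (Ioo_subset_Icc_self hxI))).tendsto.comp (tendsto_nhdsWithin_iff.2
      ⟨ht htI, Eventually.of_forall fun k => hu k t htI x (Ioo_subset_Icc_self hxI)⟩)
  filter_upwards [ae_all_iff.2 fun k => hlex k hax hxb,
    Measure.quasiMeasurePreserving_fst.ae hpt, Measure.quasiMeasurePreserving_snd.ae hpt]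
    with τ hτ h1 h2 hτ1 hτ12 hτ2
  exact le_of_tendsto (((h2 ⟨(hτ1.trans hτ12).le, hτ2⟩).sub
    (h1 ⟨hτ1.le, hτ12.le.trans hτ2⟩)).const_mul σ)
    (Eventually.of_forall fun k => hτ k hτ1 hτ12 hτ2)

/-- The fluxes of a weak solution with values in `Γ`, right-continuous in space, have weak* traces
with values in `f(Γ)`; these are the fluxes of bounded measurable functions with values in `Γ`. -/
theorem IsWeakSolution.exists_trace (hΓ : IsCompact Γ) (hf : ContinuousOn f Γ) (hinj : InjOn f Γ)
    (hconv : Convex ℝ (f '' Γ)) {u : ℝ → ℝ → EuclideanSpace ℝ (Fin n)}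
    (hu : IsWeakSolution Γ f a b T ubar u) (huΓ : ∀ t x, u t x ∈ Γ)
    (hum : Measurable fun q : ℝ × ℝ => u q.1 q.2)
    (hrc : ∀ t, ∀ x ∈ Ioo a b, ContinuousWithinAt (u t) (Ioi x) x)
    {x₀ : ℝ} {l : Filter ℝ} [NeBot l] (hl : l ≤ 𝓝[Ioo a b] x₀) :
    ∃ uc, IsDatum Γ (Icc 0 T) uc ∧ ∃ Ψ, HasWeakStarTrace T (fun t x => f (u t x)) l Ψ ∧
      ∀ᵐ t ∂(volume.restrict (Icc 0 T)), uc t ∈ Γ ∧ Ψ t = f (uc t) := by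
  obtain ⟨R₁, hR₁⟩ := hΓ.isBounded.exists_norm_le
  obtain ⟨R₂, hR₂⟩ := (hΓ.image_of_continuousOn hf).isBounded.exists_norm_le
  set R := max R₁ R₂
  have hR : ∀ z ∈ Γ, ‖z‖ ≤ R := fun z hz => (hR₁ z hz).trans (le_max_left _ _)
  have hRf : ∀ z ∈ Γ, ‖f z‖ ≤ R := fun z hz => (hR₂ _ ⟨z, hz, rfl⟩).trans (le_max_right _ _)
  have hR0 : 0 ≤ R := (norm_nonneg _).trans (hR _ (huΓ 0 0))
  obtain ⟨f', hf', hff'⟩ := exists_continuous_extension hΓ.isClosed hf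
  -- The boundary datum is `F ∘ Ψ`, where `F` is a continuous left inverse of `f` on `Γ`.
  obtain ⟨F, hF, hFf⟩ := exists_continuous_leftInverse hΓ hf hinj
  have hm : ∀ x, AEStronglyMeasurable (fun t => f (u t x)) (volume.restrict (Icc 0 T)) := by
    intro x
    have h1 : Measurable fun t => f' (u t x) :=
      hf'.measurable.comp (hum.comp (measurable_id.prodMk measurable_const))
    have h2 : (fun t => f (u t x)) = fun t => f' (u t x) :=
      funext fun t => (hff' _ (huΓ t x)).symm
    rw [h2]
    exact h1.aestronglyMeasurable
  obtain ⟨Ψ, hΨ, hΨΓ⟩ := exists_weakStarTrace (T := T) (l := l) (v := fun t x => f (u t x))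
    (hΓ.image_of_continuousOn hf) hconv
    (Eventually.of_forall fun x => ⟨hm x, fun t => ⟨_, huΓ t x, rfl⟩⟩) fun ψ hψ e => by
      obtain ⟨c, hc⟩ := hu.exists_tendsto_pairing_flux hΓ hf hR0 hR hRf (fun x _ => hm x)
        (fun t _ => hrc t) hψ e x₀
      exact ⟨c, hc.mono_left hl⟩
  have hval : ∀ᵐ t ∂(volume.restrict (Icc 0 T)), F (Ψ t) ∈ Γ ∧ Ψ t = f (F (Ψ t)) := by
    filter_upwards [hΨΓ] with t ht
    obtain ⟨z, hz, hzt⟩ := ht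
    rw [← hzt, hFf z hz]
    exact ⟨hz, rfl⟩
  exact ⟨fun t => F (Ψ t), ⟨hF.comp_aestronglyMeasurable hΨ.1.aestronglyMeasurable,
    hval.mono fun t ht => ht.1⟩, Ψ, hΨ, hval⟩

end Limits

/-! ### Compactness of the attainable set -/

/-- Solutions with values in a compact convex box have a subsequence whose profiles converge in `L¹`
at all times; the limits are the profiles of another solution, for suitable boundary data. -/
theorem exists_subseq_limit_solution {n : ℕ} (S : TempleSystem n) {α β : Fin n → ℝ}
    (hconvex : Convex ℝ (S.box α β)) (hcompact : IsCompact (S.box α β)) {a b : ℝ} (hab : a < b)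
    {ubar : ℝ → EuclideanSpace ℝ (Fin n)} {C : ℝ} (hC : 0 < C) {T : ℝ} (hT : 0 < T)
    {ua ub : ℕ → ℝ → EuclideanSpace ℝ (Fin n)} {u : ℕ → ℝ → ℝ → EuclideanSpace ℝ (Fin n)}
    (hu : ∀ k, IsEntropyWeakSolution S C a b T ubar (ua k) (ub k) (u k))
    (huΓ : ∀ k, ∀ t ∈ Icc 0 T, ∀ x ∈ Icc a b, u k t x ∈ S.box α β) :
    ∃ φ : ℕ → ℕ, StrictMono φ ∧ ∃ va vb v, IsDatum (S.box α β) (Icc 0 T) va ∧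
      IsDatum (S.box α β) (Icc 0 T) vb ∧ IsEntropyWeakSolution S C a b T ubar va vb v ∧
      (∀ t ∈ Icc 0 T, ∀ x ∈ Icc a b, v t x ∈ S.box α β) ∧
      ∀ t ∈ Ioc 0 T, Tendsto (fun k => ∫ x in Icc a b, ‖u (φ k) t x - v t x‖) atTop (𝓝 0) := by
  classical
  set Γ := S.box α β with hΓdef
  have hw : ∀ i, ContinuousOn (S.w i) Γ := fun i => (S.continuousOn_w i).mono S.box_subset
  have hwinj : InjOn (fun u i => S.w i u) Γ := S.injOn_w.mono S.box_subset
  have hf : ContinuousOn S.f Γ := S.continuousOn_f.mono S.box_subset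
  have hne : Γ.Nonempty := ⟨_, huΓ 0 0 ⟨le_rfl, hT.le⟩ a ⟨le_rfl, hab.le⟩⟩
  obtain ⟨R₁, hR₁⟩ := hcompact.isBounded.exists_norm_le
  obtain ⟨R₂, hR₂⟩ := (hcompact.image_of_continuousOn hf).isBounded.exists_norm_le
  set R := max R₁ R₂
  have hR : ∀ z ∈ Γ, ‖z‖ ≤ R := fun z hz => (hR₁ z hz).trans (le_max_left _ _)
  have hRf : ∀ z ∈ Γ, ‖S.f z‖ ≤ R := fun z hz => (hR₂ _ ⟨z, hz, rfl⟩).trans (le_max_right _ _)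
  have hR0 : 0 ≤ R := hne.elim fun z hz => (norm_nonneg _).trans (hR z hz)
  have hweak : ∀ k, IsWeakSolution Γ S.f a b T ubar (u k) := fun k =>
    (hu k).isWeakSolution (huΓ k)
  set Θ : ℝ → Fin n → ℝ → ℝ := fun t => S.entropyBound C a b t with hΘ
  set K : ℝ → Set (Lp (EuclideanSpace ℝ (Fin n)) 1 (volume.restrict (Icc a b))) := fun t =>
    {F | IsOneSided Γ S.w (Θ t) a b F} with hKdef
  have hK : ∀ t ∈ Ioc 0 T, IsCompact (K t) := fun t _ =>
    isCompact_setOf_isOneSided hcompact hw hwinj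
  -- The default value `0` is not used for `t ∈ ]0,T]`, where all profiles are integrable.
  set V : ℕ → ℝ → Lp (EuclideanSpace ℝ (Fin n)) 1 (volume.restrict (Icc a b)) := fun k t =>
    if h : Integrable (u k t) (volume.restrict (Icc a b)) then h.toL1 (u k t) else 0 with hV
  have hVu : ∀ k, ∀ t ∈ Ioc 0 T, V k t =ᵐ[volume.restrict (Icc a b)] u k t := fun k t ht => by
    simp only [hV, dif_pos (show Integrable (u k t) (volume.restrict (Icc a b)) from
      (hu k).integrable t ht)]
    exact Integrable.coeFn_toL1 _
  have hVK : ∀ k, ∀ t ∈ Ioc 0 T, V k t ∈ K t := fun k t ht =>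
    ((hu k).isOneSided (huΓ k) ht).congr (hVu k t ht).symm
  have hVpair : ∀ k, ∀ t ∈ Ioc 0 T, ∀ (ψ : ℝ → ℝ) (e : EuclideanSpace ℝ (Fin n)),
      ∫ x in Icc a b, ψ x * inner ℝ (V k t x) e = ∫ x in Icc a b, ψ x * inner ℝ (u k t x) e := by
    intro k t ht ψ e
    refine integral_congr_ae ?_
    filter_upwards [hVu k t ht] with x hx
    rw [hx]
  have hVlip : ∀ ψ, IsTestFunction a b ψ → ∀ e : EuclideanSpace ℝ (Fin n), ∃ L : ℝ, 0 ≤ L ∧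
      ∀ k, ∀ s ∈ Ioc 0 T, ∀ t ∈ Ioc 0 T, |(∫ x in Icc a b, ψ x * inner ℝ (V k t x) e) -
        ∫ x in Icc a b, ψ x * inner ℝ (V k s x) e| ≤ L * |t - s| := by
    intro ψ hψ e
    refine ⟨R * ‖e‖ * ∫ x in Icc a b, |deriv ψ x|, by positivity, fun k s hs t ht => ?_⟩
    rw [hVpair k t ht, hVpair k s hs]
    exact (hweak k).abs_pairing_sub_le hcompact hf hR0 hR hRf hψ e
      ((hu k).continuousOn_pairing hψ e) hs ht
  obtain ⟨φ, hφ, p, hp⟩ := exists_subseq_tendsto_curves hK hVK hVlip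
  have hpc : ContinuousOn p (Ioc 0 T) := by
    refine continuousOn_of_pairing hK (fun s hs t _ hst F hF => ?_) (fun t ht => (hp t ht).1)
      fun ψ hψ e => ?_
    · exact IsOneSided.mono_right hF fun i x y _ hxy _ =>
        S.entropyBound_sub_anti hC hs.1 hst i hxy
    · obtain ⟨L, hL, hLip⟩ := hVlip ψ hψ e
      refine ⟨L, hL, fun s hs t ht => ?_⟩
      have hc := continuous_pairing hψ e
      exact le_of_tendsto ((((hc.tendsto _).comp (hp t ht).2).sub
        ((hc.tendsto _).comp (hp s hs).2)).abs) (Eventually.of_forall fun k => hLip (φ k) s hs t ht)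
  obtain ⟨v, hvΓ, hvm, hpv, hvrc⟩ := exists_representative hcompact hne hw hwinj
    (Θ := Θ) (fun t i => S.continuousOn_entropyBound i) hpc fun t ht => (hp t ht).1
  have hvΓ' : ∀ t ∈ Icc 0 T, ∀ x ∈ Icc a b, v t x ∈ Γ := fun t _ x _ => hvΓ t x
  have hconv : ∀ t ∈ Ioc 0 T,
      Tendsto (fun k => ∫ x in Icc a b, ‖u (φ k) t x - v t x‖) atTop (𝓝 0) := by
    intro t ht
    refine (tendsto_iff_norm_sub_tendsto_zero.1 (hp t ht).2).congr fun k => ?_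
    exact L1_norm_sub_eq (hVu (φ k) t ht) (hpv t ht)
  obtain ⟨χ, hχ, hae⟩ := exists_subseq_tendsto_ae_prod (u := fun k => u (φ k)) hR
    (fun k => huΓ (φ k)) (fun k => (hu (φ k)).measurable) hvΓ' hvm.aestronglyMeasurable hconv
  have hvweak : IsWeakSolution Γ S.f a b T ubar v :=
    IsWeakSolution.of_tendsto hcompact hf (u := fun k => u (φ (χ k)))
      (fun k => hweak (φ (χ k))) hvΓ' hae
  have hfinj := S.injOn_f hconvex hcompact
  have hfconv := S.convex_image_f hconvex hcompact
  obtain ⟨va, hva, Ψa, hΨa, hvaΨ⟩ := hvweak.exists_trace hcompact hf hfinj hfconv hvΓ hvm hvrc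
    (x₀ := a) (l := 𝓝[>] a) (by rw [nhdsWithin_Ioo_eq_nhdsGT hab])
  obtain ⟨vb, hvb, Ψb, hΨb, hvbΨ⟩ := hvweak.exists_trace hcompact hf hfinj hfconv hvΓ hvm hvrc
    (x₀ := b) (l := 𝓝[<] b) (by rw [nhdsWithin_Ioo_eq_nhdsLT hab])
  have hvone : ∀ t ∈ Ioc 0 T, IsOneSided Γ S.w (S.entropyBound C a b t) a b (v t) := fun t ht =>
    (hp t ht).1.congr (hpv t ht)
  -- The further subsequence `χ` serves only to identify `v` as a solution; the convergence at each
  -- time is along `φ`.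
  refine ⟨φ, hφ, va, vb, v, hva, hvb, ?_, hvΓ', hconv⟩
  refine
    { mem_U := fun t _ x _ => S.box_subset (hvΓ t x)
      measurable := hvm.aestronglyMeasurable
      integrable := fun t ht => (hvone t ht).integrableOn hcompact
      continuous := fun t₀ ht₀ => ?_
      weak := hvweak.weak
      trace_left := ⟨Ψa, hΨa, ?_⟩
      trace_right := ⟨Ψb, hΨb, ?_⟩
      entropy_space_neg := fun i hi t ht => ?_
      entropy_space_pos := fun i hi t ht => ?_
      entropy_time_neg := fun i hi => ?_
      entropy_time_pos := fun i hi => ?_ }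
  · refine (tendsto_iff_norm_sub_tendsto_zero.1 (hpc t₀ ht₀)).congr' ?_
    filter_upwards [self_mem_nhdsWithin] with t ht
    exact L1_norm_sub_eq (hpv t ht) (hpv t₀ ht₀)
  · filter_upwards [hvaΨ] with t ht
    exact ⟨va t, S.self_mem_admissibleLeft (S.box_subset ht.1), ht.2.symm⟩
  · filter_upwards [hvbΨ] with t ht
    exact ⟨vb t, S.self_mem_admissibleRight (S.box_subset ht.1), ht.2.symm⟩
  · filter_upwards [(hvone t ht).le i] with q hq h1 h2 h3
    rw [← S.entropyBound_sub_neg hi h2 h3]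
    exact hq h1 h2 h3
  · filter_upwards [(hvone t ht).le i] with q hq h1 h2 h3
    rw [← S.entropyBound_sub_pos hi h1 h2]
    exact hq h1 h2 h3
  · have h := ae_pairs_le_of_tendsto (hw i) (u := fun k => u (φ (χ k))) (v := v)
      (fun k => huΓ (φ (χ k))) hvΓ' hae (σ := 1)
      (β := fun x τ => C * ((τ.2 - τ.1) / (b - x) + Real.log (τ.2 / τ.1))) fun k => by
        simpa only [one_mul] using (hu (φ (χ k))).entropy_time_neg i hi
    simpa only [one_mul] using h
  · have h := ae_pairs_le_of_tendsto (hw i) (u := fun k => u (φ (χ k))) (v := v)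
      (fun k => huΓ (φ (χ k))) hvΓ' hae (σ := -1)
      (β := fun x τ => C * ((τ.2 - τ.1) / (x - a) + Real.log (τ.2 / τ.1))) fun k => by
        simpa only [neg_mul, one_mul, neg_sub] using (hu (φ (χ k))).entropy_time_pos i hi
    simpa only [neg_mul, one_mul, neg_sub] using h

theorem theorem2 {n : ℕ} (S : TempleSystem n) (α β : Fin n → ℝ)
    (hconvex : Convex ℝ (S.box α β)) (hcompact : IsCompact (S.box α β))
    (a b : ℝ) (hab : a < b)
    (ubar : ℝ → EuclideanSpace ℝ (Fin n)) (hubar : IsDatum (S.box α β) (Icc a b) ubar)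
    (C : ℝ) (hC : 0 < C) (T : ℝ) (hT : 0 < T) :
    IsCompact (attainableSet S (S.box α β) C a b T ubar) ∧
      ∀ g ∈ attainableSet S (S.box α β) C a b T ubar,
        ∀ᵐ x ∂(volume.restrict (Icc a b)), g x ∈ S.box α β := by
  constructor
  · refine IsSeqCompact.isCompact fun g hg => ?_
    choose ua ub u _ _ hu huΓ hgu using hg
    obtain ⟨φ, hφ, va, vb, v, hva, hvb, hv, hvΓ, hlim⟩ :=
      exists_subseq_limit_solution S hconvex hcompact hab hC hT hu huΓ
    have hTT : T ∈ Ioc 0 T := ⟨hT, le_rfl⟩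
    have hint : Integrable (v T) (volume.restrict (Icc a b)) := hv.integrable T hTT
    refine ⟨hint.toL1 (v T), ⟨va, vb, v, hva, hvb, hv, hvΓ, hint.coeFn_toL1⟩, φ, hφ, ?_⟩
    rw [tendsto_iff_norm_sub_tendsto_zero]
    exact (hlim T hTT).congr fun k => (L1_norm_sub_eq (hgu (φ k)) hint.coeFn_toL1).symm
  · rintro g ⟨ua, ub, u, -, -, -, huΓ, hgu⟩
    filter_upwards [hgu, ae_restrict_mem measurableSet_Icc] with x hx hxI
    rw [hx]
    exact huΓ T ⟨hT.le, le_rfl⟩ x hxI
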